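/- **Problem.** Let $n\ge 0$, $p\ge1$, let $X_0\subset\mathbb R^n$ be nonempty, closed and convex, $\mathcal O_0\supset X_0$ open and convex, $\xi$ a random element of $\Xi$ with law $P$, and $F,G_1,\dots,G_p:\mathcal O_0\times\Xi\to\mathbb R$ measurable in $\xi$ and differentiable in $x$, such that $f(x)=\mathbb E F(x,\xi)$ and $g_i(x)=\mathbb E\,G_i(x,\xi)$ are finite on $\mathcal O_0$. Put $G=(G_1,\dots,G_p)$, $g=(g_1,\dots,g_p)$ and $L(x,\lambda)=f(x)+\sum_j\lambda_jg_j(x)$. Suppose there are positive constants $D_0,\nu_g,\kappa_f,\kappa_g,\epsilon_0,L_0,\dots,L_p$ such that $\|x-z\|\le D_0$ on $X_0$; $\|G(x,\xi)\|\le\nu_g$, $\|\nabla_xF(x,\xi)\|\le\kappa_f$ and $\|\nabla_xG_i(x,\xi)\|\le\kappa_g$ on $\mathcal O_0\times\Xi$; $g_i(\hat x)\le-\epsilon_0$ for all $i$, for some $\hat x\in X_0$; and, for every $\xi\in\Xi$, $F(\cdot,\xi)+\frac{L_0}{2}\|\cdot\|^2$ and $G_i(\cdot,\xi)+\frac{L_i}{2}\|\cdot\|^2$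 are convex on $\mathcal O_0$. **Algorithm (PMQSopt).** Let $\xi_1,\dots,\xi_T$ be i.i.d. with law $P$, $x^1\in X_0$ deterministic, $\lambda^1=0\in\mathbb R^p$. In step $t=1,\dots,T$ choose symmetric matrices $\Sigma_i^t$ ($1\le i\le p$), measurable functions of $\xi_1,\dots,\xi_t$, put $\Sigma_0^t=-\sum_{i=1}^p\lambda_i^t\Sigma_i^t+\tau I$, let $$q_0^t(x)=F(x^t,\xi_t)+\langle\nabla_xF(x^t,\xi_t),x-x^t\rangle+\tfrac12\langle\Sigma_0^t(x-x^t),x-x^t\rangle,$$ $$q_i^t(x)=G_i(x^t,\xi_t)+\langle\nabla_xG_i(x^t,\xi_t),x-x^t\rangle+\tfrac12\langle\Sigma_i^t(x-x^t),x-x^t\rangle,$$ let $x^{t+1}$, a measurable function of $\xi_1,\dots,\xi_t$, minimize $$q_0^t(x)+\frac1{2\sigma}\Big(\sum_{i=1}^p[\lambda_i^t+\sigma q_i^t(x)]_+^2-\|\lambda^t\|^2\Big)+\frac\alpha2\|x-x^t\|^2$$ over $x\in X_0$, and put $\lambda_i^{t+1}=[\lambda_i^t+\sigma q_i^t(x^{t+1})]_+$.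 The output is $(x^R,\lambda^R)$ with $R$ uniform on $\{1,\dots,T\}$ and independent of $\xi_1,\dots,\xi_T$. **Constants.** For a number $\kappa_\Sigma>0$ put $\gamma_1=\nu_g+\sqrt p\,(\kappa_gD_0+\frac12\kappa_\Sigma D_0^2)$, $\gamma_2=\nu_g+\kappa_gD_0+\frac12\kappa_\Sigma D_0^2$, $\kappa_0=\frac{4\kappa_fD_0}{\epsilon_0}$, $\kappa_1=\frac{2D_0^2}{\epsilon_0}$, $\kappa_3=\frac{2\nu_g^2}{\epsilon_0}-\gamma_1$, $\kappa_4=2\gamma_1+\frac{\epsilon_0}{4}+\frac{16\gamma_1^2}{\epsilon_0}\log\frac{128\gamma_1^2}{\epsilon_0^2}$, $\gamma_3=\kappa_0+\kappa_1+\kappa_3+\kappa_4$, and, with $\Gamma(a,b)=\int_b^\infty t^{a-1}e^{-t}\,dt$, $$\gamma_4=\gamma_3^2+32\gamma_3\frac{\gamma_1^2}{\epsilon_0}+256\frac{\gamma_1^4}{\epsilon_0^2}+2\sigma\nu_g\Big[\gamma_3+16\frac{\gamma_1^2}{\epsilon_0}\Big]+\nu_g^2+2\nu_g^2\big[\Gamma(6,1)+2\Gamma(4,1)+\Gamma(2,1)\big],$$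 $\beta=2\big[L_0+\sum_{j=1}^p\gamma_2L_j\big]+1$, $\rho_1=(2\kappa_g+\kappa_\Sigma D_0)\kappa_f$, $\rho_2=(2\kappa_g+\kappa_\Sigma D_0)(\kappa_g+\frac12\kappa_\Sigma D_0)\sqrt p$, $\gamma_5=\gamma_3+\frac1\beta[\rho_1+(\nu_g+\gamma_3)\rho_2]$. **Claim.** Let $\sigma=T^{-3/4}$, $\alpha=\beta T^{1/4}$, $\tau=T^{1/2}$, let $\Sigma_i^t\preceq-L_iI$ and $\|\Sigma_i^t\|\le\kappa_\Sigma$ (spectral norm) for all $t\in\{1,\dots,T\}$ and $i\in\{1,\dots,p\}$ (for instance $\Sigma_i^t=-L_iI$ and $\kappa_\Sigma=\max_iL_i$), let $\sqrt p\,\kappa_\Sigma D_0^2\le\epsilon_0$, and let $T>\max\{\beta^2,\ \beta^{-1}p(\kappa_g+\frac12\kappa_\Sigma D_0)^2,\ (\kappa_\Sigma\gamma_2)^4\}$. For $t\in\{1,\dots,T\}$ let $\phi^t_{1/\alpha}(x)=\inf_{z\in X_0}\{L(z,\lambda^t)+\frac\alpha2\|z-x\|^2\}$ be the Moreau envelope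 of $L(\cdot,\lambda^t)+\delta_{X_0}$. Then $\phi^t_{1/\alpha}$ is differentiable at $x^t$ for $t=1,\dots,T$, the random variables below are integrable, and (i) $$\begin{aligned}\mathbb E\,\|\nabla\phi^R_{1/\alpha}(x^R)\|^2\le{}&\frac{4(\beta+1)}{T^{1/2}}\Big[f(x^1)-\inf_{z\in X_0}f(z)\Big]+\frac4{T^{1/2}}\Big[(\beta+1)\nu_g\gamma_3+\beta D_0\gamma_2p(\kappa_g+\kappa_\Sigma D_0)\Big]\\&+\frac4{T^{1/4}}\Big[(\beta+1)\nu_g\gamma_1+\beta\big[\kappa_f+\gamma_2p(\kappa_g+\kappa_\Sigma D_0)\big]^2+\beta p\kappa_g^2\gamma_4\Big]+\frac{8\beta}{T}p\kappa_g^2\gamma_1\gamma_3+\frac{4\beta}{T^{7/4}}\gamma_1^2p\kappa_g^2;\end{aligned}$$ (ii) $\mathbb E\,g_i(x^R)\le\gamma_5\,T^{-1/4}$ for $i=1,\dots,p$; (iii) $-\mathbb E\,\langle\lambda^R,g(x^R)\rangle\le\dfrac{\nu_g^2}{2T^{3/4}}+\dfrac{\kappa_f^2}{2\beta T^{1/4}}$.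 -/

import Mathlib

open MeasureTheory ProbabilityTheory Set

noncomputable section

/-- `ℝⁿ` with its Euclidean norm. -/
abbrev RVec (n : ℕ) : Type := EuclideanSpace ℝ (Fin n)

/-- `h` is `ρ`-weakly convex over `s`: `h + (ρ/2)‖·‖²` is convex on `s`. -/
def WeaklyConvexOn {n : ℕ} (s : Set (RVec n)) (ρ : ℝ) (h : RVec n → ℝ) : Prop :=
  ConvexOn ℝ s (fun x => h x + ρ / 2 * ‖x‖ ^ 2)

/-- The action `v ↦ S v` of an `n × n` matrix on Euclidean space; its norm is the spectral norm. -/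
def matOp {n : ℕ} (S : Matrix (Fin n) (Fin n) ℝ) : RVec n →L[ℝ] RVec n :=
  Matrix.toEuclideanCLM (n := Fin n) (𝕜 := ℝ) S

/-- The quadratic model `c + ⟨v, x - y⟩ + ½⟨S (x - y), x - y⟩` centred at `y`. -/
def quadModel {n : ℕ} (c : ℝ) (v : RVec n) (S : Matrix (Fin n) (Fin n) ℝ) (y x : RVec n) : ℝ :=
  c + inner ℝ v (x - y) + 1 / 2 * inner ℝ (matOp S (x - y)) (x - y)

/-- The Moreau envelope with parameter `μ` of `h + δ_s`, where `δ_s` is the indicator function of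
`s` (`0` on `s`, `+∞` off `s`), so that the infimum runs over `s`:
`x ↦ inf_{z ∈ s} { h z + (1/(2μ)) ‖z - x‖² }`. -/
def moreauEnvelopeOn {n : ℕ} (s : Set (RVec n)) (h : RVec n → ℝ) (μ : ℝ) (x : RVec n) : ℝ :=
  ⨅ z : s, (h z + 1 / (2 * μ) * ‖(z : RVec n) - x‖ ^ 2)

/-- The upper incomplete Gamma function `Γ(a, b) = ∫_b^∞ t^(a-1) e^(-t) dt`. -/
def upperGamma (a b : ℝ) : ℝ := ∫ t in Ioi b, t ^ (a - 1) * Real.exp (-t)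

/-- The data of the stochastic program
`min f(x) = E F(x, ξ)  s.t.  g_i(x) = E G_i(x, ξ) ≤ 0 (i = 1, …, p),  x ∈ X₀`.
The values of `F` and `G` outside `O₀ × Ξ` are irrelevant. -/
structure StochProgram (n p : ℕ) (Ξ : Type*) [MeasurableSpace Ξ] where
  /-- the closed convex set of the problem -/
  X₀ : Set (RVec n)
  /-- the open convex domain of the problem functions -/
  O₀ : Set (RVec n)
  /-- the law of the random vector `ξ` -/
  P : Measure Ξ
  /-- the random objective -/
  F : RVec n → Ξ → ℝ
  /-- the random constraint functions -/
  G : Fin p → RVec n → Ξ → ℝ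

namespace StochProgram

variable {n p : ℕ} {Ξ : Type*} [MeasurableSpace Ξ] (Q : StochProgram n p Ξ)

/-- The vector `G(x, ξ) = (G_1(x, ξ), …, G_p(x, ξ))`. -/
def Gvec (x : RVec n) (ξ : Ξ) : RVec p := WithLp.toLp 2 (fun i => Q.G i x ξ)

/-- `∇_x F(x, ξ)`. -/
def gradF (x : RVec n) (ξ : Ξ) : RVec n := gradient (fun y => Q.F y ξ) x

/-- `∇_x G_i(x, ξ)`. -/
def gradG (i : Fin p) (x : RVec n) (ξ : Ξ) : RVec n := gradient (fun y => Q.G i y ξ) x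

/-- `f(x) = E F(x, ξ)`. -/
def f (x : RVec n) : ℝ := ∫ ξ, Q.F x ξ ∂Q.P

/-- `g_i(x) = E G_i(x, ξ)`. -/
def g (i : Fin p) (x : RVec n) : ℝ := ∫ ξ, Q.G i x ξ ∂Q.P

/-- The vector `g(x) = (g_1(x), …, g_p(x))`. -/
def gvec (x : RVec n) : RVec p := WithLp.toLp 2 (fun i => Q.g i x)

/-- The Lagrangian `L(x, λ) = f(x) + ∑_j λ_j g_j(x)`. -/
def lagrangian (x : RVec n) (lam : RVec p) : ℝ := Q.f x + ∑ j, lam j * Q.g j x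

/-- For `φ = L(·, λ) + δ_{X₀}`, the Moreau envelope `φ_{1/α}`. -/
def lagEnvelope (α : ℝ) (lam : RVec p) : RVec n → ℝ :=
  moreauEnvelopeOn Q.X₀ (fun z => Q.lagrangian z lam) (1 / α)

end StochProgram

/-- The numerical constants that appear in the assumptions on a stochastic program. -/
structure ProgConsts (p : ℕ) where
  D₀ : ℝ
  νg : ℝ
  κf : ℝ
  κg : ℝ
  ε₀ : ℝ
  /-- the bound `κ_Σ` on the norms of the matrices `Σ_i^t` -/
  κS : ℝ
  L₀ : ℝ
  L : Fin p → ℝ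

/-- The assumptions on the problem: the standing ones and (A2)-(A6). -/
structure StochProgram.Assumptions {n p : ℕ} {Ξ : Type*} [MeasurableSpace Ξ]
    (Q : StochProgram n p Ξ) (c : ProgConsts p) : Prop where
  isProb : IsProbabilityMeasure Q.P
  X₀_nonempty : Q.X₀.Nonempty
  X₀_closed : IsClosed Q.X₀
  X₀_convex : Convex ℝ Q.X₀
  O₀_open : IsOpen Q.O₀
  O₀_convex : Convex ℝ Q.O₀
  X₀_subset : Q.X₀ ⊆ Q.O₀
  -- the expectations are well defined and finite
  F_meas : ∀ x ∈ Q.O₀, Measurable (Q.F x)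
  G_meas : ∀ i, ∀ x ∈ Q.O₀, Measurable (Q.G i x)
  F_int : ∀ x ∈ Q.O₀, Integrable (Q.F x) Q.P
  G_int : ∀ i, ∀ x ∈ Q.O₀, Integrable (Q.G i x) Q.P
  -- (A2)
  D₀_pos : 0 < c.D₀
  diam_le : ∀ x ∈ Q.X₀, ∀ z ∈ Q.X₀, ‖x - z‖ ≤ c.D₀
  -- (A3)
  νg_pos : 0 < c.νg
  norm_G_le : ∀ x ∈ Q.O₀, ∀ ξ, ‖Q.Gvec x ξ‖ ≤ c.νg
  -- (A4), with the differentiability that the gradients presuppose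
  κf_pos : 0 < c.κf
  κg_pos : 0 < c.κg
  F_diff : ∀ x ∈ Q.O₀, ∀ ξ, DifferentiableAt ℝ (fun y => Q.F y ξ) x
  G_diff : ∀ i, ∀ x ∈ Q.O₀, ∀ ξ, DifferentiableAt ℝ (fun y => Q.G i y ξ) x
  norm_gradF_le : ∀ x ∈ Q.O₀, ∀ ξ, ‖Q.gradF x ξ‖ ≤ c.κf
  norm_gradG_le : ∀ i, ∀ x ∈ Q.O₀, ∀ ξ, ‖Q.gradG i x ξ‖ ≤ c.κg
  -- (A5)
  ε₀_pos : 0 < c.ε₀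
  slater : ∃ xhat ∈ Q.X₀, ∀ i, Q.g i xhat ≤ -c.ε₀
  -- (A6)
  L₀_pos : 0 < c.L₀
  L_pos : ∀ i, 0 < c.L i
  F_weak : ∀ ξ, WeaklyConvexOn Q.O₀ c.L₀ (fun y => Q.F y ξ)
  G_weak : ∀ i ξ, WeaklyConvexOn Q.O₀ (c.L i) (fun y => Q.G i y ξ)

namespace ProgConsts

variable {p : ℕ} (c : ProgConsts p)

def γ₁ : ℝ := c.νg + √(p : ℝ) * (c.κg * c.D₀ + 1 / 2 * c.κS * c.D₀ ^ 2)

def γ₂ : ℝ := c.νg + (c.κg * c.D₀ + c.κS * c.D₀ ^ 2 / 2)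

def κ₀ : ℝ := 4 * c.κf * c.D₀ / c.ε₀

def κ₁ : ℝ := 2 * c.D₀ ^ 2 / c.ε₀

def κ₃ : ℝ := 2 * c.νg ^ 2 / c.ε₀ - c.γ₁

def κ₄ : ℝ :=
  2 * c.γ₁ + c.ε₀ / 4 + 16 * c.γ₁ ^ 2 / c.ε₀ * Real.log (128 * c.γ₁ ^ 2 / c.ε₀ ^ 2)

def γ₃ : ℝ := c.κ₀ + c.κ₁ + c.κ₃ + c.κ₄

/-- The constant `γ₄`, which contains the step size `σ`. -/
def γ₄ (σ : ℝ) : ℝ :=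
  c.γ₃ ^ 2 + 32 * c.γ₃ * (c.γ₁ ^ 2 / c.ε₀) + 256 * (c.γ₁ ^ 4 / c.ε₀ ^ 2)
    + 2 * σ * c.νg * (c.γ₃ + 16 * (c.γ₁ ^ 2 / c.ε₀)) + c.νg ^ 2
    + 2 * c.νg ^ 2 * (upperGamma 6 1 + 2 * upperGamma 4 1 + upperGamma 2 1)

def β : ℝ := 2 * (c.L₀ + ∑ j, c.γ₂ * c.L j) + 1

def ρ₁ : ℝ := (2 * c.κg + c.κS * c.D₀) * c.κf

def ρ₂ : ℝ := (2 * c.κg + c.κS * c.D₀) * (c.κg + c.κS * c.D₀ / 2) * √(p : ℝ)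

def γ₅ : ℝ := c.γ₃ + 1 / c.β * (c.ρ₁ + (c.νg + c.γ₃) * c.ρ₂)

end ProgConsts

/-- The `σ`-algebra generated by the history `ξ_[t] = (ξ_1, …, ξ_t)` (trivial for `t = 0`). -/
abbrev history {Ω Ξ : Type*} [MeasurableSpace Ξ] (ξ : ℕ → Ω → Ξ) (t : ℕ) : MeasurableSpace Ω :=
  ⨆ s ∈ Icc 1 t, MeasurableSpace.comap (ξ s) inferInstance

section Algorithm

variable {n p : ℕ} {Ξ : Type*} [MeasurableSpace Ξ] (Q : StochProgram n p Ξ)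

/-- The matrix `Σ_0 = -∑_i λ_i Σ_i + τ I`. -/
def sigmaZero (τ : ℝ) (lam : RVec p) (S : Fin p → Matrix (Fin n) (Fin n) ℝ) :
    Matrix (Fin n) (Fin n) ℝ :=
  -(∑ i, lam i • S i) + τ • (1 : Matrix (Fin n) (Fin n) ℝ)

/-- The quadratic model `q_i` of `G_i(·, ξ)` at the point `y`. -/
def qCon (S : Fin p → Matrix (Fin n) (Fin n) ℝ) (y : RVec n) (ξ : Ξ) (i : Fin p)
    (x : RVec n) : ℝ :=
  quadModel (Q.G i y ξ) (Q.gradG i y ξ) (S i) y x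

/-- The augmented Lagrangian
`q_0(x) + (1/(2σ)) (∑_i [λ_i + σ q_i(x)]_+² - ‖λ‖²)` of the quadratic models at `y`. -/
def augLagrangian (σ τ : ℝ) (S : Fin p → Matrix (Fin n) (Fin n) ℝ) (y : RVec n) (ξ : Ξ)
    (lam : RVec p) (x : RVec n) : ℝ :=
  quadModel (Q.F y ξ) (Q.gradF y ξ) (sigmaZero τ lam S) y x
    + 1 / (2 * σ) * (∑ i, (max (lam i + σ * qCon Q S y ξ i x) 0) ^ 2 - ‖lam‖ ^ 2)

/-- `(x^t, λ^t)`, `1 ≤ t ≤ T + 1`, is generated by `T` steps of PMQSopt with parameters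
`σ, α, τ`, started at `(x1, 0)`, from the samples `ξ_1, …, ξ_T`, where in step `t` the symmetric
matrices `Sig t i` (`i = 1, …, p`) are selected. -/
structure IsPMQSopt {Ω : Type*} (σ α τ : ℝ) (T : ℕ) (x1 : RVec n) (ξ : ℕ → Ω → Ξ)
    (Sig : ℕ → Fin p → Ω → Matrix (Fin n) (Fin n) ℝ)
    (x : ℕ → Ω → RVec n) (lam : ℕ → Ω → RVec p) : Prop where
  x_init : ∀ ω, x 1 ω = x1
  lam_init : ∀ ω, lam 1 ω = 0
  Sig_symm : ∀ t ∈ Icc 1 T, ∀ i ω, (Sig t i ω).IsSymm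
  /-- the matrices of step `t` are selected on the basis of the samples seen so far -/
  Sig_meas : ∀ t ∈ Icc 1 T, ∀ i a b, Measurable[history ξ t] (fun ω => Sig t i ω a b)
  /-- `x^{t+1}` is a random vector determined by `ξ_[t]` -/
  x_meas : ∀ t ∈ Icc 1 T, Measurable[history ξ t] (x (t + 1))
  x_mem : ∀ t ∈ Icc 1 T, ∀ ω, x (t + 1) ω ∈ Q.X₀
  /-- `x^{t+1}` minimizes the proximal augmented Lagrangian over `X₀` -/
  x_step : ∀ t ∈ Icc 1 T, ∀ ω,
    IsMinOn (fun y => augLagrangian Q σ τ (fun i => Sig t i ω) (x t ω) (ξ t ω) (lam t ω) y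
      + α / 2 * ‖y - x t ω‖ ^ 2) Q.X₀ (x (t + 1) ω)
  lam_step : ∀ t ∈ Icc 1 T, ∀ ω i, lam (t + 1) ω i =
    max (lam t ω i + σ * qCon Q (fun i => Sig t i ω) (x t ω) (ξ t ω) i (x (t + 1) ω)) 0

end Algorithm

end

/-! ### Deterministic analysis of one step of the method -/

/-! Everything rests on bounds for the first two moments of the multipliers that hold at every step.
Given these, the three estimates are telescoping sums over the steps, and the uniform index `R`
turns sums into averages.

One step is analysed without probability (`IsModelStep`). The choice of `Σ_0` has two effects. Since
`λ ≥ 0` and the `Σ_i` are negative, it makes the model of `F` strongly convex with modulus `τ`. In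
the first-order condition (`IsModelStep.variational`) it cancels the curvature of the constraint
models except for a multiple of the increment `λ^{t+1} - λ^t`, which is of order `σ`. Comparing the
minimizer with the centre `x^t` gives `le_center`, hence the `complementarity` estimate and the step
length `norm_step_le`; the latter bounds the gap between `q_i^t(x^{t+1})` and `G_i(x^t, ξ_t)` and
yields `constraint_le`. Testing the first-order condition at the Slater point gives `drift`, and at
a proximal point `descent`.

Moments of the multipliers: because `Σ_i ⪯ -L_i I`, each constraint model minorizes `G_i(·, ξ_t)` on
`X₀` (`model_le_G`). At the Slater point the means are at most `-ε₀`, so `‖λ‖²` has expected drift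
`-σ ε₀ ‖λ‖`, up to constants times `σ` and a term `σ(τ + α)` times a difference of squared
distances. The last term is too large in a single step, but it telescopes. The drift is therefore
summed over windows of `s` steps with `τ + α ≤ s` and `s σ ≤ 3` (`integral_drift_window`): the
distances then cost a bounded amount per step on the scale of `σ`, while the multipliers move by at
most `3 γ₁` in a window. A process with bounded increments and such a drift above a level has a
bounded exponential moment (`integral_exp_le_of_drift`); this gives `E‖λ‖ ≤ γ₃` and `E‖λ‖² ≤ γ₄`
(`moments_norm_lam_le`).

For (i), let `z` be the proximal point of `L(·, λ^t)` at `x^t`. The Lagrangian is weakly convex with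
modulus below `α/2`, so the gradient of the envelope is `α(x^t - z)`
(`hasGradientAt_moreauEnvelopeOn`). In expectation a step approaches `z` by a multiple of `‖z -
x^t‖²`, up to small errors (`integral_descent`), and `z` is a trial point for the next envelope
(`integral_lagEnvelope_succ_le`); summation gives `sum_gradient_le`. For (ii) and (iii) the
telescoping quantities are `λ_i` and `‖λ‖²/(2σ)`.

Instead of conditional expectations, integrals are weighted by functions of the past: `x^t` and
`λ^t` depend on `ξ_1, …, ξ_{t-1}` only, so Fubini on a product law replaces the sampled functions by
their means (`integral_comp_of_indep`). For the proximal points this requires measurability, which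
comes from their continuous dependence on multiplier and centre (`continuous_prox`). -/

lemma sq_max_add_le (a b : ℝ) :
    (max (a + b) 0) ^ 2 ≤ (max a 0) ^ 2 + 2 * max a 0 * b + b ^ 2 := by
  rcases max_cases a 0 with ⟨h, h'⟩ | ⟨h, h'⟩ <;>
    rcases max_cases (a + b) 0 with ⟨k, k'⟩ | ⟨k, k'⟩ <;> rw [h, k] <;> nlinarith

/-- The function `[·]₊²` is convex and its derivative `2[·]₊` is 2-Lipschitz. This is the resulting
tangent bound from below; `sq_max_add_le` is the one from above. -/
lemma le_sq_max_add (a b : ℝ) :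
    (max a 0) ^ 2 + 2 * max a 0 * b ≤ (max (a + b) 0) ^ 2 := by
  rcases max_cases a 0 with ⟨h, h'⟩ | ⟨h, h'⟩ <;>
    rcases max_cases (a + b) 0 with ⟨k, k'⟩ | ⟨k, k'⟩ <;> rw [h, k] <;> nlinarith [sq_nonneg b]

/-- Divide by `t` and let `t → 0`. Applied on a segment issuing from a minimizer, it yields
first-order conditions without differentiating the objective. -/
lemma nonneg_of_forall_quadratic {D E : ℝ}
    (h : ∀ t : ℝ, 0 < t → t ≤ 1 → 0 ≤ t * D + t ^ 2 * E) : 0 ≤ D := by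
  by_contra hD
  push Not at hD
  have hE : 0 < |E| + |D| + 1 := by positivity
  have ht : 0 < -D / (|E| + |D| + 1) := div_pos (by linarith) hE
  have hmul : -D / (|E| + |D| + 1) * (|E| + |D| + 1) = -D := div_mul_cancel₀ _ hE.ne'
  set t := -D / (|E| + |D| + 1)
  have h1 := h t ht (by
    by_contra h2
    push Not at h2
    nlinarith [abs_nonneg E, abs_of_neg hD])
  have h3 : 0 ≤ D + t * E := by
    by_contra h4
    push Not at h4
    nlinarith
  nlinarith [le_abs_self E, abs_nonneg D]

lemma sum_le_sqrt_mul_norm {p : ℕ} (v : RVec p) : ∑ i, |v i| ≤ √(p : ℝ) * ‖v‖ := by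
  have h := Finset.sum_mul_sq_le_sq_mul_sq Finset.univ (fun _ : Fin p => (1 : ℝ)) (fun i => |v i|)
  simp only [one_mul, one_pow, sq_abs, Finset.sum_const, Finset.card_univ, Fintype.card_fin,
    nsmul_eq_mul, mul_one] at h
  have h2 : ∑ i, v i ^ 2 = ‖v‖ ^ 2 := by simp [EuclideanSpace.norm_sq_eq]
  rw [h2] at h
  calc ∑ i, |v i| ≤ √((p : ℝ) * ‖v‖ ^ 2) := Real.le_sqrt_of_sq_le h
    _ = √(p : ℝ) * ‖v‖ := by rw [Real.sqrt_mul (by positivity), Real.sqrt_sq (norm_nonneg _)]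

lemma norm_le_sum_abs {p : ℕ} (v : RVec p) : ‖v‖ ≤ ∑ i, |v i| := by
  rw [EuclideanSpace.norm_eq]
  refine Real.sqrt_le_iff.2 ⟨Finset.sum_nonneg fun i _ => abs_nonneg _, ?_⟩
  simpa using Finset.sum_sq_le_sq_sum_of_nonneg (s := Finset.univ) (f := fun i => |v i|)
    (fun i _ => abs_nonneg _)

lemma norm_le_norm_of_abs_le {p : ℕ} {v w : RVec p} (h : ∀ i, |v i| ≤ |w i|) : ‖v‖ ≤ ‖w‖ := by
  rw [EuclideanSpace.norm_eq, EuclideanSpace.norm_eq]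
  refine Real.sqrt_le_sqrt (Finset.sum_le_sum fun i _ => ?_)
  simpa using pow_le_pow_left₀ (abs_nonneg _) (h i) 2

lemma abs_apply_le_norm {p : ℕ} (v : RVec p) (i : Fin p) : |v i| ≤ ‖v‖ := by
  simpa using PiLp.norm_apply_le v i

lemma norm_le_sqrt_mul_of_abs_le {p : ℕ} {v : RVec p} {C : ℝ} (hC : 0 ≤ C)
    (h : ∀ i, |v i| ≤ C) : ‖v‖ ≤ √(p : ℝ) * C := by
  rw [EuclideanSpace.norm_eq]
  refine Real.sqrt_le_iff.2 ⟨by positivity, ?_⟩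
  calc ∑ i, ‖v i‖ ^ 2 ≤ ∑ _i : Fin p, C ^ 2 :=
        Finset.sum_le_sum fun i _ => pow_le_pow_left₀ (norm_nonneg _) (h i) 2
    _ = (√(p : ℝ) * C) ^ 2 := by
        simp [mul_pow]

lemma abs_inner_matOp_le {n : ℕ} {S : Matrix (Fin n) (Fin n) ℝ} {K : ℝ} (hS : ‖matOp S‖ ≤ K)
    (u w : RVec n) : |inner ℝ (matOp S u) w| ≤ K * ‖u‖ * ‖w‖ :=
  (abs_real_inner_le_norm _ _).trans
    (mul_le_mul_of_nonneg_right ((matOp S).le_of_opNorm_le hS u) (norm_nonneg _))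

lemma matOp_sigmaZero {n p : ℕ} (τ : ℝ) (lam : RVec p) (S : Fin p → Matrix (Fin n) (Fin n) ℝ)
    (u : RVec n) :
    matOp (sigmaZero τ lam S) u = -∑ i, lam i • matOp (S i) u + τ • u := by
  simp [matOp, sigmaZero, map_sum]

lemma quadModel_add_smul {n : ℕ} {S : Matrix (Fin n) (Fin n) ℝ}
    (hS : ∀ u w, inner ℝ (matOp S u) w = inner ℝ u (matOp S w))
    (c : ℝ) (v y x h : RVec n) (t : ℝ) :
    quadModel c v S y (x + t • h) = quadModel c v S y x
      + t * (inner ℝ v h + inner ℝ (matOp S (x - y)) h)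
      + t ^ 2 * (1 / 2 * inner ℝ (matOp S h) h) := by
  have e : x + t • h - y = (x - y) + t • h := by abel
  have s : inner ℝ (matOp S h) (x - y) = inner ℝ (matOp S (x - y)) h := by
    rw [hS, real_inner_comm]
  simp only [quadModel, e, map_add, map_smul, inner_add_left, inner_add_right,
    real_inner_smul_left, real_inner_smul_right, s]
  ring

/-- One step of the method, seen deterministically: from the data `cc`, `v0`, `v` of the models at
`y` and the multiplier `lam` it produces `y'` and `lam'`. -/
structure IsModelStep {n p : ℕ} (X : Set (RVec n)) (c : ProgConsts p) (σ α τ : ℝ)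
    (c0 : ℝ) (v0 : RVec n) (cc : RVec p) (v : Fin p → RVec n)
    (S : Fin p → Matrix (Fin n) (Fin n) ℝ) (lam lam' : RVec p) (y y' : RVec n) : Prop where
  σ_pos : 0 < σ
  α_pos : 0 < α
  τ_pos : 0 < τ
  D₀_pos : 0 < c.D₀
  νg_pos : 0 < c.νg
  κf_pos : 0 < c.κf
  κg_pos : 0 < c.κg
  κS_pos : 0 < c.κS
  L_pos : ∀ i, 0 < c.L i
  conv : Convex ℝ X
  diam_le : ∀ x ∈ X, ∀ z ∈ X, ‖x - z‖ ≤ c.D₀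
  y_mem : y ∈ X
  y'_mem : y' ∈ X
  norm_cc : ‖cc‖ ≤ c.νg
  norm_v0 : ‖v0‖ ≤ c.κf
  norm_v : ∀ i, ‖v i‖ ≤ c.κg
  symm : ∀ i u w, inner ℝ (matOp (S i) u) w = inner ℝ u (matOp (S i) w)
  quad_le : ∀ i u, inner ℝ (matOp (S i) u) u ≤ -c.L i * ‖u‖ ^ 2
  norm_S : ∀ i, ‖matOp (S i)‖ ≤ c.κS
  lam_nonneg : ∀ i, 0 ≤ lam i
  isMin : IsMinOn (fun x => quadModel c0 v0 (sigmaZero τ lam S) y x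
    + 1 / (2 * σ) * (∑ i, (max (lam i + σ * quadModel (cc i) (v i) (S i) y x) 0) ^ 2 - ‖lam‖ ^ 2)
    + α / 2 * ‖x - y‖ ^ 2) X y'
  step : ∀ i, lam' i = max (lam i + σ * quadModel (cc i) (v i) (S i) y y') 0

namespace IsModelStep

variable {n p : ℕ} {X : Set (RVec n)} {c : ProgConsts p} {σ α τ : ℝ}
    {c0 : ℝ} {v0 : RVec n} {cc : RVec p} {v : Fin p → RVec n}
    {S : Fin p → Matrix (Fin n) (Fin n) ℝ} {lam lam' : RVec p} {y y' : RVec n}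

lemma symm_sigmaZero (H : IsModelStep X c σ α τ c0 v0 cc v S lam lam' y y') (u w : RVec n) :
    inner ℝ (matOp (sigmaZero τ lam S) u) w = inner ℝ u (matOp (sigmaZero τ lam S) w) := by
  simp only [matOp_sigmaZero, inner_add_left, inner_add_right, inner_neg_left, inner_neg_right,
    sum_inner, inner_sum, real_inner_smul_left, real_inner_smul_right, H.symm]

/-- The first-order optimality condition of the subproblem. -/
lemma variational (H : IsModelStep X c σ α τ c0 v0 cc v S lam lam' y y') {z : RVec n}
    (hz : z ∈ X) :
    0 ≤ inner ℝ v0 (z - y') + ∑ i, lam' i * inner ℝ (v i) (z - y')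
      + ∑ i, (lam' i - lam i) * inner ℝ (matOp (S i) (y' - y)) (z - y')
      + (τ + α) * inner ℝ (y' - y) (z - y') := by
  set h := z - y' with hh
  set a : Fin p → ℝ := fun i => inner ℝ (v i) h + inner ℝ (matOp (S i) (y' - y)) h with ha
  set e : Fin p → ℝ := fun i => 1 / 2 * inner ℝ (matOp (S i) h) h with he
  set S0 := sigmaZero τ lam S with hS0
  have key : 0 ≤ inner ℝ v0 h + inner ℝ (matOp S0 (y' - y)) h + ∑ i, lam' i * a i
      + α * inner ℝ (y' - y) h := by
    refine nonneg_of_forall_quadratic (E := 1 / 2 * inner ℝ (matOp S0 h) h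
      + (∑ i, lam' i * e i + σ * ∑ i, (a i ^ 2 + e i ^ 2)) + α / 2 * ‖h‖ ^ 2) ?_
    intro t ht ht1
    have hmem : y' + t • h ∈ X := by
      have := H.conv.add_smul_sub_mem H.y'_mem hz ⟨ht.le, ht1⟩
      simpa [hh] using this
    have hmin := isMinOn_iff.1 H.isMin _ hmem
    simp only [← hS0] at hmin
    rw [quadModel_add_smul H.symm_sigmaZero] at hmin
    have hn : ‖y' + t • h - y‖ ^ 2 = ‖y' - y‖ ^ 2 + t * (2 * inner ℝ (y' - y) h)
        + t ^ 2 * ‖h‖ ^ 2 := by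
      have : y' + t • h - y = (y' - y) + t • h := by abel
      rw [this, norm_add_sq_real, real_inner_smul_right, norm_smul, mul_pow, Real.norm_eq_abs,
        sq_abs]
      ring
    -- At the trial point an upper bound with an error of order `t²` suffices. The tangent bound for
    -- `[·]₊²` has slope `2 [λ_i + σ q_i(y')]₊ = 2 λ'_i`, which is how the new multiplier enters.
    have hs : ∑ i, (max (lam i + σ * quadModel (cc i) (v i) (S i) y (y' + t • h)) 0) ^ 2
        ≤ ∑ i, (max (lam i + σ * quadModel (cc i) (v i) (S i) y y') 0) ^ 2
          + 2 * σ * (t * ∑ i, lam' i * a i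
            + t ^ 2 * (∑ i, lam' i * e i + σ * ∑ i, (a i ^ 2 + e i ^ 2))) := by
      simp only [Finset.mul_sum, ← Finset.sum_add_distrib]
      refine Finset.sum_le_sum fun i _ => ?_
      rw [quadModel_add_smul (H.symm i)]
      have h1 := sq_max_add_le (lam i + σ * quadModel (cc i) (v i) (S i) y y')
        (σ * (t * a i + t ^ 2 * e i))
      rw [← H.step] at h1 ⊢
      have e1 : lam i + σ * (quadModel (cc i) (v i) (S i) y y'
          + t * (inner ℝ (v i) h + inner ℝ (matOp (S i) (y' - y)) h)
          + t ^ 2 * (1 / 2 * inner ℝ (matOp (S i) h) h))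
          = lam i + σ * quadModel (cc i) (v i) (S i) y y' + σ * (t * a i + t ^ 2 * e i) := by
        simp only [ha, he]; ring
      rw [e1]
      refine h1.trans ?_
      have h2 : (t * a i + t ^ 2 * e i) ^ 2 ≤ t ^ 2 * (2 * (a i ^ 2 + e i ^ 2)) := by
        have h3 : (a i + t * e i) ^ 2 ≤ 2 * (a i ^ 2 + e i ^ 2) := by
          nlinarith [sq_nonneg (a i - t * e i), sq_nonneg (e i),
            mul_le_mul ht1 ht1 ht.le zero_le_one,
            mul_nonneg (sq_nonneg (e i)) (by nlinarith : (0 : ℝ) ≤ 1 - t ^ 2)]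
        calc (t * a i + t ^ 2 * e i) ^ 2 = t ^ 2 * (a i + t * e i) ^ 2 := by ring
          _ ≤ _ := mul_le_mul_of_nonneg_left h3 (sq_nonneg t)
      nlinarith [mul_le_mul_of_nonneg_left h2 (sq_nonneg σ)]
    have hs' : 1 / (2 * σ) * (∑ i, (max (lam i + σ * quadModel (cc i) (v i) (S i) y (y' + t • h)) 0) ^ 2 - ‖lam‖ ^ 2)
        ≤ 1 / (2 * σ) * (∑ i, (max (lam i + σ * quadModel (cc i) (v i) (S i) y y') 0) ^ 2 - ‖lam‖ ^ 2)
          + (t * ∑ i, lam' i * a i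
            + t ^ 2 * (∑ i, lam' i * e i + σ * ∑ i, (a i ^ 2 + e i ^ 2))) := by
      have h4 := mul_le_mul_of_nonneg_left hs (by have := H.σ_pos; positivity : 0 ≤ 1 / (2 * σ))
      have h5 : 1 / (2 * σ) * (2 * σ) = 1 := by have := H.σ_pos; field_simp
      linear_combination h4 + (t * ∑ i, lam' i * a i
            + t ^ 2 * (∑ i, lam' i * e i + σ * ∑ i, (a i ^ 2 + e i ^ 2))) * h5
    rw [hn] at hmin
    linear_combination hmin + hs'
  refine key.trans (le_of_eq ?_)
  -- The part `-∑ λ_i S_i` of `S0` meets `∑ λ'_i S_i` from the constraint models, and only the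
  -- increments `λ'_i - λ_i` survive.
  rw [hS0, matOp_sigmaZero, inner_add_left, inner_neg_left, sum_inner]
  simp only [real_inner_smul_left, ha, mul_add, sub_mul, Finset.sum_add_distrib,
    Finset.sum_sub_distrib]
  ring

lemma abs_model_sub_le (H : IsModelStep X c σ α τ c0 v0 cc v S lam lam' y y') {x : RVec n}
    (hx : x ∈ X) (i : Fin p) :
    |quadModel (cc i) (v i) (S i) y x - cc i| ≤ (c.κg + c.κS * c.D₀ / 2) * ‖x - y‖ := by
  have h1 := (abs_real_inner_le_norm (v i) (x - y)).trans
    (mul_le_mul_of_nonneg_right (H.norm_v i) (norm_nonneg _))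
  have h2 := abs_inner_matOp_le (H.norm_S i) (x - y) (x - y)
  have h3 : c.κS * ‖x - y‖ * ‖x - y‖ ≤ c.κS * c.D₀ * ‖x - y‖ := by
    have := H.diam_le x hx y H.y_mem
    have := H.κS_pos
    gcongr
  have e : quadModel (cc i) (v i) (S i) y x - cc i
      = inner ℝ (v i) (x - y) + 1 / 2 * inner ℝ (matOp (S i) (x - y)) (x - y) := by
    simp only [quadModel]; ring
  rw [e]
  rw [abs_le] at *
  constructor <;> nlinarith

lemma abs_model_sub_le' (H : IsModelStep X c σ α τ c0 v0 cc v S lam lam' y y') {x : RVec n}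
    (hx : x ∈ X) (i : Fin p) :
    |quadModel (cc i) (v i) (S i) y x - cc i| ≤ c.κg * c.D₀ + 1 / 2 * c.κS * c.D₀ ^ 2 := by
  refine (H.abs_model_sub_le hx i).trans ?_
  have h1 := H.diam_le x hx y H.y_mem
  have h2 : 0 ≤ c.κg + c.κS * c.D₀ / 2 := by
    have := H.κS_pos; have := H.κg_pos; have := H.D₀_pos; positivity
  nlinarith [mul_le_mul_of_nonneg_left h1 h2]

lemma abs_model_le (H : IsModelStep X c σ α τ c0 v0 cc v S lam lam' y y') {x : RVec n}
    (hx : x ∈ X) (i : Fin p) : |quadModel (cc i) (v i) (S i) y x| ≤ c.γ₂ := by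
  have h1 := H.abs_model_sub_le' hx i
  have h2 := (abs_apply_le_norm cc i).trans H.norm_cc
  rw [ProgConsts.γ₂]
  rw [abs_le] at *
  constructor <;> linarith

lemma norm_models_le (H : IsModelStep X c σ α τ c0 v0 cc v S lam lam' y y') {x : RVec n}
    (hx : x ∈ X) :
    ‖(WithLp.toLp 2 fun i => quadModel (cc i) (v i) (S i) y x : RVec p)‖ ≤ c.γ₁ := by
  set q : RVec p := WithLp.toLp 2 fun i => quadModel (cc i) (v i) (S i) y x
  have h1 : ‖q - cc‖ ≤ √(p : ℝ) * (c.κg * c.D₀ + 1 / 2 * c.κS * c.D₀ ^ 2) := by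
    refine norm_le_sqrt_mul_of_abs_le ?_ fun i => H.abs_model_sub_le' hx i
    have := H.κS_pos; have := H.κg_pos; have := H.D₀_pos; positivity
  calc ‖q‖ = ‖cc + (q - cc)‖ := by simp
    _ ≤ ‖cc‖ + ‖q - cc‖ := norm_add_le _ _
    _ ≤ c.γ₁ := by rw [ProgConsts.γ₁]; linarith [H.norm_cc]

/-- The positive part is nonexpansive, and `λ_i ≥ 0` is its own positive part. -/
lemma abs_step_sub_le (H : IsModelStep X c σ α τ c0 v0 cc v S lam lam' y y') (i : Fin p) :
    |lam' i - lam i| ≤ |σ * quadModel (cc i) (v i) (S i) y y'| := by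
  have h1 := abs_max_sub_max_le_abs (lam i + σ * quadModel (cc i) (v i) (S i) y y') (lam i) 0
  rw [← H.step, max_eq_left (H.lam_nonneg i), add_sub_cancel_left] at h1
  exact h1

lemma abs_step_sub_le_γ₂ (H : IsModelStep X c σ α τ c0 v0 cc v S lam lam' y y') (i : Fin p) :
    |lam' i - lam i| ≤ σ * c.γ₂ := by
  refine (H.abs_step_sub_le i).trans ?_
  rw [abs_mul, abs_of_pos H.σ_pos]
  exact mul_le_mul_of_nonneg_left (H.abs_model_le H.y'_mem i) H.σ_pos.le

lemma norm_step_sub_le (H : IsModelStep X c σ α τ c0 v0 cc v S lam lam' y y') :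
    ‖lam' - lam‖ ≤ σ * c.γ₁ := by
  have h1 := norm_le_norm_of_abs_le (v := lam' - lam)
    (w := σ • (WithLp.toLp 2 fun i => quadModel (cc i) (v i) (S i) y y' : RVec p))
    (fun i => H.abs_step_sub_le i)
  rw [norm_smul, Real.norm_eq_abs, abs_of_pos H.σ_pos] at h1
  exact h1.trans (mul_le_mul_of_nonneg_left (H.norm_models_le H.y'_mem) H.σ_pos.le)

lemma norm_sq_step (H : IsModelStep X c σ α τ c0 v0 cc v S lam lam' y y') :
    ∑ i, (max (lam i + σ * quadModel (cc i) (v i) (S i) y y') 0) ^ 2 = ‖lam'‖ ^ 2 := by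
  simp [EuclideanSpace.norm_sq_eq, ← H.step]

lemma sum_sq_max_le {b : Fin p → ℝ} (C : RVec p) (hσ : 0 < σ) (hlam : ∀ i, 0 ≤ lam i)
    (hb : ∀ i, b i ≤ C i) :
    ∑ i, (max (lam i + σ * b i) 0) ^ 2 ≤ ‖lam‖ ^ 2 + 2 * σ * inner ℝ lam C + σ ^ 2 * ‖C‖ ^ 2 := by
  have e1 : ‖lam‖ ^ 2 + 2 * σ * inner ℝ lam C + σ ^ 2 * ‖C‖ ^ 2
      = ∑ i, ((max (lam i) 0) ^ 2 + 2 * max (lam i) 0 * (σ * C i) + (σ * C i) ^ 2) := by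
    simp only [EuclideanSpace.norm_sq_eq, PiLp.inner_apply, Finset.mul_sum,
      ← Finset.sum_add_distrib]
    refine Finset.sum_congr rfl fun i _ => ?_
    rw [max_eq_left (hlam i)]
    simp
    ring
  rw [e1]
  refine Finset.sum_le_sum fun i _ => ?_
  refine le_trans ?_ (sq_max_add_le (lam i) (σ * C i))
  have := hb i
  gcongr

lemma model_center (c : ℝ) (v : RVec n) (S : Matrix (Fin n) (Fin n) ℝ) (y : RVec n) :
    quadModel c v S y y = c := by simp [quadModel]

/-- Negative `S_i` and nonnegative `λ_i` make `-∑ λ_i S_i` positive semidefinite, so only `τ I` has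
to be kept. -/
lemma inner_sigmaZero_ge (H : IsModelStep X c σ α τ c0 v0 cc v S lam lam' y y') (u : RVec n) :
    τ * ‖u‖ ^ 2 ≤ inner ℝ (matOp (sigmaZero τ lam S) u) u := by
  rw [matOp_sigmaZero, inner_add_left, inner_neg_left, sum_inner]
  simp only [real_inner_smul_left, real_inner_self_eq_norm_sq]
  have : ∑ i, lam i * inner ℝ (matOp (S i) u) u ≤ 0 := by
    refine Finset.sum_nonpos fun i _ => mul_nonpos_of_nonneg_of_nonpos (H.lam_nonneg i) ?_
    have := H.quad_le i u
    nlinarith [mul_nonneg (H.L_pos i).le (sq_nonneg ‖u‖)]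
  linarith

/-- The subproblem has value at most that at its centre. -/
lemma le_center (H : IsModelStep X c σ α τ c0 v0 cc v S lam lam' y y') :
    inner ℝ v0 (y' - y) + (τ + α) / 2 * ‖y' - y‖ ^ 2
      + 1 / (2 * σ) * (‖lam'‖ ^ 2 - ∑ i, (max (lam i + σ * cc i) 0) ^ 2) ≤ 0 := by
  have h := isMinOn_iff.1 H.isMin _ H.y_mem
  simp only [model_center, sub_self, norm_zero, H.norm_sq_step] at h
  rw [quadModel] at h
  have h2 := H.inner_sigmaZero_ge (y' - y)
  nlinarith

/-- Complementarity along one step. -/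
lemma complementarity (H : IsModelStep X c σ α τ c0 v0 cc v S lam lam' y y') :
    -inner ℝ lam cc ≤ σ / 2 * c.νg ^ 2 + 1 / (2 * σ) * (‖lam‖ ^ 2 - ‖lam'‖ ^ 2)
      + c.κf ^ 2 / (2 * α) := by
  have hσ := H.σ_pos
  have h1 := H.le_center
  have h2 := sum_sq_max_le (b := cc) cc H.σ_pos H.lam_nonneg (fun i => le_rfl)
  have h3 : -(c.κf * ‖y' - y‖) ≤ inner ℝ v0 (y' - y) :=
    (neg_le_neg (mul_le_mul_of_nonneg_right H.norm_v0 (norm_nonneg _))).trans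
      (neg_le_of_abs_le (abs_real_inner_le_norm _ _))
  have h4 : ‖cc‖ ^ 2 ≤ c.νg ^ 2 := pow_le_pow_left₀ (norm_nonneg _) H.norm_cc 2
  have h5 : c.κf * ‖y' - y‖ ≤ (τ + α) / 2 * ‖y' - y‖ ^ 2 + c.κf ^ 2 / (2 * α) := by
    have h6 : c.κf * ‖y' - y‖ ≤ α / 2 * ‖y' - y‖ ^ 2 + c.κf ^ 2 / (2 * α) := by
      have := H.α_pos
      have : 0 ≤ (α * ‖y' - y‖ - c.κf) ^ 2 / (2 * α) := by positivity
      have e : (α * ‖y' - y‖ - c.κf) ^ 2 / (2 * α)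
        = α / 2 * ‖y' - y‖ ^ 2 + c.κf ^ 2 / (2 * α) - c.κf * ‖y' - y‖ := by
        field_simp; ring
      linarith
    nlinarith [mul_nonneg H.τ_pos.le (sq_nonneg ‖y' - y‖)]
  have h7 : 1 / (2 * σ) * (∑ i, (max (lam i + σ * cc i) 0) ^ 2) ≤
      1 / (2 * σ) * ‖lam‖ ^ 2 + inner ℝ lam cc + σ / 2 * c.νg ^ 2 := by
    refine (mul_le_mul_of_nonneg_left h2 (by positivity)).trans ?_
    have e : 1 / (2 * σ) * (‖lam‖ ^ 2 + 2 * σ * inner ℝ lam cc + σ ^ 2 * ‖cc‖ ^ 2)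
      = 1 / (2 * σ) * ‖lam‖ ^ 2 + inner ℝ lam cc + σ / 2 * ‖cc‖ ^ 2 := by
      field_simp
    rw [e]
    nlinarith
  linarith

/-- The step length. -/
lemma norm_step_le (H : IsModelStep X c σ α τ c0 v0 cc v S lam lam' y y') (hσ1 : σ ≤ 1) :
    α * ‖y' - y‖ ≤ 2 * (c.κf + √(p : ℝ) * (c.κg + c.κS * c.D₀ / 2) * (c.νg + ‖lam‖)) := by
  have hσ := H.σ_pos
  set K := c.κg + c.κS * c.D₀ / 2 with hK
  have hK0 : 0 ≤ K := by
    have := H.κS_pos; have := H.κg_pos; have := H.D₀_pos; positivity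
  have h1 := H.le_center
  have h3 : -(c.κf * ‖y' - y‖) ≤ inner ℝ v0 (y' - y) :=
    (neg_le_neg (mul_le_mul_of_nonneg_right H.norm_v0 (norm_nonneg _))).trans
      (neg_le_of_abs_le (abs_real_inner_le_norm _ _))
  -- `w` is the multiplier that would result if the point stayed at `y`. The squares at `y'` are
  -- bounded below by their tangents at `y`, whose slopes are `2 w_i`.
  set w : RVec p := WithLp.toLp 2 fun i => max (lam i + σ * cc i) 0 with hw
  have hw1 : ‖w‖ ≤ ‖lam‖ + c.νg := by
    have h4 : ‖w‖ ≤ ‖lam + σ • cc‖ := by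
      refine norm_le_norm_of_abs_le fun i => ?_
      simp only [hw, PiLp.add_apply, PiLp.smul_apply, smul_eq_mul]
      rcases max_cases (lam i + σ * cc i) 0 with ⟨h, -⟩ | ⟨h, -⟩ <;> rw [h]
      simp
    have h5 : ‖σ • cc‖ ≤ c.νg := by
      rw [norm_smul, Real.norm_eq_abs, abs_of_pos hσ]
      calc σ * ‖cc‖ ≤ 1 * ‖cc‖ := by gcongr
        _ ≤ _ := by linarith [H.norm_cc]
    exact h4.trans ((norm_add_le _ _).trans (by linarith))
  have h6 : ∑ i, (max (lam i + σ * cc i) 0) ^ 2 - 2 * σ * (√(p : ℝ) * ‖w‖ * (K * ‖y' - y‖))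
      ≤ ‖lam'‖ ^ 2 := by
    rw [← H.norm_sq_step]
    have h7 : ∀ i, (max (lam i + σ * cc i) 0) ^ 2 - 2 * σ * (|w i| * (K * ‖y' - y‖))
        ≤ (max (lam i + σ * quadModel (cc i) (v i) (S i) y y') 0) ^ 2 := by
      intro i
      have h8 := le_sq_max_add (lam i + σ * cc i)
        (σ * (quadModel (cc i) (v i) (S i) y y' - cc i))
      have e : lam i + σ * cc i + σ * (quadModel (cc i) (v i) (S i) y y' - cc i)
        = lam i + σ * quadModel (cc i) (v i) (S i) y y' := by ring
      rw [e] at h8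
      refine le_trans ?_ h8
      have h9 := (abs_le.1 (H.abs_model_sub_le H.y'_mem i)).1
      rw [← hK] at h9
      have hwi : |w i| = max (lam i + σ * cc i) 0 := by
        simp only [hw]; exact abs_of_nonneg (le_max_right _ _)
      rw [← hwi]
      have := mul_le_mul_of_nonneg_left h9 (mul_nonneg hσ.le (abs_nonneg (w i)))
      nlinarith
    refine le_trans ?_ (Finset.sum_le_sum fun i _ => h7 i)
    rw [Finset.sum_sub_distrib, ← Finset.mul_sum, ← Finset.sum_mul]
    have h10 := mul_le_mul_of_nonneg_right (sum_le_sqrt_mul_norm w)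
      (mul_nonneg hK0 (norm_nonneg (y' - y)))
    nlinarith
  have h11 : -(√(p : ℝ) * ‖w‖ * (K * ‖y' - y‖)) ≤
      1 / (2 * σ) * (‖lam'‖ ^ 2 - ∑ i, (max (lam i + σ * cc i) 0) ^ 2) := by
    have h12 : -(2 * σ * (√(p : ℝ) * ‖w‖ * (K * ‖y' - y‖)))
      ≤ ‖lam'‖ ^ 2 - ∑ i, (max (lam i + σ * cc i) 0) ^ 2 := by linarith
    have := mul_le_mul_of_nonneg_left h12 (by positivity : 0 ≤ 1 / (2 * σ))
    refine le_trans (le_of_eq ?_) this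
    field_simp
  have h13 : √(p : ℝ) * ‖w‖ * (K * ‖y' - y‖)
      ≤ √(p : ℝ) * (‖lam‖ + c.νg) * (K * ‖y' - y‖) := by gcongr
  have h14 : (α * ‖y' - y‖) * ‖y' - y‖
      ≤ 2 * (c.κf + √(p : ℝ) * K * (c.νg + ‖lam‖)) * ‖y' - y‖ := by
    nlinarith [mul_nonneg H.τ_pos.le (sq_nonneg ‖y' - y‖)]
  rcases (norm_nonneg (y' - y)).eq_or_lt with h0 | h0
  · rw [← h0, mul_zero]
    have := H.κf_pos; have := H.νg_pos
    positivity
  · exact le_of_mul_le_mul_right h14 h0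

/-- The constraint values along one step. -/
lemma constraint_le (H : IsModelStep X c σ α τ c0 v0 cc v S lam lam' y y') (hσ1 : σ ≤ 1)
    (i : Fin p) :
    σ * cc i ≤ lam' i - lam i + σ * (1 / α * (c.ρ₁ + (c.νg + ‖lam‖) * c.ρ₂)) := by
  have hα := H.α_pos
  have h1 : lam i + σ * quadModel (cc i) (v i) (S i) y y' ≤ lam' i := by
    rw [H.step]; exact le_max_left _ _
  have h2 := (abs_le.1 (H.abs_model_sub_le H.y'_mem i)).1
  have h3 := H.norm_step_le hσ1
  set K := c.κg + c.κS * c.D₀ / 2 with hK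
  have hK0 : 0 ≤ K := by
    have := H.κS_pos; have := H.κg_pos; have := H.D₀_pos; positivity
  have h4 : K * ‖y' - y‖ ≤ 1 / α * (c.ρ₁ + (c.νg + ‖lam‖) * c.ρ₂) := by
    have h5 := mul_le_mul_of_nonneg_left h3 (by positivity : 0 ≤ K / α)
    refine le_trans (le_of_eq ?_) (h5.trans (le_of_eq ?_))
    · field_simp
    · rw [ProgConsts.ρ₁, ProgConsts.ρ₂, ← hK, hK]; ring
  have h6 := mul_le_mul_of_nonneg_left (h2.trans le_rfl) H.σ_pos.le
  have h7 := mul_le_mul_of_nonneg_left h4 H.σ_pos.le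
  nlinarith

/-- The drift of the multipliers along one step. -/
lemma drift (H : IsModelStep X c σ α τ c0 v0 cc v S lam lam' y y')
    (hκε : √(p : ℝ) * c.κS * c.D₀ ^ 2 ≤ c.ε₀) {z : RVec n} (hz : z ∈ X) {C : RVec p}
    (hC : ‖C‖ ≤ c.νg) (hCz : ∀ i, quadModel (cc i) (v i) (S i) y z ≤ C i) :
    1 / (2 * σ) * (‖lam'‖ ^ 2 - ‖lam‖ ^ 2) ≤ c.κf * c.D₀
      + (τ + α) / 2 * (‖z - y‖ ^ 2 - ‖z - y'‖ ^ 2) + c.ε₀ / 2 * ‖lam‖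
      + c.ε₀ / 2 * (σ * c.γ₁) + inner ℝ lam C + σ / 2 * c.νg ^ 2 := by
  have hσ := H.σ_pos
  have h1 := H.variational hz
  set h := z - y' with hh
  set d := y' - y with hd
  have hzy : z - y = d + h := by rw [hh, hd]; abel
  set q : Fin p → RVec n → ℝ := fun i x => quadModel (cc i) (v i) (S i) y x with hq
  have hq1 : ∀ i, q i z - q i y' = inner ℝ (v i) h + inner ℝ (matOp (S i) d) h
      + 1 / 2 * inner ℝ (matOp (S i) h) h := by
    intro i
    have e : z = y' + (1 : ℝ) • h := by rw [hh]; simp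
    simp only [hq]
    rw [e, quadModel_add_smul (H.symm i)]
    ring
  have hq2 : ∀ i, inner ℝ (matOp (S i) (z - y)) (z - y) = inner ℝ (matOp (S i) d) d
      + 2 * inner ℝ (matOp (S i) d) h + inner ℝ (matOp (S i) h) h := by
    intro i
    have e : inner ℝ (matOp (S i) h) d = inner ℝ (matOp (S i) d) h := by
      rw [H.symm, real_inner_comm]
    simp only [hzy, map_add, inner_add_left, inner_add_right, e]
    ring
  -- each constraint contributes at most
  have hterm : ∀ i, lam' i * inner ℝ (v i) h + (lam' i - lam i) * inner ℝ (matOp (S i) d) h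
      ≤ 1 / (2 * σ) * ((max (lam i + σ * q i z) 0) ^ 2
          - (max (lam i + σ * q i y') 0) ^ 2)
        + 1 / 2 * (c.κS * c.D₀ ^ 2) * |lam i| + 1 / 2 * (c.κS * c.D₀ ^ 2) * |lam' i - lam i| := by
    intro i
    -- By the polarization `hq2`, the left side of the goal equals `λ'_i (q_i(z) - q_i(y')) - ½(λ'_i
    -- - λ_i)⟨S_i h, h⟩ - ½ λ_i ⟨S_i(z-y), z-y⟩ + ½ λ_i ⟨S_i d, d⟩`. The last term is nonpositive;
    -- `k1`, `k8` and `k7` bound the others in this order.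
    have k1 : lam' i * (q i z - q i y') ≤ 1 / (2 * σ) * ((max (lam i + σ * q i z) 0) ^ 2
          - (max (lam i + σ * q i y') 0) ^ 2) := by
      have k2 := le_sq_max_add (lam i + σ * q i y') (σ * (q i z - q i y'))
      have e : lam i + σ * q i y' + σ * (q i z - q i y') = lam i + σ * q i z := by ring
      rw [e, ← H.step] at k2
      have k3 : (2 * σ) * (lam' i * (q i z - q i y')) ≤ (max (lam i + σ * q i z) 0) ^ 2
          - (max (lam i + σ * q i y') 0) ^ 2 := by
        rw [← H.step]; linarith
      have := mul_le_mul_of_nonneg_left k3 (by positivity : 0 ≤ 1 / (2 * σ))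
      refine le_trans (le_of_eq ?_) this
      field_simp
    have bnd : ∀ u : RVec n, ‖u‖ ≤ c.D₀ → |inner ℝ (matOp (S i) u) u| ≤ c.κS * c.D₀ ^ 2 := by
      intro u hu
      refine (abs_inner_matOp_le (H.norm_S i) u u).trans ?_
      have := H.κS_pos
      have := H.D₀_pos.le
      calc c.κS * ‖u‖ * ‖u‖ = c.κS * (‖u‖ * ‖u‖) := by ring
        _ ≤ c.κS * (c.D₀ * c.D₀) := by gcongr
        _ = _ := by ring
    have k4 := bnd (z - y) (H.diam_le z hz y H.y_mem)
    have k5 := bnd h (H.diam_le z hz y' H.y'_mem)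
    have k6 : inner ℝ (matOp (S i) d) d ≤ 0 := by
      have := H.quad_le i d
      nlinarith [mul_nonneg (H.L_pos i).le (sq_nonneg ‖d‖)]
    have k7 : -(1 / 2 * lam i * inner ℝ (matOp (S i) (z - y)) (z - y))
        ≤ 1 / 2 * (c.κS * c.D₀ ^ 2) * |lam i| := by
      rw [abs_of_nonneg (H.lam_nonneg i)]
      nlinarith [mul_le_mul_of_nonneg_left (abs_le.1 k4).1 (H.lam_nonneg i)]
    have k8 : -(1 / 2 * (lam' i - lam i) * inner ℝ (matOp (S i) h) h)
        ≤ 1 / 2 * (c.κS * c.D₀ ^ 2) * |lam' i - lam i| := by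
      have := mul_le_mul_of_nonneg_left k5 (abs_nonneg (lam' i - lam i))
      rw [← abs_mul] at this
      linarith [(abs_le.1 this).1]
    have k9 := mul_nonpos_of_nonpos_of_nonneg k6 (H.lam_nonneg i)
    rw [hq2] at k7
    rw [hq1] at k1
    nlinarith
  have hsum := Finset.sum_le_sum fun i (_ : i ∈ Finset.univ) => hterm i
  simp only [Finset.sum_add_distrib, ← Finset.mul_sum, Finset.sum_sub_distrib] at hsum
  have s1 : ∑ i, (max (lam i + σ * q i y') 0) ^ 2 = ‖lam'‖ ^ 2 := H.norm_sq_step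
  have s2 := sum_sq_max_le (b := fun i => q i z) C hσ H.lam_nonneg hCz
  have s3 := sum_le_sqrt_mul_norm lam
  have s4 : ∑ i, |lam' i - lam i| ≤ √(p : ℝ) * ‖lam' - lam‖ := sum_le_sqrt_mul_norm (lam' - lam)
  have hKD : 0 ≤ c.κS * c.D₀ ^ 2 := by have := H.κS_pos; positivity
  -- The smallness of `√p κ_Σ D₀²` relative to `ε₀` enters here: the curvature costs at most
  -- `(ε₀/2)‖λ‖`, half of what the Slater point will gain.
  have s5 : c.κS * c.D₀ ^ 2 * ∑ i, |lam i| ≤ c.ε₀ * ‖lam‖ := by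
    have := mul_le_mul_of_nonneg_left s3 hKD
    have := mul_le_mul_of_nonneg_right hκε (norm_nonneg lam)
    nlinarith
  have s6 : c.κS * c.D₀ ^ 2 * ∑ i, |lam' i - lam i| ≤ c.ε₀ * (σ * c.γ₁) := by
    have a1 := mul_le_mul_of_nonneg_left s4 hKD
    have a2 := mul_le_mul_of_nonneg_right hκε (norm_nonneg (lam' - lam))
    have hε : 0 ≤ c.ε₀ := le_trans (by have := H.κS_pos; positivity) hκε
    have a3 := mul_le_mul_of_nonneg_left H.norm_step_sub_le hε
    nlinarith
  have s7 : 1 / (2 * σ) * (∑ i, (max (lam i + σ * q i z) 0) ^ 2 - ‖lam'‖ ^ 2)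
      ≤ 1 / (2 * σ) * (‖lam‖ ^ 2 - ‖lam'‖ ^ 2) + inner ℝ lam C + σ / 2 * c.νg ^ 2 := by
    have hC2 : ‖C‖ ^ 2 ≤ c.νg ^ 2 := pow_le_pow_left₀ (norm_nonneg _) hC 2
    have a1 : ∑ i, (max (lam i + σ * q i z) 0) ^ 2 - ‖lam'‖ ^ 2
      ≤ (‖lam‖ ^ 2 - ‖lam'‖ ^ 2) + 2 * σ * inner ℝ lam C + σ ^ 2 * c.νg ^ 2 := by
      nlinarith [mul_le_mul_of_nonneg_left hC2 (sq_nonneg σ)]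
    refine (mul_le_mul_of_nonneg_left a1 (by positivity)).trans (le_of_eq ?_)
    field_simp
  have s8 : inner ℝ v0 h ≤ c.κf * c.D₀ :=
    (le_abs_self _).trans ((abs_real_inner_le_norm _ _).trans
      (mul_le_mul H.norm_v0 (H.diam_le z hz y' H.y'_mem) (norm_nonneg _) H.κf_pos.le))
  have s9 : (τ + α) * inner ℝ d h ≤ (τ + α) / 2 * (‖z - y‖ ^ 2 - ‖h‖ ^ 2) := by
    rw [hzy, norm_add_sq_real]
    nlinarith [mul_nonneg (add_pos H.τ_pos H.α_pos).le (sq_nonneg ‖d‖)]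
  rw [s1] at hsum
  linarith

/-- The distance of the new point to a point `z` of `X`. -/
lemma descent (H : IsModelStep X c σ α τ c0 v0 cc v S lam lam' y y') (hσ1 : σ ≤ 1)
    {z : RVec n} (hz : z ∈ X) :
    (τ + α) / 2 * ‖z - y'‖ ^ 2 ≤ (τ + α) / 2 * ‖z - y‖ ^ 2
      + (inner ℝ v0 (z - y) + ∑ i, lam i * inner ℝ (v i) (z - y))
      + σ * (c.D₀ * c.γ₂ * p * (c.κg + c.κS * c.D₀))
      + ((c.κf + c.γ₂ * p * (c.κg + c.κS * c.D₀)) ^ 2 + p * c.κg ^ 2 * ‖lam‖ ^ 2) / (τ + α) := by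
  have hσ := H.σ_pos
  have hτα : 0 < τ + α := add_pos H.τ_pos H.α_pos
  have h1 := H.variational hz
  -- Write `λ' = λ + (λ' - λ)`. All contributions of the increment are collected in `w`, of norm
  -- `O(σ)`; the old multipliers contribute `V`, whose norm grows only linearly in `‖λ‖`.
  set w : RVec n := ∑ i, (lam' i - lam i) • (v i + matOp (S i) (y' - y)) with hw
  set V : RVec n := ∑ i, lam i • v i with hV
  set B := c.γ₂ * p * (c.κg + c.κS * c.D₀) with hB
  have hγ₂ : 0 ≤ c.γ₂ := by
    have := H.κS_pos; have := H.κg_pos; have := H.D₀_pos; have := H.νg_pos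
    rw [ProgConsts.γ₂]; positivity
  have hB0 : 0 ≤ B := by
    have := H.κS_pos; have := H.κg_pos; have := H.D₀_pos
    positivity
  have hwn : ‖w‖ ≤ σ * B := by
    calc ‖w‖ ≤ ∑ i, ‖(lam' i - lam i) • (v i + matOp (S i) (y' - y))‖ := norm_sum_le _ _
      _ ≤ ∑ _i : Fin p, (σ * c.γ₂) * (c.κg + c.κS * c.D₀) := by
        refine Finset.sum_le_sum fun i _ => ?_
        rw [norm_smul]
        refine mul_le_mul (H.abs_step_sub_le_γ₂ i) ?_ (norm_nonneg _) (by positivity)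
        refine (norm_add_le _ _).trans (add_le_add (H.norm_v i) ?_)
        exact ((matOp (S i)).le_of_opNorm_le (H.norm_S i) _).trans
          (mul_le_mul_of_nonneg_left (H.diam_le y' H.y'_mem y H.y_mem) H.κS_pos.le)
      _ = σ * B := by
        rw [Finset.sum_const, Finset.card_univ, Fintype.card_fin, nsmul_eq_mul, hB]; ring
  have hVn : ‖V‖ ^ 2 ≤ p * c.κg ^ 2 * ‖lam‖ ^ 2 := by
    have : ‖V‖ ≤ √(p : ℝ) * ‖lam‖ * c.κg := by
      calc ‖V‖ ≤ ∑ i, ‖lam i • v i‖ := norm_sum_le _ _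
        _ ≤ ∑ i, |lam i| * c.κg := by
          refine Finset.sum_le_sum fun i _ => ?_
          rw [norm_smul, Real.norm_eq_abs]
          exact mul_le_mul_of_nonneg_left (H.norm_v i) (abs_nonneg _)
        _ ≤ _ := by
          rw [← Finset.sum_mul]
          exact mul_le_mul_of_nonneg_right (sum_le_sqrt_mul_norm lam) H.κg_pos.le
    calc ‖V‖ ^ 2 ≤ (√(p : ℝ) * ‖lam‖ * c.κg) ^ 2 := pow_le_pow_left₀ (norm_nonneg _) this 2
      _ = _ := by rw [mul_pow, mul_pow, Real.sq_sqrt (by positivity)]; ring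
  have hbase : ‖v0 + w‖ ≤ c.κf + B := by
    refine (norm_add_le _ _).trans (add_le_add H.norm_v0 (hwn.trans ?_))
    nlinarith
  have hall : ‖v0 + w + V‖ ^ 2 ≤ 2 * ((c.κf + B) ^ 2 + p * c.κg ^ 2 * ‖lam‖ ^ 2) := by
    have k1 := norm_add_le (v0 + w) V
    have k2 := pow_le_pow_left₀ (norm_nonneg _) k1 2
    have k3 := pow_le_pow_left₀ (norm_nonneg _) hbase 2
    nlinarith [sq_nonneg (‖v0 + w‖ - ‖V‖)]
  have e1 : inner ℝ v0 (z - y') + ∑ i, lam' i * inner ℝ (v i) (z - y')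
      + ∑ i, (lam' i - lam i) * inner ℝ (matOp (S i) (y' - y)) (z - y')
      = inner ℝ (v0 + w + V) (z - y') := by
    simp only [hw, hV, inner_add_left, sum_inner, real_inner_smul_left, mul_add,
      Finset.sum_add_distrib, sub_mul, Finset.sum_sub_distrib]
    ring
  rw [e1] at h1
  have e2 : z - y' = (z - y) - (y' - y) := by abel
  have e3 : inner ℝ (v0 + w + V) (z - y') = (inner ℝ v0 (z - y)
      + ∑ i, lam i * inner ℝ (v i) (z - y)) + inner ℝ w (z - y)
      - inner ℝ (v0 + w + V) (y' - y) := by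
    rw [e2, inner_sub_right]
    simp only [hV, inner_add_left, sum_inner, real_inner_smul_left]
    ring
  have e4 : ‖z - y'‖ ^ 2 = ‖z - y‖ ^ 2 - 2 * inner ℝ (y' - y) (z - y') - ‖y' - y‖ ^ 2 := by
    have : z - y = (y' - y) + (z - y') := by abel
    rw [this, norm_add_sq_real]; ring
  have k1 : inner ℝ w (z - y) ≤ σ * (c.D₀ * c.γ₂ * p * (c.κg + c.κS * c.D₀)) := by
    refine (le_abs_self _).trans ((abs_real_inner_le_norm _ _).trans ?_)
    calc ‖w‖ * ‖z - y‖ ≤ (σ * B) * c.D₀ :=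
          mul_le_mul hwn (H.diam_le z hz y H.y_mem) (norm_nonneg _) (by positivity)
      _ = _ := by rw [hB]; ring
  -- Young's inequality, `-ab - (k/2) b² ≤ a²/(2k)` with `k = τ + α`; the factor `2` in `hall`
  -- cancels the denominator's.
  have k2 : -inner ℝ (v0 + w + V) (y' - y) - (τ + α) / 2 * ‖y' - y‖ ^ 2
      ≤ ((c.κf + B) ^ 2 + p * c.κg ^ 2 * ‖lam‖ ^ 2) / (τ + α) := by
    have a1 := (abs_le.1 (abs_real_inner_le_norm (v0 + w + V) (y' - y))).1
    rw [le_div_iff₀ hτα]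
    nlinarith [sq_nonneg (‖v0 + w + V‖ - (τ + α) * ‖y' - y‖),
      mul_le_mul_of_nonneg_left a1 hτα.le]
  rw [e4]
  rw [e3] at h1
  nlinarith

end IsModelStep

/-! ### Proximal points and Moreau envelopes of weakly convex functions -/

section Prox

variable {n : ℕ}

/-- The objective `z ↦ h z + (α/2) ‖z - x‖²` of the proximal problem. -/
noncomputable def proxObj (h : RVec n → ℝ) (α : ℝ) (x z : RVec n) : ℝ := h z + α / 2 * ‖z - x‖ ^ 2

/-- The quadratic `(α/2)‖· - x‖²` compensates the weak convexity and leaves modulus `α - m`; a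
minimizer then has quadratic growth. The proof compares it with points of the segment towards `w`.
-/
lemma WeaklyConvexOn.proxObj_growth {X : Set (RVec n)} {h : RVec n → ℝ} {m α : ℝ}
    (hh : WeaklyConvexOn X m h) {x z w : RVec n} (hz : z ∈ X) (hw : w ∈ X)
    (hmin : IsMinOn (proxObj h α x) X z) :
    proxObj h α x z + (α - m) / 2 * ‖w - z‖ ^ 2 ≤ proxObj h α x w := by
  have key : 0 ≤ proxObj h α x w - proxObj h α x z - (α - m) / 2 * ‖w - z‖ ^ 2 := by
    refine nonneg_of_forall_quadratic (E := (α - m) / 2 * ‖w - z‖ ^ 2) ?_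
    intro t ht ht1
    have h1 := hh.2 hz hw (by linarith : 0 ≤ 1 - t) ht.le (by ring)
    have hmem := hh.1 hz hw (by linarith : 0 ≤ 1 - t) ht.le (by ring)
    have h2 := isMinOn_iff.1 hmin _ hmem
    simp only [smul_eq_mul] at h1
    have e1 : (1 - t) • z + t • w = z + t • (w - z) := by module
    rw [e1] at h1 h2
    have e2 : ‖z + t • (w - z)‖ ^ 2 = ‖z‖ ^ 2 + 2 * t * inner ℝ z (w - z) + t ^ 2 * ‖w - z‖ ^ 2 := by
      rw [norm_add_sq_real, real_inner_smul_right, norm_smul, mul_pow, Real.norm_eq_abs, sq_abs]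
      ring
    have e3 : ‖z + t • (w - z) - x‖ ^ 2
        = ‖z - x‖ ^ 2 + 2 * t * inner ℝ (z - x) (w - z) + t ^ 2 * ‖w - z‖ ^ 2 := by
      have : z + t • (w - z) - x = (z - x) + t • (w - z) := by abel
      rw [this, norm_add_sq_real, real_inner_smul_right, norm_smul, mul_pow, Real.norm_eq_abs,
        sq_abs]
      ring
    have e4 : ‖w‖ ^ 2 = ‖z‖ ^ 2 + 2 * inner ℝ z (w - z) + ‖w - z‖ ^ 2 := by
      have : w = z + (w - z) := by abel
      conv_lhs => rw [this, norm_add_sq_real]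
    have e5 : ‖w - x‖ ^ 2 = ‖z - x‖ ^ 2 + 2 * inner ℝ (z - x) (w - z) + ‖w - z‖ ^ 2 := by
      have : w - x = (z - x) + (w - z) := by abel
      rw [this, norm_add_sq_real]
    simp only [proxObj] at h2 ⊢
    rw [e3] at h2
    rw [e2, e4] at h1
    rw [e5]
    nlinarith
  linarith

/-- Two proximal points, of functions that differ by `h' - h`. -/
lemma WeaklyConvexOn.dist_prox_le {X : Set (RVec n)} {h h' : RVec n → ℝ} {m α K : ℝ}
    (hh : WeaklyConvexOn X m h) (hh' : WeaklyConvexOn X m h') (hα : 0 ≤ α)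
    {x x' z z' : RVec n} (hz : z ∈ X) (hz' : z' ∈ X)
    (hmin : IsMinOn (proxObj h α x) X z) (hmin' : IsMinOn (proxObj h' α x') X z')
    (hK : (h' z - h z) - (h' z' - h z') ≤ K * ‖z' - z‖) (hK0 : 0 ≤ K) :
    (α - m) * ‖z' - z‖ ≤ α * ‖x' - x‖ + K := by
  have h1 := hh.proxObj_growth hz hz' hmin
  have h2 := hh'.proxObj_growth hz' hz hmin'
  rw [norm_sub_rev z z'] at h2
  simp only [proxObj] at h1 h2
  have e : ‖z' - x‖ ^ 2 - ‖z - x‖ ^ 2 + ‖z - x'‖ ^ 2 - ‖z' - x'‖ ^ 2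
      = 2 * inner ℝ (x' - x) (z' - z) := by
    simp only [← real_inner_self_eq_norm_sq, inner_sub_left, inner_sub_right]
    rw [real_inner_comm z x, real_inner_comm z' x, real_inner_comm z x', real_inner_comm z' x']
    ring
  have h3 := (le_abs_self _).trans (abs_real_inner_le_norm (x' - x) (z' - z))
  have h4 : (α - m) * ‖z' - z‖ * ‖z' - z‖ ≤ (α * ‖x' - x‖ + K) * ‖z' - z‖ := by
    have := mul_le_mul_of_nonneg_left h3 hα
    nlinarith
  rcases (norm_nonneg (z' - z)).eq_or_lt with h0 | h0
  · rw [← h0, mul_zero]; positivity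
  · exact le_of_mul_le_mul_right h4 h0

lemma moreauEnvelopeOn_eq {X : Set (RVec n)} {h : RVec n → ℝ} {α : ℝ} {x z : RVec n}
    (hz : z ∈ X) (hmin : IsMinOn (proxObj h α x) X z) :
    moreauEnvelopeOn X h (1 / α) x = proxObj h α x z := by
  have e : ∀ w : X, h w + 1 / (2 * (1 / α)) * ‖(w : RVec n) - x‖ ^ 2 = proxObj h α x w := by
    intro w
    have : 1 / (2 * (1 / α)) = α / 2 := by rw [one_div, mul_inv, one_div, inv_inv]; ring
    rw [this, proxObj]
  simp only [moreauEnvelopeOn, e]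
  have hle : ∀ w : X, proxObj h α x z ≤ proxObj h α x w := fun w => isMinOn_iff.1 hmin _ w.2
  have : Nonempty X := ⟨⟨z, hz⟩⟩
  have hbdd : BddBelow (range fun w : X => proxObj h α x w) :=
    ⟨proxObj h α x z, by rintro _ ⟨w, rfl⟩; exact hle w⟩
  exact le_antisymm (ciInf_le hbdd ⟨z, hz⟩) (le_ciInf hle)

/-- The gradient of the Moreau envelope of a weakly convex function. -/
lemma WeaklyConvexOn.hasGradientAt_moreauEnvelopeOn {X : Set (RVec n)} {h : RVec n → ℝ} {m α : ℝ}
    (hh : WeaklyConvexOn X m h) (hα : 0 ≤ α) (hm : m < α) {P : RVec n → RVec n}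
    (hP : ∀ x, P x ∈ X) (hmin : ∀ x, IsMinOn (proxObj h α x) X (P x)) (x : RVec n) :
    HasGradientAt (moreauEnvelopeOn X h (1 / α)) (α • (x - P x)) x := by
  rw [hasGradientAt_iff_hasFDerivAt]
  refine HasFDerivAt.of_isLittleO ?_
  have hlip : ∀ x', ‖P x' - P x‖ ≤ α / (α - m) * ‖x' - x‖ := by
    intro x'
    have := hh.dist_prox_le hh hα (hP x) (hP x') (hmin x) (hmin x') (K := 0) (by simp) le_rfl
    rw [div_mul_eq_mul_div, le_div_iff₀ (by linarith)]
    linarith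
  have hmin' : ∀ x z, z ∈ X → proxObj h α x (P x) ≤ proxObj h α x z :=
    fun x z hz => isMinOn_iff.1 (hmin x) z hz
  have hbound : ∀ x', ‖moreauEnvelopeOn X h (1 / α) x' - moreauEnvelopeOn X h (1 / α) x
      - (InnerProductSpace.toDual ℝ (RVec n)) (α • (x - P x)) (x' - x)‖
      ≤ (α / 2 + α * (α / (α - m))) * ‖‖x' - x‖ ^ 2‖ := by
    intro x'
    rw [moreauEnvelopeOn_eq (hP x) (hmin x), moreauEnvelopeOn_eq (hP x') (hmin x'),
      InnerProductSpace.toDual_apply_apply, real_inner_smul_left, Real.norm_eq_abs,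
      norm_pow, norm_norm]
    -- Each of the two envelopes is tested at the proximal point of the other centre. This traps the
    -- first-order remainder from both sides, and the Lipschitz bound on `P` makes the gap
    -- quadratic.
    have h1 := hmin' x' (P x) (hP x)
    have h2 := hmin' x (P x') (hP x')
    have e1 : ∀ z : RVec n, ‖z - x'‖ ^ 2 = ‖z - x‖ ^ 2 + 2 * inner ℝ (x - z) (x' - x)
        + ‖x' - x‖ ^ 2 := by
      intro z
      have : z - x' = -((x - z) + (x' - x)) := by abel
      rw [this, norm_neg, norm_add_sq_real, norm_sub_rev x z]
    simp only [proxObj, e1] at h1 h2 ⊢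
    have e2 : inner ℝ (x - P x') (x' - x) = inner ℝ (x - P x) (x' - x)
        - inner ℝ (P x' - P x) (x' - x) := by
      rw [← inner_sub_left]; congr 1; abel
    have h3 : inner ℝ (P x' - P x) (x' - x) ≤ α / (α - m) * ‖x' - x‖ ^ 2 := by
      refine (le_abs_self _).trans ((abs_real_inner_le_norm _ _).trans ?_)
      rw [pow_two, ← mul_assoc]
      exact mul_le_mul_of_nonneg_right (hlip x') (norm_nonneg _)
    have h4 := mul_le_mul_of_nonneg_left h3 hα
    have h5 : 0 ≤ α * (α / (α - m)) * ‖x' - x‖ ^ 2 := by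
      have : 0 < α - m := by linarith
      positivity
    rw [e2] at h1 ⊢
    have h6 : 0 ≤ α * ‖x' - x‖ ^ 2 := by positivity
    rw [abs_le]
    constructor <;> nlinarith
  refine (Asymptotics.IsBigO.of_bound _ (Filter.Eventually.of_forall hbound)).trans_isLittleO ?_
  have := (Asymptotics.isLittleO_norm_pow_id (E' := RVec n) one_lt_two).comp_tendsto
    (tendsto_sub_nhds_zero_iff.2 (Filter.tendsto_id (x := nhds x)))
  exact this

end Prox

/-! ### Consequences of the assumptions on the program -/

/-- The gradient inequality for weakly convex functions. -/
lemma WeaklyConvexOn.gradient_le {n : ℕ} {s : Set (RVec n)} {ρ : ℝ} {h : RVec n → ℝ}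
    (hh : WeaklyConvexOn s ρ h) {x z : RVec n} (hx : x ∈ s) (hz : z ∈ s)
    (hd : DifferentiableAt ℝ h x) :
    h x + inner ℝ (gradient h x) (z - x) - ρ / 2 * ‖z - x‖ ^ 2 ≤ h z := by
  have h1 : HasFDerivAt (fun y => h y + ρ / 2 * ‖y‖ ^ 2)
      (InnerProductSpace.toDual ℝ (RVec n) (gradient h x) + (ρ / 2) • (2 • innerSL ℝ x)) x :=
    (hasGradientAt_iff_hasFDerivAt.1 hd.hasGradientAt).add
      ((hasStrictFDerivAt_norm_sq x).hasFDerivAt.const_mul _)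
  have h2 : HasDerivAt (fun t : ℝ => (fun y => h y + ρ / 2 * ‖y‖ ^ 2) (AffineMap.lineMap x z t))
      ((InnerProductSpace.toDual ℝ (RVec n) (gradient h x) + (ρ / 2) • (2 • innerSL ℝ x)) (z - x))
      0 := by
    have h0 : (AffineMap.lineMap x z : ℝ → RVec n) 0 = x := AffineMap.lineMap_apply_zero x z
    rw [← h0] at h1
    have hl : HasDerivAt (AffineMap.lineMap x z : ℝ → RVec n) (z - x) 0 :=
      AffineMap.hasDerivAt_lineMap
    have := h1.comp_hasDerivAt (0 : ℝ) hl
    rw [h0] at this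
    exact this
  have h3 := ConvexOn.comp_affineMap (AffineMap.lineMap x z : ℝ →ᵃ[ℝ] RVec n) hh
  have h4 := h3.le_slope_of_hasDerivAt (x := 0) (y := 1) (by simpa using hx) (by simpa using hz)
    zero_lt_one h2
  simp only [slope_def_field, Function.comp, AffineMap.lineMap_apply_one,
    AffineMap.lineMap_apply_zero, sub_zero, div_one, add_apply, smul_apply,
    InnerProductSpace.toDual_apply_apply, innerSL_apply_apply, smul_eq_mul, nsmul_eq_mul] at h4
  have e4 : ‖z‖ ^ 2 = ‖x‖ ^ 2 + 2 * inner ℝ x (z - x) + ‖z - x‖ ^ 2 := by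
    have : z = x + (z - x) := by abel
    conv_lhs => rw [this, norm_add_sq_real]
  rw [e4] at h4
  push_cast at h4
  linarith

lemma norm_fderiv_eq_norm_gradient {n : ℕ} (h : RVec n → ℝ) (x : RVec n) :
    ‖fderiv ℝ h x‖ = ‖gradient h x‖ := by
  rw [gradient, LinearIsometryEquiv.norm_map]

namespace StochProgram.Assumptions

variable {n p : ℕ} {Ξ : Type*} [MeasurableSpace Ξ] {Q : StochProgram n p Ξ} {c : ProgConsts p}

lemma abs_F_sub_le (hQ : Q.Assumptions c) {x z : RVec n} (hx : x ∈ Q.O₀) (hz : z ∈ Q.O₀) (ξ : Ξ) :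
    |Q.F z ξ - Q.F x ξ| ≤ c.κf * ‖z - x‖ :=
  Convex.norm_image_sub_le_of_norm_fderiv_le (𝕜 := ℝ) (f := fun y => Q.F y ξ)
    (fun y hy => hQ.F_diff y hy ξ)
    (fun y hy => by rw [norm_fderiv_eq_norm_gradient]; exact hQ.norm_gradF_le y hy ξ)
    hQ.O₀_convex hx hz

lemma abs_G_sub_le (hQ : Q.Assumptions c) (i : Fin p) {x z : RVec n} (hx : x ∈ Q.O₀)
    (hz : z ∈ Q.O₀) (ξ : Ξ) : |Q.G i z ξ - Q.G i x ξ| ≤ c.κg * ‖z - x‖ :=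
  Convex.norm_image_sub_le_of_norm_fderiv_le (𝕜 := ℝ) (f := fun y => Q.G i y ξ)
    (fun y hy => hQ.G_diff i y hy ξ)
    (fun y hy => by rw [norm_fderiv_eq_norm_gradient]; exact hQ.norm_gradG_le i y hy ξ)
    hQ.O₀_convex hx hz

lemma abs_G_le (hQ : Q.Assumptions c) (i : Fin p) {x : RVec n} (hx : x ∈ Q.O₀) (ξ : Ξ) :
    |Q.G i x ξ| ≤ c.νg :=
  (abs_apply_le_norm (Q.Gvec x ξ) i).trans (hQ.norm_G_le x hx ξ)

lemma f_sub (hQ : Q.Assumptions c) {x z : RVec n} (hx : x ∈ Q.O₀) (hz : z ∈ Q.O₀) :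
    Q.f z - Q.f x = ∫ ξ, (Q.F z ξ - Q.F x ξ) ∂Q.P :=
  (integral_sub (hQ.F_int z hz) (hQ.F_int x hx)).symm

lemma abs_f_sub_le (hQ : Q.Assumptions c) {x z : RVec n} (hx : x ∈ Q.O₀) (hz : z ∈ Q.O₀) :
    |Q.f z - Q.f x| ≤ c.κf * ‖z - x‖ := by
  have := hQ.isProb
  rw [hQ.f_sub hx hz]
  simpa using norm_integral_le_of_norm_le_const (μ := Q.P)
    (Filter.Eventually.of_forall fun ξ => (Real.norm_eq_abs _).trans_le (hQ.abs_F_sub_le hx hz ξ))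

lemma abs_g_sub_le (hQ : Q.Assumptions c) (i : Fin p) {x z : RVec n} (hx : x ∈ Q.O₀)
    (hz : z ∈ Q.O₀) : |Q.g i z - Q.g i x| ≤ c.κg * ‖z - x‖ := by
  have := hQ.isProb
  have : Q.g i z - Q.g i x = ∫ ξ, (Q.G i z ξ - Q.G i x ξ) ∂Q.P :=
    (integral_sub (hQ.G_int i z hz) (hQ.G_int i x hx)).symm
  rw [this]
  simpa using norm_integral_le_of_norm_le_const (μ := Q.P)
    (Filter.Eventually.of_forall fun ξ => (Real.norm_eq_abs _).trans_le (hQ.abs_G_sub_le i hx hz ξ))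

lemma integral_Gvec (hQ : Q.Assumptions c) {x : RVec n} (hx : x ∈ Q.O₀) :
    Integrable (Q.Gvec x) Q.P ∧ ∫ ξ, Q.Gvec x ξ ∂Q.P = Q.gvec x := by
  have hint : Integrable (Q.Gvec x) Q.P :=
    (PiLp.continuousLinearEquiv 2 ℝ (fun _ : Fin p => ℝ)).symm.toContinuousLinearMap.integrable_comp
      (Integrable.of_eval fun i => hQ.G_int i x hx)
  refine ⟨hint, ?_⟩
  ext i
  have := (EuclideanSpace.proj (𝕜 := ℝ) i : RVec p →L[ℝ] ℝ).integral_comp_comm hint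
  exact this.symm

lemma norm_gvec_le (hQ : Q.Assumptions c) {x : RVec n} (hx : x ∈ Q.O₀) : ‖Q.gvec x‖ ≤ c.νg := by
  have := hQ.isProb
  rw [← (hQ.integral_Gvec hx).2]
  simpa using norm_integral_le_of_norm_le_const (μ := Q.P)
    (Filter.Eventually.of_forall fun ξ => hQ.norm_G_le x hx ξ)

lemma abs_g_le (hQ : Q.Assumptions c) (i : Fin p) {x : RVec n} (hx : x ∈ Q.O₀) :
    |Q.g i x| ≤ c.νg := (abs_apply_le_norm (Q.gvec x) i).trans (hQ.norm_gvec_le hx)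

lemma norm_gvec_sub_le (hQ : Q.Assumptions c) {x z : RVec n} (hx : x ∈ Q.O₀) (hz : z ∈ Q.O₀) :
    ‖Q.gvec z - Q.gvec x‖ ≤ √(p : ℝ) * (c.κg * ‖z - x‖) :=
  norm_le_sqrt_mul_of_abs_le (mul_nonneg hQ.κg_pos.le (norm_nonneg _))
    fun i => hQ.abs_g_sub_le i hx hz

lemma weaklyConvexOn_integral {n : ℕ} {Ξ : Type*} [MeasurableSpace Ξ] {P : Measure Ξ}
    [IsProbabilityMeasure P] {s : Set (RVec n)} {ρ : ℝ} {F : RVec n → Ξ → ℝ} (hs : Convex ℝ s)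
    (hint : ∀ x ∈ s, Integrable (F x) P) (hF : ∀ ξ, WeaklyConvexOn s ρ (fun y => F y ξ)) :
    WeaklyConvexOn s ρ (fun y => ∫ ξ, F y ξ ∂P) := by
  have e : ∀ y ∈ s, ∫ ξ, F y ξ ∂P + ρ / 2 * ‖y‖ ^ 2 = ∫ ξ, (F y ξ + ρ / 2 * ‖y‖ ^ 2) ∂P := by
    intro y hy
    rw [integral_add (hint y hy) (integrable_const _), integral_const]
    simp
  have hint' : ∀ y ∈ s, Integrable (fun ξ => F y ξ + ρ / 2 * ‖y‖ ^ 2) P := fun y hy =>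
    (hint y hy).add (integrable_const _)
  refine ⟨hs, fun x hx z hz a b ha hb hab => ?_⟩
  simp only
  rw [e x hx, e z hz, e _ (hs hx hz ha hb hab), smul_eq_mul, smul_eq_mul, ← integral_const_mul,
    ← integral_const_mul, ← integral_add ((hint' x hx).const_mul a) ((hint' z hz).const_mul b)]
  refine integral_mono (hint' _ (hs hx hz ha hb hab))
    (((hint' x hx).const_mul a).add ((hint' z hz).const_mul b)) fun ξ => ?_
  exact (hF ξ).2 hx hz ha hb hab

/-- The Lagrangian is weakly convex. -/
lemma weaklyConvexOn_lagrangian (hQ : Q.Assumptions c) {lam : RVec p} (hlam : ∀ i, 0 ≤ lam i)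
    {m : ℝ} (hm : c.L₀ + ∑ i, lam i * c.L i ≤ m) :
    WeaklyConvexOn Q.X₀ m (fun z => Q.lagrangian z lam) := by
  have := hQ.isProb
  have hf := weaklyConvexOn_integral hQ.O₀_convex hQ.F_int hQ.F_weak
  have hg := fun i => weaklyConvexOn_integral hQ.O₀_convex (hQ.G_int i) (hQ.G_weak i)
  have hsub := hQ.X₀_subset
  refine ⟨hQ.X₀_convex, fun x hx z hz a b ha hb hab => ?_⟩
  have h0 := hf.2 (hsub hx) (hsub hz) ha hb hab
  have hi := Finset.sum_le_sum fun i (_ : i ∈ Finset.univ) =>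
    mul_le_mul_of_nonneg_left ((hg i).2 (hsub hx) (hsub hz) ha hb hab) (hlam i)
  simp only [smul_eq_mul, mul_add] at h0 hi ⊢
  have e : ∀ y : RVec n, ∑ i, lam i * (c.L i / 2 * ‖y‖ ^ 2)
      = (∑ i, lam i * c.L i) / 2 * ‖y‖ ^ 2 := by
    intro y; rw [Finset.sum_div, Finset.sum_mul]; exact Finset.sum_congr rfl fun i _ => by ring
  have e' : ∀ (y : RVec n) (a : ℝ), ∑ i, lam i * (a * (c.L i / 2 * ‖y‖ ^ 2))
      = a * ((∑ i, lam i * c.L i) / 2 * ‖y‖ ^ 2) := by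
    intro y a; rw [← e, Finset.mul_sum]; exact Finset.sum_congr rfl fun i _ => by ring
  have e'' : ∀ (y : RVec n) (a : ℝ), ∑ i, lam i * (a * ∫ ξ, Q.G i y ξ ∂Q.P)
      = a * ∑ i, lam i * ∫ ξ, Q.G i y ξ ∂Q.P := by
    intro y a; rw [Finset.mul_sum]; exact Finset.sum_congr rfl fun i _ => by ring
  simp only [Finset.sum_add_distrib, e, e', e''] at hi
  have hsq : ‖a • x + b • z‖ ^ 2 ≤ a * ‖x‖ ^ 2 + b * ‖z‖ ^ 2 := by
    have hb' : b = 1 - a := by linarith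
    have : ‖a • x + b • z‖ ^ 2 = a ^ 2 * ‖x‖ ^ 2 + 2 * (a * b) * inner ℝ x z + b ^ 2 * ‖z‖ ^ 2 := by
      rw [norm_add_sq_real, norm_smul, norm_smul, real_inner_smul_left, real_inner_smul_right,
        mul_pow, mul_pow, Real.norm_eq_abs, Real.norm_eq_abs, sq_abs, sq_abs]; ring
    rw [this]
    have h2 : 0 ≤ ‖x - z‖ ^ 2 := sq_nonneg _
    rw [norm_sub_sq_real] at h2
    subst hb'
    nlinarith [mul_le_mul_of_nonneg_left h2 (mul_nonneg ha hb)]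
  have hk := mul_le_mul_of_nonneg_left hsq (by linarith : 0 ≤ (m - (c.L₀ + ∑ i, lam i * c.L i)) / 2)
  simp only [lagrangian, f, g]
  linarith

lemma isCompact_X₀ (hQ : Q.Assumptions c) : IsCompact Q.X₀ := by
  refine Metric.isCompact_of_isClosed_isBounded hQ.X₀_closed ?_
  refine Metric.isBounded_iff.2 ⟨c.D₀, fun x hx z hz => ?_⟩
  rw [dist_eq_norm]; exact hQ.diam_le x hx z hz

lemma lagrangian_eq (x : RVec n) (lam : RVec p) :
    Q.lagrangian x lam = Q.f x + inner ℝ lam (Q.gvec x) := by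
  simp [lagrangian, gvec, PiLp.inner_apply, mul_comm]

lemma continuousOn_lagrangian (hQ : Q.Assumptions c) (lam : RVec p) :
    ContinuousOn (fun z => Q.lagrangian z lam) Q.X₀ := by
  have hf : ContinuousOn Q.f Q.X₀ := by
    refine (LipschitzOnWith.of_dist_le_mul (K := ⟨c.κf, hQ.κf_pos.le⟩) fun x hx z hz => ?_).continuousOn
    rw [Real.dist_eq, dist_eq_norm]
    exact hQ.abs_f_sub_le (hQ.X₀_subset hz) (hQ.X₀_subset hx)
  have hg : ∀ i, ContinuousOn (Q.g i) Q.X₀ := fun i => by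
    refine (LipschitzOnWith.of_dist_le_mul (K := ⟨c.κg, hQ.κg_pos.le⟩) fun x hx z hz => ?_).continuousOn
    rw [Real.dist_eq, dist_eq_norm]
    exact hQ.abs_g_sub_le i (hQ.X₀_subset hz) (hQ.X₀_subset hx)
  exact hf.add (continuousOn_finsetSum _ fun i _ => continuousOn_const.mul (hg i))

lemma exists_prox (hQ : Q.Assumptions c) (α : ℝ) (lam : RVec p) (x : RVec n) :
    ∃ z ∈ Q.X₀, IsMinOn (proxObj (fun z => Q.lagrangian z lam) α x) Q.X₀ z :=
  hQ.isCompact_X₀.exists_isMinOn hQ.X₀_nonempty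
    ((hQ.continuousOn_lagrangian lam).add (by fun_prop))

/-- The proximal point of the Lagrangian. -/
noncomputable def prox (hQ : Q.Assumptions c) (α : ℝ) (lam : RVec p) (x : RVec n) : RVec n :=
  (hQ.exists_prox α lam x).choose

lemma prox_mem (hQ : Q.Assumptions c) (α : ℝ) (lam : RVec p) (x : RVec n) :
    hQ.prox α lam x ∈ Q.X₀ := (hQ.exists_prox α lam x).choose_spec.1

lemma isMinOn_prox (hQ : Q.Assumptions c) (α : ℝ) (lam : RVec p) (x : RVec n) :
    IsMinOn (proxObj (fun z => Q.lagrangian z lam) α x) Q.X₀ (hQ.prox α lam x) :=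
  (hQ.exists_prox α lam x).choose_spec.2

lemma lagEnvelope_eq (hQ : Q.Assumptions c) (α : ℝ) (lam : RVec p) (x : RVec n) :
    Q.lagEnvelope α lam x = proxObj (fun z => Q.lagrangian z lam) α x (hQ.prox α lam x) :=
  moreauEnvelopeOn_eq (hQ.prox_mem α lam x) (hQ.isMinOn_prox α lam x)

lemma lagEnvelope_le (hQ : Q.Assumptions c) (α : ℝ) (lam : RVec p) (x : RVec n) {z : RVec n}
    (hz : z ∈ Q.X₀) : Q.lagEnvelope α lam x ≤ Q.lagrangian z lam + α / 2 * ‖z - x‖ ^ 2 := by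
  rw [hQ.lagEnvelope_eq]
  exact isMinOn_iff.1 (hQ.isMinOn_prox α lam x) z hz

lemma hasGradientAt_lagEnvelope (hQ : Q.Assumptions c) {α : ℝ} {lam : RVec p}
    (hlam : ∀ i, 0 ≤ lam i) (hm : c.L₀ + ∑ i, lam i * c.L i < α) (hα : 0 ≤ α) (x : RVec n) :
    HasGradientAt (Q.lagEnvelope α lam) (α • (x - hQ.prox α lam x)) x :=
  (hQ.weaklyConvexOn_lagrangian hlam le_rfl).hasGradientAt_moreauEnvelopeOn hα hm
    (hQ.prox_mem α lam) (hQ.isMinOn_prox α lam) x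

/-- The multipliers for which the Lagrangian is `m`-weakly convex. -/
def multiplierSet (c : ProgConsts p) (m : ℝ) : Set (RVec p) :=
  {lam | (∀ i, 0 ≤ lam i) ∧ c.L₀ + ∑ i, lam i * c.L i ≤ m}

/-- The proximal point depends continuously on the multiplier and the centre. -/
lemma continuous_prox (hQ : Q.Assumptions c) {α m : ℝ} (hm : m < α) (hα : 0 ≤ α) :
    Continuous fun a : multiplierSet c m × RVec n => hQ.prox α (a.1 : RVec p) a.2 := by
  rw [Metric.continuous_iff]
  intro b ε hε
  set K := √(p : ℝ) * c.κg with hK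
  have hK0 : 0 ≤ K := mul_nonneg (Real.sqrt_nonneg _) hQ.κg_pos.le
  have hαm : 0 < α - m := by linarith
  refine ⟨(α - m) * ε / (α + K + 1), by positivity, fun a ha => ?_⟩
  have h1 := max_lt_iff.1 (Prod.dist_eq (x := a) (y := b) ▸ ha)
  set z := hQ.prox α (b.1 : RVec p) b.2
  set z' := hQ.prox α (a.1 : RVec p) a.2
  have hz := hQ.prox_mem α (b.1 : RVec p) b.2
  have hz' := hQ.prox_mem α (a.1 : RVec p) a.2
  have h2 := (hQ.weaklyConvexOn_lagrangian b.1.2.1 b.1.2.2).dist_prox_le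
    (hQ.weaklyConvexOn_lagrangian a.1.2.1 a.1.2.2) hα hz hz' (hQ.isMinOn_prox α (b.1 : RVec p) b.2)
    (hQ.isMinOn_prox α (a.1 : RVec p) a.2) (K := K * ‖(a.1 : RVec p) - b.1‖) (by
      have e : (Q.lagrangian z a.1 - Q.lagrangian z b.1)
          - (Q.lagrangian z' a.1 - Q.lagrangian z' b.1)
          = inner ℝ ((a.1 : RVec p) - b.1) (Q.gvec z - Q.gvec z') := by
        simp only [lagrangian_eq, inner_sub_left, inner_sub_right]; ring
      refine (le_of_eq e).trans ((le_abs_self _).trans ((abs_real_inner_le_norm _ _).trans ?_))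
      have h3 := hQ.norm_gvec_sub_le (hQ.X₀_subset hz') (hQ.X₀_subset hz)
      rw [norm_sub_rev z z'] at h3
      calc _ ≤ ‖(a.1 : RVec p) - b.1‖ * (√(p : ℝ) * (c.κg * ‖z' - z‖)) :=
            mul_le_mul_of_nonneg_left h3 (norm_nonneg _)
        _ = _ := by rw [hK]; ring) (by positivity)
  rw [dist_eq_norm]
  have h4 : ‖(a.1 : RVec p) - b.1‖ < (α - m) * ε / (α + K + 1) := by
    have := h1.1; rwa [Subtype.dist_eq, dist_eq_norm] at this
  have h5 : ‖a.2 - b.2‖ < (α - m) * ε / (α + K + 1) := by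
    have := h1.2; rwa [dist_eq_norm] at this
  set δ := (α - m) * ε / (α + K + 1) with hδ
  have h6 : δ * (α + K + 1) = (α - m) * ε := div_mul_cancel₀ _ (by positivity)
  have h7 : 0 < δ := by positivity
  have h8 : (α - m) * ‖z' - z‖ < (α - m) * ε := by
    have := mul_le_mul_of_nonneg_left h4.le hK0
    have := mul_le_mul_of_nonneg_left h5.le hα
    nlinarith
  exact lt_of_mul_lt_mul_left h8 hαm.le

end StochProgram.Assumptions

/-! ### Exponential moments of processes with negative drift -/

section Drift

variable {Ω : Type*} [MeasurableSpace Ω] {μ : Measure Ω} [IsProbabilityMeasure μ]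

lemma integrable_of_abs_le {f : Ω → ℝ} (hf : Measurable f) {C : ℝ} (hC : ∀ ω, |f ω| ≤ C) :
    Integrable f μ :=
  Integrable.of_bound hf.aestronglyMeasurable C (Filter.Eventually.of_forall hC)

/-- Taylor expansion of order two; for `|x| ≤ 1/4` the cubic remainder fits into the difference
between `2/3` and `1/2`. -/
lemma exp_le_of_abs_le_quarter {x : ℝ} (hx : |x| ≤ 1 / 4) :
    Real.exp x ≤ 1 + x + 2 / 3 * x ^ 2 := by
  have h := (abs_le.1 (Real.exp_bound (x := x) (by linarith) (n := 3) (by norm_num))).2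
  norm_num [Finset.sum_range_succ, Nat.factorial] at h
  have h2 : |x| ^ 3 ≤ x ^ 2 * (1 / 4) := by
    rw [pow_succ, sq_abs]; exact mul_le_mul_of_nonneg_left hx (sq_nonneg x)
  nlinarith [sq_nonneg x]

lemma abs_sub_le_mul {z : ℕ → ℝ} {δ : ℝ} {N : ℕ} (hinc : ∀ t, 1 ≤ t → t ≤ N → |z (t + 1) - z t| ≤ δ)
    {t k : ℕ} (ht : 1 ≤ t) (htk : t + k ≤ N + 1) : |z (t + k) - z t| ≤ k * δ := by
  induction k with
  | zero => simp
  | succ k ih =>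
    have h1 := ih (by omega)
    have h2 := hinc (t + k) (by omega) (by omega)
    have : z (t + (k + 1)) - z t = (z (t + k + 1) - z (t + k)) + (z (t + k) - z t) := by
      rw [← add_assoc]; ring
    rw [this]
    refine (abs_add_le _ _).trans ?_
    push_cast
    linarith

/-- The drift is known for `Z²`, the exponential needs it for `Z`. The passage is `z' - z ≤ (z'² -
z²)/(2z)`, which produces the weight `e^{rz}/(2z)`. -/
lemma exp_le_of_abs_sub_le {r D z z' : ℝ} (hr : 0 < r) (hrD : r * D ≤ 1 / 4) (hz : 0 < z)
    (hzz : |z' - z| ≤ D) :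
    Real.exp (r * z') ≤ Real.exp (r * z) * (1 + 2 / 3 * (r * D) ^ 2)
      + r * (Real.exp (r * z) / (2 * z) * (z' ^ 2 - z ^ 2)) := by
  have hez := Real.exp_pos (r * z)
  have k1 : Real.exp (r * z') = Real.exp (r * z) * Real.exp (r * (z' - z)) := by
    rw [← Real.exp_add]; congr 1; ring
  have k2 : |r * (z' - z)| ≤ r * D := by
    rw [abs_mul, abs_of_pos hr]; exact mul_le_mul_of_nonneg_left hzz hr.le
  have k3 := exp_le_of_abs_le_quarter (k2.trans hrD)
  have k4 : (r * (z' - z)) ^ 2 ≤ (r * D) ^ 2 := sq_le_sq' (abs_le.1 k2).1 (abs_le.1 k2).2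
  have k5 : r * (z' - z) ≤ r * ((z' ^ 2 - z ^ 2) / (2 * z)) := by
    refine mul_le_mul_of_nonneg_left ?_ hr.le
    rw [le_div_iff₀ (by positivity)]
    nlinarith [sq_nonneg (z' - z)]
  rw [k1]
  have : Real.exp (r * z) * Real.exp (r * (z' - z)) ≤ Real.exp (r * z)
      * (1 + r * ((z' ^ 2 - z ^ 2) / (2 * z)) + 2 / 3 * (r * D) ^ 2) :=
    mul_le_mul_of_nonneg_left (by linarith) hez.le
  refine this.trans (le_of_eq ?_)
  ring

/-- For `z ≥ θ` one has `θ/2 - z ≤ -z/2`, and the factor `z` cancels the denominator of the weight.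
-/
lemma weight_mul_le {a b z θ : ℝ} (ha : 0 ≤ a) (hb : 0 < b) (hz : 0 < z) (hθz : θ ≤ z) :
    a / (2 * z) * (b * (θ / 2 - z)) ≤ -(b / 4) * a := by
  rw [div_mul_eq_mul_div, div_le_iff₀ (by positivity)]
  have : b * (θ / 2 - z) ≤ -(b / 4) * (2 * z) := by nlinarith
  nlinarith [mul_le_mul_of_nonneg_left this ha]

/-- A nonnegative process with bounded increments and negative drift over windows of length `s`
while above the level `θ` has a uniformly bounded exponential moment. -/
theorem integral_exp_le_of_drift {Z : ℕ → Ω → ℝ} {N s : ℕ} {θ δ b D : ℝ}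
    (hZm : ∀ t, 1 ≤ t → t ≤ N + 1 → Measurable (Z t))
    (hZ0 : ∀ t, 1 ≤ t → t ≤ N + 1 → ∀ ω, 0 ≤ Z t ω) (hZ1 : ∀ ω, Z 1 ω = 0)
    (hinc : ∀ ω t, 1 ≤ t → t ≤ N → |Z (t + 1) ω - Z t ω| ≤ δ)
    (hs : 1 ≤ s) (hδ : 0 ≤ δ) (hD : s * δ ≤ D) (hb : 0 < b) (hbD : b ≤ D) (hθ : 0 < θ)
    (hdrift : ∀ t, 1 ≤ t → t + s ≤ N + 1 → ∀ w : ℝ → ℝ, Measurable w → (∀ z, 0 ≤ w z) →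
      (∃ C, ∀ z, w z ≤ C) →
      ∫ ω, w (Z t ω) * (Z (t + s) ω ^ 2 - Z t ω ^ 2) ∂μ
        ≤ ∫ ω, w (Z t ω) * (b * (θ / 2 - Z t ω)) ∂μ) :
    ∀ t, 1 ≤ t → t ≤ N + 1 → ∫ ω, Real.exp (b / (4 * D ^ 2) * Z t ω) ∂μ
      ≤ Real.exp (b / (4 * D ^ 2) * (θ + D)) * (48 * D ^ 2 / b ^ 2) := by
  have hD0 : 0 < D := hb.trans_le hbD
  -- With this rate `r b / 4 = (rD)²`, so the drift dominates the second-order term `(2/3)(rD)²` and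
  -- leaves the contraction factor `1 - (rD)²/3 = 1 - b²/(48D²)`.
  set r := b / (4 * D ^ 2) with hr
  have hr0 : 0 < r := by positivity
  have hrD : r * D ≤ 1 / 4 := by
    rw [hr, div_mul_eq_mul_div, div_le_div_iff₀ (by positivity) (by norm_num)]
    nlinarith
  have hrb : r * b = 4 * (r * D) ^ 2 := by rw [hr]; field_simp
  set A := Real.exp (r * (θ + D)) with hA
  -- The fixed point of the recursion `e ↦ A + (1 - b²/(48D²)) e` over one window.
  set C := A * (48 * D ^ 2 / b ^ 2) with hC
  have hA1 : 1 ≤ A := Real.one_le_exp (by positivity)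
  have hB : ∀ t, 1 ≤ t → t ≤ N + 1 → ∀ ω, Z t ω ≤ N * δ := by
    intro t ht htN ω
    have h := abs_sub_le_mul (z := fun t => Z t ω) (hinc ω) (t := 1) (k := t - 1) le_rfl (by omega)
    rw [show 1 + (t - 1) = t by omega, hZ1, sub_zero] at h
    refine (le_abs_self _).trans (h.trans (mul_le_mul_of_nonneg_right ?_ hδ))
    exact_mod_cast (by omega : t - 1 ≤ N)
  have hint : ∀ t, 1 ≤ t → t ≤ N + 1 → Integrable (fun ω => Real.exp (r * Z t ω)) μ := by
    intro t ht htN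
    refine integrable_of_abs_le (C := Real.exp (r * (N * δ)))
      (((hZm t ht htN).const_mul r).exp) fun ω => ?_
    rw [abs_of_pos (Real.exp_pos _)]
    exact Real.exp_le_exp.2 (mul_le_mul_of_nonneg_left (hB t ht htN ω) hr0.le)
  -- the recursion over one window
  have hrec : ∀ t, 1 ≤ t → t + s ≤ N + 1 → ∫ ω, Real.exp (r * Z (t + s) ω) ∂μ
      ≤ A + (1 - b ^ 2 / (48 * D ^ 2)) * ∫ ω, Real.exp (r * Z t ω) ∂μ := by
    intro t ht hts
    -- The lower cutoff keeps the denominator away from zero. The upper cutoff only makes the weight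
    -- bounded, since the process never exceeds `N δ`.
    set w : ℝ → ℝ := fun z => if θ ≤ z ∧ z ≤ N * δ then Real.exp (r * z) / (2 * z) else 0 with hw
    have hwm : Measurable w := by
      refine Measurable.ite (measurableSet_Ici.inter measurableSet_Iic) ?_ measurable_const
      fun_prop
    have hw0 : ∀ z, 0 ≤ w z := by
      intro z
      simp only [hw]
      split_ifs with h
      · have : 0 < z := hθ.trans_le h.1
        positivity
      · exact le_rfl
    have hwC : ∀ z, w z ≤ Real.exp (r * (N * δ)) / (2 * θ) := by
      intro z
      simp only [hw]
      split_ifs with h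
      · gcongr
        · exact h.2
        · exact h.1
      · positivity
    have hd := hdrift t ht hts w hwm hw0 ⟨_, hwC⟩
    have htN : t ≤ N + 1 := by omega
    have hts1 : 1 ≤ t + s := by omega
    have hwZm : Measurable fun ω => w (Z t ω) := hwm.comp (hZm t ht htN)
    have hsqb : ∀ u, 1 ≤ u → u ≤ N + 1 → ∀ ω, Z u ω ^ 2 ≤ (N * δ) ^ 2 := fun u hu huN ω =>
      pow_le_pow_left₀ (hZ0 u hu huN ω) (hB u hu huN ω) 2
    have hi1 : Integrable (fun ω => w (Z t ω) * (Z (t + s) ω ^ 2 - Z t ω ^ 2)) μ := by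
      refine integrable_of_abs_le (C := Real.exp (r * (N * δ)) / (2 * θ) * (N * δ) ^ 2)
        (hwZm.mul (((hZm _ hts1 hts).pow_const 2).sub ((hZm t ht htN).pow_const 2))) fun ω => ?_
      rw [abs_mul, abs_of_nonneg (hw0 _)]
      refine mul_le_mul (hwC _) ?_ (abs_nonneg _) (by positivity)
      rw [abs_le]
      constructor <;> nlinarith [hsqb _ hts1 hts ω, hsqb t ht htN ω, sq_nonneg (Z t ω),
        sq_nonneg (Z (t + s) ω)]
    have hi2 : Integrable (fun ω => w (Z t ω) * (b * (θ / 2 - Z t ω))) μ := by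
      refine integrable_of_abs_le
        (C := Real.exp (r * (N * δ)) / (2 * θ) * (b * (θ / 2 + N * δ)))
        (hwZm.mul (((hZm t ht htN).const_sub _).const_mul b)) fun ω => ?_
      rw [abs_mul, abs_of_nonneg (hw0 _), abs_mul, abs_of_pos hb]
      refine mul_le_mul (hwC _) (mul_le_mul_of_nonneg_left ?_ hb.le) (by positivity)
        (by positivity)
      rw [abs_le]
      constructor <;> nlinarith [hB t ht htN ω, hZ0 t ht htN ω]
    have hpt : ∀ ω, Real.exp (r * Z (t + s) ω) ≤ A
        + (1 + 2 / 3 * (r * D) ^ 2 - r * b / 4) * Real.exp (r * Z t ω)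
        + r * (w (Z t ω) * (Z (t + s) ω ^ 2 - Z t ω ^ 2))
        - r * (w (Z t ω) * (b * (θ / 2 - Z t ω))) := by
      intro ω
      have hz0 := hZ0 t ht htN ω
      have hzB := hB t ht htN ω
      have hinc' : |Z (t + s) ω - Z t ω| ≤ D := (abs_sub_le_mul (z := fun t => Z t ω) (hinc ω) ht hts).trans hD
      have hfac : 0 ≤ 1 + 2 / 3 * (r * D) ^ 2 - r * b / 4 := by
        rw [hrb]; nlinarith [mul_pos hr0 hD0]
      set z := Z t ω
      set z' := Z (t + s) ω
      have hez := Real.exp_pos (r * z)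
      by_cases hzθ : θ ≤ z
      · have hzpos : 0 < z := hθ.trans_le hzθ
        have hwz : w z = Real.exp (r * z) / (2 * z) := by
          simp only [hw]; rw [if_pos ⟨hzθ, hzB⟩]
        have k1 := exp_le_of_abs_sub_le hr0 hrD hzpos hinc'
        have k2 := mul_le_mul_of_nonneg_left (weight_mul_le hez.le hb hzpos hzθ) hr0.le
        rw [hwz]
        linarith [Real.exp_pos (r * (θ + D))]
      -- Below the level no drift is available, but one window raises the process by at most `D`;
      -- the constant `A` covers this case.
      · have hwz : w z = 0 := by simp only [hw]; rw [if_neg (fun h => hzθ h.1)]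
        push Not at hzθ
        have k1 : Real.exp (r * z') ≤ A :=
          Real.exp_le_exp.2 (mul_le_mul_of_nonneg_left (by linarith [(abs_le.1 hinc').2]) hr0.le)
        rw [hwz, zero_mul, zero_mul, mul_zero]
        linarith [mul_nonneg hfac hez.le]
    have j0 : Integrable (fun ω => (1 + 2 / 3 * (r * D) ^ 2 - r * b / 4) * Real.exp (r * Z t ω)) μ :=
      (hint t ht htN).const_mul _
    have j1 : Integrable (fun ω => A + (1 + 2 / 3 * (r * D) ^ 2 - r * b / 4)
        * Real.exp (r * Z t ω)) μ := (integrable_const A).add j0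
    have j2 : Integrable (fun ω => A + (1 + 2 / 3 * (r * D) ^ 2 - r * b / 4)
        * Real.exp (r * Z t ω) + r * (w (Z t ω) * (Z (t + s) ω ^ 2 - Z t ω ^ 2))) μ :=
      j1.add (hi1.const_mul r)
    refine (integral_mono (hint _ hts1 hts) (j2.sub (hi2.const_mul r)) hpt).trans ?_
    simp only [Pi.sub_apply]
    rw [integral_sub j2 (hi2.const_mul r), integral_add j1 (hi1.const_mul r),
      integral_add (integrable_const A) j0, integral_const_mul, integral_const_mul,
      integral_const_mul, integral_const]
    simp only [probReal_univ, smul_eq_mul, one_mul]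
    have e : 1 + 2 / 3 * (r * D) ^ 2 - r * b / 4 = 1 - b ^ 2 / (48 * D ^ 2) := by
      rw [hr]; field_simp; ring
    rw [e]
    have := mul_le_mul_of_nonneg_left hd hr0.le
    linarith
  have hκ : 0 < b ^ 2 / (48 * D ^ 2) := by positivity
  have hκ1 : b ^ 2 / (48 * D ^ 2) ≤ 1 := by
    rw [div_le_one (by positivity)]; nlinarith
  have hAC : A = b ^ 2 / (48 * D ^ 2) * C := by rw [hC]; field_simp
  have hC0 : 0 ≤ C := by positivity
  intro t
  induction t using Nat.strong_induction_on with
  | _ t ih =>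
    intro ht htN
    -- The induction proceeds by strides of `s`. In the first window the start at `0` gives `Z t ≤ s
    -- δ ≤ D`.
    by_cases hts : t ≤ s
    · have h1 : ∀ ω, Real.exp (r * Z t ω) ≤ A := by
        intro ω
        have h := abs_sub_le_mul (z := fun t => Z t ω) (hinc ω) (t := 1) (k := t - 1) le_rfl (by omega)
        rw [show 1 + (t - 1) = t by omega, hZ1, sub_zero] at h
        refine Real.exp_le_exp.2 (mul_le_mul_of_nonneg_left ?_ hr0.le)
        have h2 : ((t - 1 : ℕ) : ℝ) * δ ≤ s * δ :=
          mul_le_mul_of_nonneg_right (by exact_mod_cast (by omega : t - 1 ≤ s)) hδ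
        linarith [le_abs_self (Z t ω)]
      have h2 := integral_mono (hint t ht htN) (integrable_const A) h1
      simp only [integral_const, probReal_univ, smul_eq_mul, one_mul] at h2
      refine h2.trans ?_
      rw [hAC]; nlinarith
    · have h1 := hrec (t - s) (by omega) (by omega)
      rw [show t - s + s = t by omega] at h1
      have h2 := ih (t - s) (by omega) (by omega) (by omega)
      refine h1.trans ?_
      have := mul_le_mul_of_nonneg_left h2 (by linarith : 0 ≤ 1 - b ^ 2 / (48 * D ^ 2))
      nlinarith

/-- First and second moments from an exponential moment. -/
lemma moments_le_of_integral_exp_le {Z : Ω → ℝ} {r C : ℝ} (hr : 0 < r) (hC : 1 ≤ C)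
    (hZm : Measurable Z) (hZ0 : ∀ ω, 0 ≤ Z ω) {B : ℝ} (hZB : ∀ ω, Z ω ≤ B)
    (h : ∫ ω, Real.exp (r * Z ω) ∂μ ≤ C) :
    ∫ ω, Z ω ∂μ ≤ Real.log C / r ∧
    ∫ ω, Z ω ^ 2 ∂μ ≤ (Real.log C / r) ^ 2 + 2 * (Real.log C / r) * (1 / r) + 2 * (1 / r) ^ 2 := by
  have hC0 : 0 < C := by linarith
  set ℓ := Real.log C with hℓ
  have hℓ0 : 0 ≤ ℓ := Real.log_nonneg hC
  have hei : Integrable (fun ω => Real.exp (r * Z ω)) μ := by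
    refine integrable_of_abs_le (C := Real.exp (r * B)) ((hZm.const_mul r).exp) fun ω => ?_
    rw [abs_of_pos (Real.exp_pos _)]
    exact Real.exp_le_exp.2 (mul_le_mul_of_nonneg_left (hZB ω) hr.le)
  have hZi : Integrable Z μ := integrable_of_abs_le (C := B) hZm fun ω => by
    rw [abs_of_nonneg (hZ0 ω)]; exact hZB ω
  have hZi2 : Integrable (fun ω => Z ω ^ 2) μ :=
    integrable_of_abs_le (C := B ^ 2) (hZm.pow_const 2) fun ω => by
      rw [abs_of_nonneg (sq_nonneg _)]; exact pow_le_pow_left₀ (hZ0 ω) (hZB ω) 2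
  have hu : ∀ ω, Real.exp (r * Z ω - ℓ) = Real.exp (r * Z ω) / C := by
    intro ω; rw [Real.exp_sub, hℓ, Real.exp_log hC0]
  -- Normalizing by `C = e^ℓ` gives `E e^{rZ-ℓ} ≤ 1`; the mean then follows from `1 + v ≤ e^v` with
  -- `v = rZ - ℓ`.
  have hle1 : ∫ ω, Real.exp (r * Z ω) / C ∂μ ≤ 1 := by
    rw [integral_div, div_le_one hC0]; exact h
  constructor
  · have h1 := integral_mono ((hZi.const_mul r).add (integrable_const (1 - ℓ)))
      (hei.div_const C) (fun ω => by
        have := Real.add_one_le_exp (r * Z ω - ℓ)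
        rw [hu] at this
        simp only [Pi.add_apply]
        linarith)
    simp only [Pi.add_apply] at h1
    rw [integral_add (hZi.const_mul r) (integrable_const _), integral_const_mul,
      integral_const] at h1
    simp only [probReal_univ, smul_eq_mul, one_mul] at h1
    rw [le_div_iff₀ hr]
    linarith
  -- Pointwise `(rZ)² ≤ ℓ² + (2ℓ + 2) e^{rZ-ℓ}`: this is clear if `rZ ≤ ℓ`, and otherwise `e^v ≥ 1 +
  -- v + v²/2` dominates both `2ℓv` and `v²`.
  · have h1 := integral_mono (hZi2.const_mul (r ^ 2)) ((integrable_const (ℓ ^ 2)).add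
      ((hei.div_const C).const_mul (2 * ℓ + 2))) (fun ω => by
        have hq : 0 ≤ Real.exp (r * Z ω) / C := by positivity
        simp only [Pi.add_apply]
        by_cases hz : r * Z ω ≤ ℓ
        · have h2 : r ^ 2 * Z ω ^ 2 ≤ ℓ ^ 2 := by
            rw [← mul_pow]; exact pow_le_pow_left₀ (mul_nonneg hr.le (hZ0 ω)) hz 2
          nlinarith
        · push Not at hz
          have h3 := Real.quadratic_le_exp_of_nonneg (sub_nonneg.2 hz.le)
          rw [hu] at h3
          nlinarith [mul_le_mul_of_nonneg_left h3 hℓ0, sub_nonneg.2 hz.le,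
            sq_nonneg (r * Z ω - ℓ), mul_nonneg hℓ0 (sq_nonneg (r * Z ω - ℓ))])
    simp only [Pi.add_apply] at h1
    rw [integral_add (integrable_const _) ((hei.div_const C).const_mul _), integral_const_mul,
      integral_const_mul, integral_const] at h1
    simp only [probReal_univ, smul_eq_mul, one_mul] at h1
    have h2 : r ^ 2 * ∫ ω, Z ω ^ 2 ∂μ ≤ ℓ ^ 2 + 2 * ℓ + 2 := by nlinarith
    have e : (ℓ / r) ^ 2 + 2 * (ℓ / r) * (1 / r) + 2 * (1 / r) ^ 2
        = (ℓ ^ 2 + 2 * ℓ + 2) / r ^ 2 := by field_simp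
    rw [e, le_div_iff₀ (by positivity)]
    linarith

end Drift

/-! ### Measurability and independence -/

section Measurability

variable {n p : ℕ} {Ξ Ω : Type*} [MeasurableSpace Ξ]

/-- A function that is measurable in `ξ` and continuous in `x ∈ O` is jointly measurable. -/
lemma measurable_indicator_of_continuousOn {O : Set (RVec n)} (hO : MeasurableSet O)
    {F : RVec n → Ξ → ℝ} (hm : ∀ x ∈ O, Measurable (F x))
    (hc : ∀ ξ, ContinuousOn (fun y => F y ξ) O) :
    Measurable fun a : RVec n × Ξ => O.indicator (fun y => F y a.2) a.1 := by
  have hs : MeasurableSet (Prod.fst ⁻¹' O : Set (RVec n × Ξ)) := measurable_fst hO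
  refine measurable_of_restrict_of_restrict_compl hs ?_ ?_
  · have h1 : Measurable (Function.uncurry fun (y : O) (ξ : Ξ) => F y ξ) :=
      measurable_uncurry_of_continuous_of_measurable
        (fun ξ => continuousOn_iff_continuous_domRestrict.1 (hc ξ)) fun y => hm y y.2
    have h2 : Measurable fun a : (Prod.fst ⁻¹' O : Set (RVec n × Ξ)) =>
        ((⟨a.1.1, a.2⟩ : O), a.1.2) :=
      (Measurable.subtype_mk (measurable_fst.comp measurable_subtype_coe)).prodMk
        (measurable_snd.comp measurable_subtype_coe)
    convert! h1.comp h2 using 1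
    ext a
    exact indicator_of_mem (s := O) a.2 (fun y => F y a.1.2)
  · convert! measurable_const (a := (0 : ℝ)) using 1
    ext a
    exact indicator_of_notMem (s := O) a.2 (fun y => F y a.1.2)

lemma measurable_comp_of_continuousOn {m : MeasurableSpace Ω} {O : Set (RVec n)}
    (hO : MeasurableSet O) {F : RVec n → Ξ → ℝ} (hm : ∀ x ∈ O, Measurable (F x))
    (hc : ∀ ξ, ContinuousOn (fun y => F y ξ) O) {y : Ω → RVec n} {e : Ω → Ξ}
    (hy : Measurable y) (hyO : ∀ ω, y ω ∈ O) (he : Measurable e) :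
    Measurable fun ω => F (y ω) (e ω) := by
  convert! (measurable_indicator_of_continuousOn hO hm hc).comp (hy.prodMk he) using 1
  ext ω
  exact (indicator_of_mem (hyO ω) (fun y => F y (e ω))).symm

/-- Each coordinate of the gradient is a limit of difference quotients. Extending the function by
zero off `O` keeps the quotients measurable even while the shifted point lies outside `O`; the limit
is unaffected because `O` is open. -/
lemma measurable_gradient_comp {m : MeasurableSpace Ω} {O : Set (RVec n)}
    (hO : IsOpen O) {F : RVec n → Ξ → ℝ} (hm : ∀ x ∈ O, Measurable (F x))
    (hd : ∀ x ∈ O, ∀ ξ, DifferentiableAt ℝ (fun y => F y ξ) x) {y : Ω → RVec n} {e : Ω → Ξ}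
    (hy : Measurable y) (hyO : ∀ ω, y ω ∈ O) (he : Measurable e) :
    Measurable fun ω => gradient (fun y => F y (e ω)) (y ω) := by
  have hc : ∀ ξ, ContinuousOn (fun y => F y ξ) O := fun ξ x hx =>
    (hd x hx ξ).continuousAt.continuousWithinAt
  have hG := measurable_indicator_of_continuousOn hO.measurableSet hm hc
  have hcoord : ∀ j, Measurable fun ω => gradient (fun y => F y (e ω)) (y ω) j := by
    intro j
    set v : RVec n := EuclideanSpace.single j 1 with hv
    have hlim : ∀ ω, Filter.Tendsto (fun k : ℕ => ((k : ℝ) + 1) *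
        (O.indicator (fun y => F y (e ω)) (y ω + ((k : ℝ) + 1)⁻¹ • v)
          - O.indicator (fun y => F y (e ω)) (y ω))) Filter.atTop
        (nhds (gradient (fun y => F y (e ω)) (y ω) j)) := by
      intro ω
      have h1 := hasGradientAt_iff_hasFDerivAt.1 (hd (y ω) (hyO ω) (e ω)).hasGradientAt
      have heq : O.indicator (fun y => F y (e ω)) =ᶠ[nhds (y ω)] fun y => F y (e ω) := by
        filter_upwards [hO.mem_nhds (hyO ω)] with z hz
        exact indicator_of_mem hz _
      have h2 := (h1.congr_of_eventuallyEq heq).lim (l := Filter.atTop)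
        (c := fun k : ℕ => (k : ℝ) + 1) v (by
          have : Filter.Tendsto (fun k : ℕ => (k : ℝ) + 1) Filter.atTop Filter.atTop :=
            Filter.tendsto_atTop_add_const_right _ _ tendsto_natCast_atTop_atTop
          exact tendsto_norm_atTop_atTop.comp this)
      rw [InnerProductSpace.toDual_apply_apply, hv, EuclideanSpace.inner_single_right] at h2
      simpa using h2
    refine measurable_of_tendsto_metrizable (fun k => ?_) (tendsto_pi_nhds.2 hlim)
    refine Measurable.const_mul (Measurable.sub ?_ ?_) _
    · exact hG.comp ((hy.add_const _).prodMk he)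
    · exact hG.comp (hy.prodMk he)
  exact (PiLp.continuousLinearEquiv 2 ℝ (fun _ : Fin n => ℝ)).symm.continuous.measurable.comp
    (measurable_pi_iff.2 hcoord)

lemma measurable_apply {m : MeasurableSpace Ω} {y : Ω → RVec n} (hy : Measurable y) (j : Fin n) :
    Measurable fun ω => y ω j :=
  (EuclideanSpace.proj (𝕜 := ℝ) j : RVec n →L[ℝ] ℝ).continuous.measurable.comp hy

lemma measurable_of_apply {m : MeasurableSpace Ω} {y : Ω → RVec n}
    (hy : ∀ j, Measurable fun ω => y ω j) : Measurable y :=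
  (PiLp.continuousLinearEquiv 2 ℝ (fun _ : Fin n => ℝ)).symm.continuous.measurable.comp
    (measurable_pi_iff.2 hy)

lemma measurable_inner {m : MeasurableSpace Ω} {u w : Ω → RVec n} (hu : Measurable u)
    (hw : Measurable w) : Measurable fun ω => (inner ℝ (u ω) (w ω) : ℝ) :=
  (continuous_inner (𝕜 := ℝ) (E := RVec n)).measurable.comp (hu.prodMk hw)

lemma measurable_quadModel {m : MeasurableSpace Ω} {c : Ω → ℝ} {v y x : Ω → RVec n}
    {S : Ω → Matrix (Fin n) (Fin n) ℝ} (hc : Measurable c) (hv : Measurable v) (hy : Measurable y)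
    (hx : Measurable x) (hS : ∀ a b, Measurable fun ω => S ω a b) :
    Measurable fun ω => quadModel (c ω) (v ω) (S ω) (y ω) (x ω) := by
  have hd : Measurable fun ω => x ω - y ω := hx.sub hy
  refine (hc.add (measurable_inner hv hd)).add (Measurable.const_mul (measurable_inner ?_ hd) _)
  refine measurable_of_apply fun j => ?_
  have : ∀ ω, matOp (S ω) (x ω - y ω) j = ∑ k, S ω j k * (x ω - y ω) k := fun ω => by
    rw [matOp, Matrix.ofLp_toEuclideanCLM]; rfl
  simp only [this]
  exact Finset.measurable_sum _ fun k _ => (hS j k).mul (measurable_apply hd k)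

lemma indep_history {mΩ : MeasurableSpace Ω} {μ : Measure Ω} {ξ : ℕ → Ω → Ξ} (hξ : ∀ t, Measurable (ξ t)) (hind : iIndepFun ξ μ) {t : ℕ}
    (ht : 1 ≤ t) :
    Indep (history ξ (t - 1)) (MeasurableSpace.comap (ξ t) inferInstance) μ := by
  have h := indep_iSup_of_disjoint (fun t => (hξ t).comap_le) hind.iIndep
    (S := Icc 1 (t - 1)) (T := {t}) (by
      rw [Set.disjoint_singleton_right]
      intro h; have := h.2; omega)
  simpa only [mem_singleton_iff, iSup_iSup_eq_left] using h

variable {m mΩ : MeasurableSpace Ω} {μ : Measure Ω} [IsProbabilityMeasure μ]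

/-- Integrating out a random variable that is independent of the past. -/
lemma integral_comp_of_indep {U : Type*} [MeasurableSpace U] {P : Measure Ξ}
    (hm : m ≤ mΩ) {u : Ω → U} (hu : Measurable[m] u) {e : Ω → Ξ} (he : Measurable e)
    (hind : Indep m (MeasurableSpace.comap e inferInstance) μ) (hP : μ.map e = P)
    {h : U → Ξ → ℝ} (hh : Measurable (Function.uncurry h))
    (hint : Integrable (fun ω => h (u ω) (e ω)) μ) :
    ∫ ω, h (u ω) (e ω) ∂μ = ∫ ω, ∫ ξ, h (u ω) ξ ∂P ∂μ := by
  have hu' : Measurable u := hu.mono hm le_rfl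
  have hind' : IndepFun u e μ := indep_of_indep_of_le_left hind hu.comap_le
  have hprod := (indepFun_iff_map_prod_eq_prod_map_map hu'.aemeasurable he.aemeasurable).1 hind'
  have hpair : Measurable fun ω => (u ω, e ω) := hu'.prodMk he
  have : IsProbabilityMeasure (μ.map u) := Measure.isProbabilityMeasure_map hu'.aemeasurable
  have : IsProbabilityMeasure (μ.map e) := Measure.isProbabilityMeasure_map he.aemeasurable
  have hint' : Integrable (Function.uncurry h) ((μ.map u).prod (μ.map e)) := by
    rw [← hprod]
    exact (integrable_map_measure hh.aestronglyMeasurable hpair.aemeasurable).2 hint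
  calc ∫ ω, h (u ω) (e ω) ∂μ = ∫ a, Function.uncurry h a ∂(μ.map fun ω => (u ω, e ω)) :=
        (integral_map hpair.aemeasurable hh.aestronglyMeasurable).symm
    _ = ∫ a, ∫ ξ, h a ξ ∂(μ.map e) ∂(μ.map u) := by
        rw [hprod, integral_prod _ hint']; rfl
    _ = ∫ ω, ∫ ξ, h (u ω) ξ ∂P ∂μ := by
        have h3 : Integrable (fun a => ∫ ξ, h a ξ ∂(μ.map e)) (μ.map u) := hint'.integral_prod_left
        rw [integral_map hu'.aemeasurable h3.aestronglyMeasurable, hP]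

lemma history_le {ξ : ℕ → Ω → Ξ} (hξ : ∀ t, Measurable (ξ t)) (t : ℕ) : history ξ t ≤ mΩ :=
  iSup₂_le fun s _ => (hξ s).comap_le

lemma history_mono {ξ : ℕ → Ω → Ξ} {s t : ℕ} (hst : s ≤ t) : history ξ s ≤ history ξ t :=
  biSup_mono fun _ hk => ⟨hk.1, hk.2.trans hst⟩

lemma measurable_history {ξ : ℕ → Ω → Ξ} {t : ℕ} (ht : 1 ≤ t) : Measurable[history ξ t] (ξ t) :=
  (comap_measurable (ξ t)).mono
    (le_biSup (fun s => MeasurableSpace.comap (ξ s) inferInstance) ⟨ht, le_rfl⟩) le_rfl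

/-- Averaging over an independent uniform index. -/
lemma integral_uniform_index {R : Ω → ℕ} (hR : Measurable R) {T : ℕ}
    (hR_law : μ.map R = uniformOn (Icc 1 T)) (hm : m ≤ mΩ)
    (hind : Indep (MeasurableSpace.comap R inferInstance) m μ) {Y : ℕ → Ω → ℝ} {C : ℝ}
    (hY : ∀ t, 1 ≤ t → t ≤ T → Measurable[m] (Y t))
    (hC : ∀ t, 1 ≤ t → t ≤ T → ∀ ω, |Y t ω| ≤ C) :
    Integrable (fun ω => Y (R ω) ω) μ ∧
      ∫ ω, Y (R ω) ω ∂μ = 1 / T * ∑ t ∈ Finset.Icc 1 T, ∫ ω, Y t ω ∂μ := by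
  classical
  have hcoe : ((Finset.Icc 1 T : Finset ℕ) : Set ℕ) = Icc 1 T := Finset.coe_Icc 1 T
  have hlaw : ∀ t, 1 ≤ t → t ≤ T → μ.real (R ⁻¹' {t}) = 1 / T := by
    intro t h1 h2
    rw [Measure.real, ← Measure.map_apply hR (measurableSet_singleton t), hR_law, uniformOn,
      cond_apply (by measurability), ← hcoe, Measure.count_apply_finset]
    have : (↑(Finset.Icc 1 T) ∩ {t} : Set ℕ) = {t} := by
      rw [Set.inter_eq_right, Set.singleton_subset_iff, hcoe]; exact ⟨h1, h2⟩
    rw [this, Measure.count_singleton]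
    simp
  have hae : ∀ᵐ ω ∂μ, R ω ∈ Icc 1 T := by
    have h1 : ∀ᵐ t ∂(μ.map R), t ∈ Icc 1 T := by
      rw [hR_law, uniformOn]
      exact ae_cond_mem (by measurability)
    exact ae_of_ae_map hR.aemeasurable h1
  have hYi : ∀ t, 1 ≤ t → t ≤ T → Integrable (Y t) μ := fun t h1 h2 =>
    integrable_of_abs_le ((hY t h1 h2).mono hm le_rfl) (hC t h1 h2)
  set I : ℕ → ℕ → ℝ := fun t => ({t} : Set ℕ).indicator fun _ => 1 with hI
  have hIm : ∀ t, Measurable (I t) := fun t => measurable_from_top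
  have hIi : ∀ t, Integrable (fun ω => I t (R ω)) μ := fun t =>
    integrable_of_abs_le (C := 1) ((hIm t).comp hR) fun ω => by
      simp only [hI, indicator]; split_ifs <;> simp
  have hindf : ∀ t, 1 ≤ t → t ≤ T → IndepFun (fun ω => I t (R ω)) (Y t) μ := by
    intro t h1 h2
    have hRY : IndepFun R (Y t) μ := indep_of_indep_of_le_right hind (hY t h1 h2).comap_le
    exact hRY.comp (hIm t) measurable_id
  have hterm : ∀ t, 1 ≤ t → t ≤ T → Integrable (fun ω => I t (R ω) * Y t ω) μ ∧
      ∫ ω, I t (R ω) * Y t ω ∂μ = 1 / T * ∫ ω, Y t ω ∂μ := by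
    intro t h1 h2
    refine ⟨(hindf t h1 h2).integrable_mul (hIi t) (hYi t h1 h2), ?_⟩
    rw [(hindf t h1 h2).integral_fun_mul_eq_mul_integral (hIi t).aestronglyMeasurable
      (hYi t h1 h2).aestronglyMeasurable]
    congr 1
    have : ∀ ω, I t (R ω) = (R ⁻¹' {t}).indicator (fun _ => (1 : ℝ)) ω := fun ω => rfl
    simp only [this]
    rw [integral_indicator_const _ (hR (measurableSet_singleton t)), hlaw t h1 h2]
    simp
  have hsum : (fun ω => Y (R ω) ω) =ᵐ[μ] fun ω => ∑ t ∈ Finset.Icc 1 T, I t (R ω) * Y t ω := by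
    filter_upwards [hae] with ω hω
    rw [Finset.sum_eq_single (R ω)]
    · simp [hI]
    · intro t _ ht
      simp [hI, ht.symm]
    · intro h
      exact absurd (Finset.mem_Icc.2 hω) h
  have hti : ∀ t ∈ Finset.Icc 1 T, Integrable (fun ω => I t (R ω) * Y t ω) μ := fun t ht =>
    (hterm t (Finset.mem_Icc.1 ht).1 (Finset.mem_Icc.1 ht).2).1
  refine ⟨(integrable_finsetSum _ hti).congr hsum.symm, ?_⟩
  rw [integral_congr_ae hsum, integral_finsetSum _ hti, Finset.mul_sum]
  exact Finset.sum_congr rfl fun t ht =>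
    (hterm t (Finset.mem_Icc.1 ht).1 (Finset.mem_Icc.1 ht).2).2

end Measurability

/-! ### Replacing the sampled functions by their expectations -/

namespace StochProgram.Assumptions

variable {n p : ℕ} {Ξ Ω : Type*} [MeasurableSpace Ξ] {Q : StochProgram n p Ξ} {c : ProgConsts p}
  {m mΩ : MeasurableSpace Ω} {μ : Measure Ω} [IsProbabilityMeasure μ]

lemma continuousOn_F (hQ : Q.Assumptions c) (ξ : Ξ) : ContinuousOn (fun y => Q.F y ξ) Q.O₀ :=
  fun x hx => (hQ.F_diff x hx ξ).continuousAt.continuousWithinAt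

lemma continuousOn_G (hQ : Q.Assumptions c) (i : Fin p) (ξ : Ξ) :
    ContinuousOn (fun y => Q.G i y ξ) Q.O₀ :=
  fun x hx => (hQ.G_diff i x hx ξ).continuousAt.continuousWithinAt

lemma measurable_G (hQ : Q.Assumptions c) (i : Fin p) {y : Ω → RVec n} {e : Ω → Ξ}
    (hy : Measurable y) (hyO : ∀ ω, y ω ∈ Q.O₀) (he : Measurable e) :
    Measurable fun ω => Q.G i (y ω) (e ω) :=
  measurable_comp_of_continuousOn hQ.O₀_open.measurableSet (hQ.G_meas i) (hQ.continuousOn_G i)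
    hy hyO he

lemma measurable_F (hQ : Q.Assumptions c) {y : Ω → RVec n} {e : Ω → Ξ}
    (hy : Measurable y) (hyO : ∀ ω, y ω ∈ Q.O₀) (he : Measurable e) :
    Measurable fun ω => Q.F (y ω) (e ω) :=
  measurable_comp_of_continuousOn hQ.O₀_open.measurableSet hQ.F_meas hQ.continuousOn_F
    hy hyO he

lemma measurable_Gvec (hQ : Q.Assumptions c) {y : Ω → RVec n} {e : Ω → Ξ}
    (hy : Measurable y) (hyO : ∀ ω, y ω ∈ Q.O₀) (he : Measurable e) :
    Measurable fun ω => Q.Gvec (y ω) (e ω) :=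
  measurable_of_apply fun i => hQ.measurable_G i hy hyO he

lemma measurable_gradG (hQ : Q.Assumptions c) (i : Fin p) {y : Ω → RVec n} {e : Ω → Ξ}
    (hy : Measurable y) (hyO : ∀ ω, y ω ∈ Q.O₀) (he : Measurable e) :
    Measurable fun ω => Q.gradG i (y ω) (e ω) :=
  measurable_gradient_comp hQ.O₀_open (hQ.G_meas i) (hQ.G_diff i) hy hyO he

lemma measurable_f (hQ : Q.Assumptions c) {y : Ω → RVec n} (hy : Measurable y)
    (hyO : ∀ ω, y ω ∈ Q.O₀) : Measurable fun ω => Q.f (y ω) :=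
  have hc : ContinuousOn Q.f Q.O₀ :=
    (LipschitzOnWith.of_dist_le_mul (K := ⟨c.κf, hQ.κf_pos.le⟩) fun x hx z hz => by
      rw [Real.dist_eq, dist_eq_norm]; exact hQ.abs_f_sub_le hz hx).continuousOn
  measurable_comp_of_continuousOn (Ξ := Unit) (F := fun y _ => Q.f y) hQ.O₀_open.measurableSet
    (fun _ _ => measurable_const) (fun _ => hc) hy hyO (e := fun _ => ()) measurable_const

lemma measurable_g (hQ : Q.Assumptions c) (i : Fin p) {y : Ω → RVec n} (hy : Measurable y)
    (hyO : ∀ ω, y ω ∈ Q.O₀) : Measurable fun ω => Q.g i (y ω) :=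
  have hc : ContinuousOn (Q.g i) Q.O₀ :=
    (LipschitzOnWith.of_dist_le_mul (K := ⟨c.κg, hQ.κg_pos.le⟩) fun x hx z hz => by
      rw [Real.dist_eq, dist_eq_norm]; exact hQ.abs_g_sub_le i hz hx).continuousOn
  measurable_comp_of_continuousOn (Ξ := Unit) (F := fun y _ => Q.g i y) hQ.O₀_open.measurableSet
    (fun _ _ => measurable_const) (fun _ => hc) hy hyO (e := fun _ => ()) measurable_const

lemma measurable_gvec (hQ : Q.Assumptions c) {y : Ω → RVec n} (hy : Measurable y)
    (hyO : ∀ ω, y ω ∈ Q.O₀) : Measurable fun ω => Q.gvec (y ω) :=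
  measurable_of_apply fun i => hQ.measurable_g i hy hyO

lemma abs_inner_le {V : RVec p} {C B : ℝ} {w : RVec p} (hV : ‖V‖ ≤ C) (hw : ‖w‖ ≤ B) :
    |inner ℝ V w| ≤ C * B :=
  (abs_real_inner_le_norm _ _).trans
    (mul_le_mul hV hw (norm_nonneg _) ((norm_nonneg _).trans hV))

/-- Constraint values at points determined by the past may be replaced by their means. -/
lemma integral_inner_Gvec (hQ : Q.Assumptions c) (hm : m ≤ mΩ) {V : Ω → RVec p} {y : Ω → RVec n}
    {e : Ω → Ξ} (hV : Measurable[m] V) {C : ℝ} (hVC : ∀ ω, ‖V ω‖ ≤ C) (hy : Measurable[m] y)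
    (hyO : ∀ ω, y ω ∈ Q.O₀) (he : Measurable e)
    (hind : Indep m (MeasurableSpace.comap e inferInstance) μ) (hP : μ.map e = Q.P) :
    ∫ ω, inner ℝ (V ω) (Q.Gvec (y ω) (e ω)) ∂μ = ∫ ω, inner ℝ (V ω) (Q.gvec (y ω)) ∂μ := by
  -- Nothing is assumed about `G` off `O₀`; the indicator gives a function that is jointly
  -- measurable on the whole product and agrees with the inner product along the trajectory.
  set h : RVec p × RVec n → Ξ → ℝ := fun u ξ =>
    ∑ i, Q.O₀.indicator (fun y => Q.G i y ξ) u.2 * u.1 i with hh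
  have hval : ∀ ω ξ, h (V ω, y ω) ξ = inner ℝ (V ω) (Q.Gvec (y ω) ξ) := by
    intro ω ξ
    simp only [hh, indicator_of_mem (hyO ω), Gvec, PiLp.inner_apply]
    rfl
  have hhm : Measurable (Function.uncurry h) := by
    refine Finset.measurable_sum _ fun i _ => Measurable.mul ?_ ?_
    · exact (measurable_indicator_of_continuousOn hQ.O₀_open.measurableSet (hQ.G_meas i)
        (hQ.continuousOn_G i)).comp
          (((measurable_snd.comp measurable_fst)).prodMk measurable_snd)
    · exact measurable_apply (measurable_fst.comp measurable_fst) i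
  have hint : Integrable (fun ω => h (V ω, y ω) (e ω)) μ := by
    simp only [hval]
    exact integrable_of_abs_le (measurable_inner (hV.mono hm le_rfl)
      (hQ.measurable_Gvec (hy.mono hm le_rfl) hyO he))
      fun ω => abs_inner_le (hVC ω) (hQ.norm_G_le _ (hyO ω) _)
  have key := integral_comp_of_indep hm (hV.prodMk hy) he hind hP hhm hint
  simp only [hval] at key
  rw [key]
  refine integral_congr_ae (Filter.Eventually.of_forall fun ω => ?_)
  simp only
  rw [← (hQ.integral_Gvec (hyO ω)).2]
  exact integral_inner (hQ.integral_Gvec (hyO ω)).1 (V ω)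

/-- Objective differences at points determined by the past may be replaced by their means. -/
lemma integral_F_sub (hQ : Q.Assumptions c) (hm : m ≤ mΩ) {y z : Ω → RVec n}
    {e : Ω → Ξ} (hy : Measurable[m] y) (hz : Measurable[m] z)
    (hyX : ∀ ω, y ω ∈ Q.X₀) (hzX : ∀ ω, z ω ∈ Q.X₀) (he : Measurable e)
    (hind : Indep m (MeasurableSpace.comap e inferInstance) μ) (hP : μ.map e = Q.P) :
    ∫ ω, (Q.F (z ω) (e ω) - Q.F (y ω) (e ω)) ∂μ = ∫ ω, (Q.f (z ω) - Q.f (y ω)) ∂μ := by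
  have hyO := fun ω => hQ.X₀_subset (hyX ω)
  have hzO := fun ω => hQ.X₀_subset (hzX ω)
  set h : RVec n × RVec n → Ξ → ℝ := fun u ξ =>
    Q.O₀.indicator (fun y => Q.F y ξ) u.2 - Q.O₀.indicator (fun y => Q.F y ξ) u.1 with hh
  have hval : ∀ ω ξ, h (y ω, z ω) ξ = Q.F (z ω) ξ - Q.F (y ω) ξ := by
    intro ω ξ
    simp only [hh, indicator_of_mem (hyO ω), indicator_of_mem (hzO ω)]
  have hF := measurable_indicator_of_continuousOn hQ.O₀_open.measurableSet hQ.F_meas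
    hQ.continuousOn_F
  have hhm : Measurable (Function.uncurry h) :=
    (hF.comp ((measurable_snd.comp measurable_fst).prodMk measurable_snd)).sub
      (hF.comp ((measurable_fst.comp measurable_fst).prodMk measurable_snd))
  have hint : Integrable (fun ω => h (y ω, z ω) (e ω)) μ := by
    simp only [hval]
    refine integrable_of_abs_le (C := c.κf * c.D₀)
      ((hQ.measurable_F (hz.mono hm le_rfl) hzO he).sub
        (hQ.measurable_F (hy.mono hm le_rfl) hyO he)) fun ω => ?_
    exact (hQ.abs_F_sub_le (hyO ω) (hzO ω) _).trans
      (mul_le_mul_of_nonneg_left (hQ.diam_le _ (hzX ω) _ (hyX ω)) hQ.κf_pos.le)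
  have key := integral_comp_of_indep hm (hy.prodMk hz) he hind hP hhm hint
  simp only [hval] at key
  rw [key]
  refine integral_congr_ae (Filter.Eventually.of_forall fun ω => ?_)
  exact (hQ.f_sub (hyO ω) (hzO ω)).symm

end StochProgram.Assumptions

/-! ### Runs of the method -/

/-- A run of the method on i.i.d. samples, with parameters that are in the admissible range. -/
structure IsSampledRun {n p : ℕ} {Ω Ξ : Type*} [mΩ : MeasurableSpace Ω] [MeasurableSpace Ξ]
    (Q : StochProgram n p Ξ) (c : ProgConsts p) (μ : Measure Ω) (σ α τ : ℝ) (T : ℕ)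
    (ξ : ℕ → Ω → Ξ) (x1 : RVec n) (Sig : ℕ → Fin p → Ω → Matrix (Fin n) (Fin n) ℝ)
    (x : ℕ → Ω → RVec n) (lam : ℕ → Ω → RVec p) : Prop where
  isProb : IsProbabilityMeasure μ
  assumptions : Q.Assumptions c
  p_pos : 1 ≤ p
  σ_pos : 0 < σ
  σ_le_one : σ ≤ 1
  α_pos : 0 < α
  τ_pos : 0 < τ
  κS_pos : 0 < c.κS
  κS_le : √(p : ℝ) * c.κS * c.D₀ ^ 2 ≤ c.ε₀
  -- Length of the drift windows: long enough that the telescoped distances cost at most `D₀²/2` per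
  -- step, short enough that a multiplier moves by at most `3 γ₁`.
  window : ∃ s : ℕ, 1 ≤ s ∧ s * σ ≤ 3 ∧ τ + α ≤ s
  -- As `λ_i` grows by at most `σ γ₂` per step, `α` exceeds twice the weak convexity modulus of
  -- every Lagrangian met during the run.
  weak : 2 * (c.L₀ + ∑ i, T * (σ * c.γ₂) * c.L i) < α
  ξ_meas : ∀ t, Measurable (ξ t)
  ξ_law : ∀ t ∈ Icc 1 T, μ.map (ξ t) = Q.P
  ξ_indep : iIndepFun ξ μ
  x1_mem : x1 ∈ Q.X₀
  run : IsPMQSopt Q σ α τ T x1 ξ Sig x lam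
  Sig_le : ∀ t ∈ Icc 1 T, ∀ i ω,
    (-(c.L i) • (1 : Matrix (Fin n) (Fin n) ℝ) - Sig t i ω).PosSemidef
  Sig_norm : ∀ t ∈ Icc 1 T, ∀ i ω, ‖matOp (Sig t i ω)‖ ≤ c.κS

lemma inner_matOp_le_of_posSemidef {n : ℕ} {S : Matrix (Fin n) (Fin n) ℝ} {l : ℝ}
    (h : (-l • (1 : Matrix (Fin n) (Fin n) ℝ) - S).PosSemidef) (u : RVec n) :
    inner ℝ (matOp S u) u ≤ -l * ‖u‖ ^ 2 := by
  have h1 := (Matrix.posSemidef_iff_dotProduct_mulVec.1 h).2 (u : Fin n → ℝ)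
  have h2 : inner ℝ u (matOp (-l • (1 : Matrix (Fin n) (Fin n) ℝ) - S) u)
      = -l * ‖u‖ ^ 2 - inner ℝ (matOp S u) u := by
    have : matOp (-l • (1 : Matrix (Fin n) (Fin n) ℝ) - S) u = -l • u - matOp S u := by
      simp [matOp]
    rw [this, inner_sub_right, real_inner_smul_right, real_inner_self_eq_norm_sq,
      real_inner_comm u (matOp S u)]
  rw [matOp, Matrix.inner_toEuclideanCLM] at h2
  simp only [star_trivial] at h1
  linarith

lemma inner_matOp_comm {n : ℕ} {S : Matrix (Fin n) (Fin n) ℝ} (h : S.IsSymm) (u w : RVec n) :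
    inner ℝ (matOp S u) w = inner ℝ u (matOp S w) := by
  rw [real_inner_comm, matOp, Matrix.inner_toEuclideanCLM, Matrix.inner_toEuclideanCLM,
    Matrix.dotProduct_mulVec, ← Matrix.mulVec_transpose, h.eq, dotProduct_comm]

namespace IsSampledRun

variable {n p : ℕ} {Ω Ξ : Type*} [mΩ : MeasurableSpace Ω] [MeasurableSpace Ξ]
    {Q : StochProgram n p Ξ} {c : ProgConsts p} {μ : Measure Ω} {σ α τ : ℝ} {T : ℕ}
    {ξ : ℕ → Ω → Ξ} {x1 : RVec n} {Sig : ℕ → Fin p → Ω → Matrix (Fin n) (Fin n) ℝ}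
    {x : ℕ → Ω → RVec n} {lam : ℕ → Ω → RVec p}

lemma x_mem (H : IsSampledRun Q c μ σ α τ T ξ x1 Sig x lam) {t : ℕ} (ht : 1 ≤ t)
    (htT : t ≤ T + 1) (ω : Ω) : x t ω ∈ Q.X₀ := by
  obtain ⟨k, rfl⟩ : ∃ k, t = k + 1 := ⟨t - 1, by omega⟩
  rcases Nat.eq_zero_or_pos k with rfl | hk
  · rw [zero_add, H.run.x_init]; exact H.x1_mem
  · exact H.run.x_mem k ⟨hk, by omega⟩ ω

lemma x_memO (H : IsSampledRun Q c μ σ α τ T ξ x1 Sig x lam) {t : ℕ} (ht : 1 ≤ t)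
    (htT : t ≤ T + 1) (ω : Ω) : x t ω ∈ Q.O₀ := H.assumptions.X₀_subset (H.x_mem ht htT ω)

lemma lam_nonneg (H : IsSampledRun Q c μ σ α τ T ξ x1 Sig x lam) {t : ℕ} (ht : 1 ≤ t)
    (htT : t ≤ T + 1) (ω : Ω) (i : Fin p) : 0 ≤ lam t ω i := by
  obtain ⟨k, rfl⟩ : ∃ k, t = k + 1 := ⟨t - 1, by omega⟩
  rcases Nat.eq_zero_or_pos k with rfl | hk
  · rw [zero_add, H.run.lam_init]; simp
  · rw [H.run.lam_step k ⟨hk, by omega⟩]; exact le_max_right _ _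

lemma isModelStep (H : IsSampledRun Q c μ σ α τ T ξ x1 Sig x lam) {t : ℕ} (ht : 1 ≤ t)
    (htT : t ≤ T) (ω : Ω) :
    IsModelStep Q.X₀ c σ α τ (Q.F (x t ω) (ξ t ω)) (Q.gradF (x t ω) (ξ t ω))
      (Q.Gvec (x t ω) (ξ t ω)) (fun i => Q.gradG i (x t ω) (ξ t ω)) (fun i => Sig t i ω)
      (lam t ω) (lam (t + 1) ω) (x t ω) (x (t + 1) ω) where
  σ_pos := H.σ_pos
  α_pos := H.α_pos
  τ_pos := H.τ_pos
  D₀_pos := H.assumptions.D₀_pos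
  νg_pos := H.assumptions.νg_pos
  κf_pos := H.assumptions.κf_pos
  κg_pos := H.assumptions.κg_pos
  κS_pos := H.κS_pos
  L_pos := H.assumptions.L_pos
  conv := H.assumptions.X₀_convex
  diam_le := H.assumptions.diam_le
  y_mem := H.x_mem ht (by omega) ω
  y'_mem := H.x_mem (by omega) (by omega) ω
  norm_cc := H.assumptions.norm_G_le _ (H.x_memO ht (by omega) ω) _
  norm_v0 := H.assumptions.norm_gradF_le _ (H.x_memO ht (by omega) ω) _
  norm_v := fun i => H.assumptions.norm_gradG_le i _ (H.x_memO ht (by omega) ω) _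
  symm := fun i u w => inner_matOp_comm (H.run.Sig_symm t ⟨ht, htT⟩ i ω) u w
  quad_le := fun i u => inner_matOp_le_of_posSemidef (H.Sig_le t ⟨ht, htT⟩ i ω) u
  norm_S := fun i => H.Sig_norm t ⟨ht, htT⟩ i ω
  lam_nonneg := H.lam_nonneg ht (by omega) ω
  isMin := H.run.x_step t ⟨ht, htT⟩ ω
  step := H.run.lam_step t ⟨ht, htT⟩ ω

lemma γ₁_ge (H : IsSampledRun Q c μ σ α τ T ξ x1 Sig x lam) : c.νg ≤ c.γ₁ := by
  have h1 := H.assumptions.κg_pos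
  have h2 := H.assumptions.D₀_pos
  have h3 := H.κS_pos
  rw [ProgConsts.γ₁]
  have : 0 ≤ √(p : ℝ) * (c.κg * c.D₀ + 1 / 2 * c.κS * c.D₀ ^ 2) := by positivity
  linarith

lemma γ₂_pos (H : IsSampledRun Q c μ σ α τ T ξ x1 Sig x lam) : 0 < c.γ₂ := by
  have h1 := H.assumptions.κg_pos
  have h2 := H.assumptions.D₀_pos
  have h3 := H.κS_pos
  have h4 := H.assumptions.νg_pos
  rw [ProgConsts.γ₂]
  positivity

lemma ε₀_le (H : IsSampledRun Q c μ σ α τ T ξ x1 Sig x lam) : c.ε₀ ≤ c.γ₁ := by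
  obtain ⟨xh, hxh, hg⟩ := H.assumptions.slater
  have i : Fin p := ⟨0, H.p_pos⟩
  have h1 := hg i
  have h2 := (abs_le.1 (H.assumptions.abs_g_le i (H.assumptions.X₀_subset hxh))).1
  linarith [H.γ₁_ge]

lemma γ₁_pos (H : IsSampledRun Q c μ σ α τ T ξ x1 Sig x lam) : 0 < c.γ₁ :=
  H.assumptions.νg_pos.trans_le H.γ₁_ge

lemma abs_norm_lam_sub_le (H : IsSampledRun Q c μ σ α τ T ξ x1 Sig x lam) (ω : Ω) (t : ℕ)
    (ht : 1 ≤ t) (htT : t ≤ T) : |‖lam (t + 1) ω‖ - ‖lam t ω‖| ≤ σ * c.γ₁ :=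
  (abs_norm_sub_norm_le _ _).trans (H.isModelStep ht htT ω).norm_step_sub_le

lemma norm_lam_le (H : IsSampledRun Q c μ σ α τ T ξ x1 Sig x lam) {t : ℕ} (ht : 1 ≤ t)
    (htT : t ≤ T + 1) (ω : Ω) : ‖lam t ω‖ ≤ T * (σ * c.γ₁) := by
  have h := abs_sub_le_mul (z := fun t => ‖lam t ω‖) (H.abs_norm_lam_sub_le ω) (t := 1)
    (k := t - 1) le_rfl (by omega)
  simp only [H.run.lam_init, norm_zero, sub_zero, abs_norm] at h
  rw [show 1 + (t - 1) = t by omega] at h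
  refine h.trans (mul_le_mul_of_nonneg_right ?_ (mul_nonneg H.σ_pos.le H.γ₁_pos.le))
  exact_mod_cast (by omega : t - 1 ≤ T)

lemma lam_le (H : IsSampledRun Q c μ σ α τ T ξ x1 Sig x lam) {t : ℕ} (ht : 1 ≤ t)
    (htT : t ≤ T + 1) (ω : Ω) (i : Fin p) : lam t ω i ≤ T * (σ * c.γ₂) := by
  have h := abs_sub_le_mul (z := fun t => lam t ω i)
    (fun t h1 h2 => (H.isModelStep h1 h2 ω).abs_step_sub_le_γ₂ i) (t := 1)
    (k := t - 1) le_rfl (by omega)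
  simp only [H.run.lam_init, PiLp.zero_apply, sub_zero] at h
  rw [show 1 + (t - 1) = t by omega] at h
  refine (le_abs_self _).trans (h.trans
    (mul_le_mul_of_nonneg_right ?_ (mul_nonneg H.σ_pos.le H.γ₂_pos.le)))
  exact_mod_cast (by omega : t - 1 ≤ T)

lemma x_meas (H : IsSampledRun Q c μ σ α τ T ξ x1 Sig x lam) {t : ℕ} (ht : 1 ≤ t)
    (htT : t ≤ T + 1) : Measurable[history ξ (t - 1)] (x t) := by
  obtain ⟨k, rfl⟩ : ∃ k, t = k + 1 := ⟨t - 1, by omega⟩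
  rcases Nat.eq_zero_or_pos k with rfl | hk
  · have : x (0 + 1) = fun _ => x1 := funext H.run.x_init
    rw [this]; exact measurable_const
  · exact H.run.x_meas k ⟨hk, by omega⟩

lemma lam_meas (H : IsSampledRun Q c μ σ α τ T ξ x1 Sig x lam) {t : ℕ} (ht : 1 ≤ t)
    (htT : t ≤ T + 1) : Measurable[history ξ (t - 1)] (lam t) := by
  induction t, ht using Nat.le_induction with
  | base =>
    have : lam 1 = fun _ => 0 := funext H.run.lam_init
    rw [this]; exact measurable_const
  | succ t ht ih =>
    have htT' : t ≤ T := by omega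
    have hmono : history ξ (t - 1) ≤ history ξ t := history_mono (by omega)
    have hl := (ih (by omega)).mono hmono le_rfl
    have hx := (H.x_meas ht (by omega)).mono hmono le_rfl
    have hx' := H.x_meas (t := t + 1) (by omega) htT
    have hξ := measurable_history (ξ := ξ) ht
    rw [Nat.add_sub_cancel] at hx' ⊢
    have hxO := fun ω => H.x_memO ht (by omega : t ≤ T + 1) ω
    refine measurable_of_apply fun i => ?_
    have hq : Measurable[history ξ t] fun ω =>
        qCon Q (fun i => Sig t i ω) (x t ω) (ξ t ω) i (x (t + 1) ω) :=
      measurable_quadModel (H.assumptions.measurable_G i hx hxO hξ)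
        (H.assumptions.measurable_gradG i hx hxO hξ) hx hx'
        (fun a b => H.run.Sig_meas t ⟨ht, htT'⟩ i a b)
    have he : (fun ω => lam (t + 1) ω i) = fun ω =>
        max (lam t ω i + σ * qCon Q (fun i => Sig t i ω) (x t ω) (ξ t ω) i (x (t + 1) ω)) 0 :=
      funext fun ω => H.run.lam_step t ⟨ht, htT'⟩ ω i
    rw [he]
    exact ((measurable_apply hl i).add (hq.const_mul σ)).max measurable_const

lemma x_meas' (H : IsSampledRun Q c μ σ α τ T ξ x1 Sig x lam) {t : ℕ} (ht : 1 ≤ t)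
    (htT : t ≤ T + 1) : Measurable (x t) := (H.x_meas ht htT).mono (history_le H.ξ_meas _) le_rfl

lemma lam_meas' (H : IsSampledRun Q c μ σ α τ T ξ x1 Sig x lam) {t : ℕ} (ht : 1 ≤ t)
    (htT : t ≤ T + 1) : Measurable (lam t) :=
  (H.lam_meas ht htT).mono (history_le H.ξ_meas _) le_rfl

lemma integrable_norm_lam_sq (H : IsSampledRun Q c μ σ α τ T ξ x1 Sig x lam) {t : ℕ} (ht : 1 ≤ t)
    (htT : t ≤ T + 1) : Integrable (fun ω => ‖lam t ω‖ ^ 2) μ := by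
  have := H.isProb
  refine integrable_of_abs_le (C := (T * (σ * c.γ₁)) ^ 2)
    ((H.lam_meas' ht htT).norm.pow_const 2) fun ω => ?_
  rw [abs_of_nonneg (sq_nonneg _)]
  exact pow_le_pow_left₀ (norm_nonneg _) (H.norm_lam_le ht htT ω) 2

lemma integrable_norm_lam (H : IsSampledRun Q c μ σ α τ T ξ x1 Sig x lam) {t : ℕ} (ht : 1 ≤ t)
    (htT : t ≤ T + 1) : Integrable (fun ω => ‖lam t ω‖) μ := by
  have := H.isProb
  refine integrable_of_abs_le (C := T * (σ * c.γ₁)) (H.lam_meas' ht htT).norm fun ω => ?_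
  rw [abs_norm]
  exact H.norm_lam_le ht htT ω

/-- The curvature `-L_i` of the model is at least as negative as the one in the weak-convexity
gradient inequality. -/
lemma model_le_G (H : IsSampledRun Q c μ σ α τ T ξ x1 Sig x lam) {t : ℕ} (ht : 1 ≤ t)
    (htT : t ≤ T) (ω : Ω) {z : RVec n} (hz : z ∈ Q.X₀) (i : Fin p) :
    quadModel (Q.G i (x t ω) (ξ t ω)) (Q.gradG i (x t ω) (ξ t ω)) (Sig t i ω) (x t ω) z
      ≤ Q.G i z (ξ t ω) := by
  have hxO := H.x_memO ht (by omega : t ≤ T + 1) ω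
  have h1 := (H.assumptions.G_weak i (ξ t ω)).gradient_le hxO (H.assumptions.X₀_subset hz)
    (H.assumptions.G_diff i _ hxO _)
  have h2 := (H.isModelStep ht htT ω).quad_le i (z - x t ω)
  simp only [quadModel, StochProgram.gradG] at *
  linarith

/-- The drift of the multipliers in one step, weighted by a function of the past. -/
lemma integral_drift (H : IsSampledRun Q c μ σ α τ T ξ x1 Sig x lam) {xh : RVec n}
    (hxh : xh ∈ Q.X₀) (hg : ∀ i, Q.g i xh ≤ -c.ε₀) {t : ℕ} (ht : 1 ≤ t) (htT : t ≤ T)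
    {W : Ω → ℝ} (hW : Measurable[history ξ (t - 1)] W) (hW0 : ∀ ω, 0 ≤ W ω) {C : ℝ}
    (hWC : ∀ ω, W ω ≤ C) :
    ∫ ω, W ω * (‖lam (t + 1) ω‖ ^ 2 - ‖lam t ω‖ ^ 2) ∂μ
      ≤ ∫ ω, W ω * (2 * σ * (c.κf * c.D₀ + c.ε₀ / 2 * (σ * c.γ₁) + σ / 2 * c.νg ^ 2
        - c.ε₀ / 2 * ‖lam t ω‖
        + (τ + α) / 2 * (‖xh - x t ω‖ ^ 2 - ‖xh - x (t + 1) ω‖ ^ 2))) ∂μ := by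
  have := H.isProb
  have hQ := H.assumptions
  have hle := history_le H.ξ_meas (t - 1)
  have hW' : Measurable W := hW.mono hle le_rfl
  have hC0 : 0 ≤ C := by
    obtain ⟨ω⟩ : Nonempty Ω := μ.nonempty_of_neZero
    exact (hW0 ω).trans (hWC ω)
  have hσ := H.σ_pos
  have hxO := hQ.X₀_subset hxh
  have hl := H.lam_meas' ht (by omega : t ≤ T + 1)
  have hlC := H.norm_lam_le ht (by omega : t ≤ T + 1)
  set V : Ω → RVec p := fun ω => W ω • lam t ω with hV
  have hVm : Measurable[history ξ (t - 1)] V := hW.smul (H.lam_meas ht (by omega))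
  have hVC : ∀ ω, ‖V ω‖ ≤ C * (T * (σ * c.γ₁)) := fun ω => by
    rw [hV, norm_smul, Real.norm_eq_abs, abs_of_nonneg (hW0 ω)]
    exact mul_le_mul (hWC ω) (hlC ω) (norm_nonneg _) hC0
  -- The weight and the multiplier are known before `ξ t` is drawn and the Slater point is
  -- deterministic, so `G` may be replaced by its mean there.
  have hind := hQ.integral_inner_Gvec (μ := μ) hle hVm hVC (y := fun _ => xh) measurable_const
    (fun _ => hxO) (H.ξ_meas t) (indep_history H.ξ_meas H.ξ_indep ht) (H.ξ_law t ⟨ht, htT⟩)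
  -- bounded pieces
  set B : Ω → ℝ := fun ω => W ω * (2 * σ * (c.κf * c.D₀ + c.ε₀ / 2 * (σ * c.γ₁)
    + σ / 2 * c.νg ^ 2 + c.ε₀ / 2 * ‖lam t ω‖
    + (τ + α) / 2 * (‖xh - x t ω‖ ^ 2 - ‖xh - x (t + 1) ω‖ ^ 2))) with hB
  have hdist : ∀ k, 1 ≤ k → k ≤ T + 1 → Integrable (fun ω => W ω * ‖xh - x k ω‖ ^ 2) μ := by
    intro k h1 h2
    refine integrable_of_abs_le (C := C * c.D₀ ^ 2)
      (hW'.mul (((H.x_meas' h1 h2).const_sub xh).norm.pow_const 2)) fun ω => ?_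
    rw [abs_mul, abs_of_nonneg (hW0 ω), abs_of_nonneg (sq_nonneg _)]
    exact mul_le_mul (hWC ω) (pow_le_pow_left₀ (norm_nonneg _)
      (hQ.diam_le _ hxh _ (H.x_mem h1 h2 ω)) 2) (sq_nonneg _) hC0
  have hWi : Integrable W μ := integrable_of_abs_le (C := C) hW' fun ω => by
    rw [abs_of_nonneg (hW0 ω)]; exact hWC ω
  have hWl : ∀ k, 1 ≤ k → k ≤ T + 1 → Integrable (fun ω => W ω * ‖lam k ω‖) μ := by
    intro k h1 h2
    refine integrable_of_abs_le (C := C * (T * (σ * c.γ₁)))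
      (hW'.mul (H.lam_meas' h1 h2).norm) fun ω => ?_
    rw [abs_mul, abs_of_nonneg (hW0 ω), abs_norm]
    exact mul_le_mul (hWC ω) (H.norm_lam_le h1 h2 ω) (norm_nonneg _) hC0
  have hWl2 : ∀ k, 1 ≤ k → k ≤ T + 1 → Integrable (fun ω => W ω * ‖lam k ω‖ ^ 2) μ := by
    intro k h1 h2
    refine integrable_of_abs_le (C := C * (T * (σ * c.γ₁)) ^ 2)
      (hW'.mul ((H.lam_meas' h1 h2).norm.pow_const 2)) fun ω => ?_
    rw [abs_mul, abs_of_nonneg (hW0 ω), abs_of_nonneg (sq_nonneg _)]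
    exact mul_le_mul (hWC ω) (pow_le_pow_left₀ (norm_nonneg _) (H.norm_lam_le h1 h2 ω) 2)
      (sq_nonneg _) hC0
  have hBi : Integrable B μ := by
    have e : B = fun ω => (2 * σ * (c.κf * c.D₀ + c.ε₀ / 2 * (σ * c.γ₁) + σ / 2 * c.νg ^ 2)) * W ω
        + (2 * σ * (c.ε₀ / 2)) * (W ω * ‖lam t ω‖)
        + ((2 * σ * ((τ + α) / 2)) * (W ω * ‖xh - x t ω‖ ^ 2)
          - (2 * σ * ((τ + α) / 2)) * (W ω * ‖xh - x (t + 1) ω‖ ^ 2)) := by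
      ext ω; simp only [hB]; ring
    rw [e]
    exact ((hWi.const_mul _).add ((hWl t ht (by omega)).const_mul _)).add
      (((hdist t ht (by omega)).const_mul _).sub ((hdist (t + 1) (by omega) (by omega)).const_mul _))
  have hIi : Integrable (fun ω => inner ℝ (V ω) (Q.Gvec xh (ξ t ω))) μ :=
    integrable_of_abs_le (measurable_inner (hVm.mono hle le_rfl)
      (hQ.measurable_Gvec (y := fun _ => xh) measurable_const (fun _ => hxO) (H.ξ_meas t)))
      fun ω => StochProgram.Assumptions.abs_inner_le (hVC ω) (hQ.norm_G_le _ hxO _)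
  have hgi : Integrable (fun ω => inner ℝ (V ω) (Q.gvec xh)) μ :=
    integrable_of_abs_le (measurable_inner (hVm.mono hle le_rfl) measurable_const)
      fun ω => StochProgram.Assumptions.abs_inner_le (hVC ω) (hQ.norm_gvec_le hxO)
  have hpt : ∀ ω, W ω * (‖lam (t + 1) ω‖ ^ 2 - ‖lam t ω‖ ^ 2)
      ≤ B ω + 2 * σ * inner ℝ (V ω) (Q.Gvec xh (ξ t ω)) := by
    intro ω
    have h1 := (H.isModelStep ht htT ω).drift H.κS_le hxh (C := Q.Gvec xh (ξ t ω))
      (hQ.norm_G_le _ hxO _) (fun i => H.model_le_G ht htT ω hxh i)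
    have h2 := mul_le_mul_of_nonneg_left h1 (mul_nonneg (hW0 ω) (by positivity : 0 ≤ 2 * σ))
    have e : W ω * (2 * σ) * (1 / (2 * σ) * (‖lam (t + 1) ω‖ ^ 2 - ‖lam t ω‖ ^ 2))
        = W ω * (‖lam (t + 1) ω‖ ^ 2 - ‖lam t ω‖ ^ 2) := by field_simp
    rw [e] at h2
    refine h2.trans (le_of_eq ?_)
    simp only [hB, hV, real_inner_smul_left]
    ring
  have hlhs : Integrable (fun ω => W ω * (‖lam (t + 1) ω‖ ^ 2 - ‖lam t ω‖ ^ 2)) μ := by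
    simp only [mul_sub]
    exact (hWl2 (t + 1) (by omega) (by omega)).sub (hWl2 t ht (by omega))
  refine (integral_mono hlhs (hBi.add (hIi.const_mul (2 * σ))) hpt).trans ?_
  simp only [Pi.add_apply]
  rw [integral_add hBi (hIi.const_mul _), integral_const_mul, hind, ← integral_const_mul,
    ← integral_add hBi (hgi.const_mul _)]
  refine integral_mono (hBi.add (hgi.const_mul _)) ?_ fun ω => ?_
  · have e : (fun ω => W ω * (2 * σ * (c.κf * c.D₀ + c.ε₀ / 2 * (σ * c.γ₁) + σ / 2 * c.νg ^ 2
        - c.ε₀ / 2 * ‖lam t ω‖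
        + (τ + α) / 2 * (‖xh - x t ω‖ ^ 2 - ‖xh - x (t + 1) ω‖ ^ 2))))
        = fun ω => B ω - (2 * σ * c.ε₀) * (W ω * ‖lam t ω‖) := by
      ext ω; simp only [hB]; ring
    rw [e]
    exact hBi.sub ((hWl t ht (by omega)).const_mul _)
  -- Nonnegativity of `λ` and the domination of the Euclidean norm by the sum norm give a gain of
  -- `ε₀‖λ‖`. Against the cost `(ε₀/2)‖λ‖` contained in `B`, half of it remains.
  · have h1 : inner ℝ (lam t ω) (Q.gvec xh) ≤ -(c.ε₀ * ‖lam t ω‖) := by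
      have h2 : inner ℝ (lam t ω) (Q.gvec xh) ≤ ∑ i, |lam t ω i| * (-c.ε₀) := by
        rw [PiLp.inner_apply]
        refine Finset.sum_le_sum fun i _ => ?_
        have h3 := H.lam_nonneg ht (by omega : t ≤ T + 1) ω i
        rw [abs_of_nonneg h3]
        simpa [mul_comm, StochProgram.gvec] using mul_le_mul_of_nonneg_left (hg i) h3
      rw [← Finset.sum_mul] at h2
      nlinarith [norm_le_sum_abs (lam t ω), hQ.ε₀_pos]
    have h4 := mul_le_mul_of_nonneg_left h1 (mul_nonneg (hW0 ω) (by positivity : 0 ≤ 2 * σ))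
    simp only [hB, hV, real_inner_smul_left]
    linarith

end IsSampledRun

/-! ### Drift over windows and moments of the multipliers -/

lemma upperGamma_nonneg {a b : ℝ} (hb : 0 ≤ b) : 0 ≤ upperGamma a b :=
  setIntegral_nonneg measurableSet_Ioi fun _ ht =>
    mul_nonneg (Real.rpow_nonneg (hb.trans ht.le) _) (Real.exp_pos _).le

namespace IsSampledRun

variable {n p : ℕ} {Ω Ξ : Type*} [mΩ : MeasurableSpace Ω] [MeasurableSpace Ξ]
    {Q : StochProgram n p Ξ} {c : ProgConsts p} {μ : Measure Ω} {σ α τ : ℝ} {T : ℕ}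
    {ξ : ℕ → Ω → Ξ} {x1 : RVec n} {Sig : ℕ → Fin p → Ω → Matrix (Fin n) (Fin n) ℝ}
    {x : ℕ → Ω → RVec n} {lam : ℕ → Ω → RVec p}

/-- The drift of the multipliers over a window. -/
lemma integral_drift_window (H : IsSampledRun Q c μ σ α τ T ξ x1 Sig x lam) {xh : RVec n}
    (hxh : xh ∈ Q.X₀) (hg : ∀ i, Q.g i xh ≤ -c.ε₀) {t s : ℕ} (ht : 1 ≤ t)
    {W : Ω → ℝ} (hW : Measurable[history ξ (t - 1)] W) (hW0 : ∀ ω, 0 ≤ W ω) {C : ℝ}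
    (hWC : ∀ ω, W ω ≤ C) {k : ℕ} (hk : k ≤ s) (htk : t + k ≤ T + 1) :
    ∫ ω, W ω * (‖lam (t + k) ω‖ ^ 2 - ‖lam t ω‖ ^ 2) ∂μ
      ≤ ∫ ω, W ω * (2 * σ * (k * (c.κf * c.D₀ + c.ε₀ / 2 * (σ * c.γ₁) + σ / 2 * c.νg ^ 2
        - c.ε₀ / 2 * (‖lam t ω‖ - s * (σ * c.γ₁)))
        + (τ + α) / 2 * (‖xh - x t ω‖ ^ 2 - ‖xh - x (t + k) ω‖ ^ 2))) ∂μ := by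
  have := H.isProb
  have hQ := H.assumptions
  have hσ := H.σ_pos
  have hC0 : 0 ≤ C := by
    obtain ⟨ω⟩ : Nonempty Ω := μ.nonempty_of_neZero
    exact (hW0 ω).trans (hWC ω)
  have hW' : Measurable W := hW.mono (history_le H.ξ_meas _) le_rfl
  have hdist : ∀ k, 1 ≤ k → k ≤ T + 1 → Integrable (fun ω => W ω * ‖xh - x k ω‖ ^ 2) μ := by
    intro k h1 h2
    refine integrable_of_abs_le (C := C * c.D₀ ^ 2)
      (hW'.mul (((H.x_meas' h1 h2).const_sub xh).norm.pow_const 2)) fun ω => ?_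
    rw [abs_mul, abs_of_nonneg (hW0 ω), abs_of_nonneg (sq_nonneg _)]
    exact mul_le_mul (hWC ω) (pow_le_pow_left₀ (norm_nonneg _)
      (hQ.diam_le _ hxh _ (H.x_mem h1 h2 ω)) 2) (sq_nonneg _) hC0
  have hWi : Integrable W μ := integrable_of_abs_le (C := C) hW' fun ω => by
    rw [abs_of_nonneg (hW0 ω)]; exact hWC ω
  have hWl : ∀ k, 1 ≤ k → k ≤ T + 1 → Integrable (fun ω => W ω * ‖lam k ω‖) μ := by
    intro k h1 h2
    refine integrable_of_abs_le (C := C * (T * (σ * c.γ₁)))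
      (hW'.mul (H.lam_meas' h1 h2).norm) fun ω => ?_
    rw [abs_mul, abs_of_nonneg (hW0 ω), abs_norm]
    exact mul_le_mul (hWC ω) (H.norm_lam_le h1 h2 ω) (norm_nonneg _) hC0
  have hWl2 : ∀ k, 1 ≤ k → k ≤ T + 1 → Integrable (fun ω => W ω * ‖lam k ω‖ ^ 2) μ := by
    intro k h1 h2
    refine integrable_of_abs_le (C := C * (T * (σ * c.γ₁)) ^ 2)
      (hW'.mul ((H.lam_meas' h1 h2).norm.pow_const 2)) fun ω => ?_
    rw [abs_mul, abs_of_nonneg (hW0 ω), abs_of_nonneg (sq_nonneg _)]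
    exact mul_le_mul (hWC ω) (pow_le_pow_left₀ (norm_nonneg _) (H.norm_lam_le h1 h2 ω) 2)
      (sq_nonneg _) hC0
  -- integrability of affine combinations
  have hcomb : ∀ (a b d : ℝ) (j l m : ℕ), 1 ≤ j → j ≤ T + 1 → 1 ≤ l → l ≤ T + 1 → 1 ≤ m →
      m ≤ T + 1 → Integrable (fun ω => W ω * (a - b * ‖lam j ω‖
        + d * (‖xh - x l ω‖ ^ 2 - ‖xh - x m ω‖ ^ 2))) μ := by
    intro a b d j l m h1 h2 h3 h4 h5 h6
    have e : (fun ω => W ω * (a - b * ‖lam j ω‖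
        + d * (‖xh - x l ω‖ ^ 2 - ‖xh - x m ω‖ ^ 2))) = fun ω => a * W ω - b * (W ω * ‖lam j ω‖)
        + (d * (W ω * ‖xh - x l ω‖ ^ 2) - d * (W ω * ‖xh - x m ω‖ ^ 2)) := by
      ext ω; ring
    rw [e]
    exact ((hWi.const_mul _).sub ((hWl j h1 h2).const_mul _)).add
      (((hdist l h3 h4).const_mul _).sub ((hdist m h5 h6).const_mul _))
  set A := c.κf * c.D₀ + c.ε₀ / 2 * (σ * c.γ₁) + σ / 2 * c.νg ^ 2 with hA
  have hrhs : ∀ k, t + k ≤ T + 1 → Integrable (fun ω => W ω * (2 * σ * (k * (A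
        - c.ε₀ / 2 * (‖lam t ω‖ - s * (σ * c.γ₁)))
        + (τ + α) / 2 * (‖xh - x t ω‖ ^ 2 - ‖xh - x (t + k) ω‖ ^ 2)))) μ := by
    intro k hk
    refine (hcomb (2 * σ * (k * (A + c.ε₀ / 2 * (s * (σ * c.γ₁))))) (2 * σ * (k * (c.ε₀ / 2)))
      (2 * σ * ((τ + α) / 2)) t t (t + k) ht (by omega) ht (by omega) (by omega) hk).congr
      (Filter.Eventually.of_forall fun ω => ?_)
    simp only
    ring
  induction k with
  | zero => simp
  | succ k ih =>
    have hmono : history ξ (t - 1) ≤ history ξ (t + k - 1) := history_mono (by omega)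
    have h1 := ih (by omega) (by omega)
    have h2 := H.integral_drift hxh hg (t := t + k) (by omega) (by omega) (hW.mono hmono le_rfl)
      hW0 hWC
    have hi1 : ∀ j, t + j ≤ T + 1 →
        Integrable (fun ω => W ω * (‖lam (t + j) ω‖ ^ 2 - ‖lam t ω‖ ^ 2)) μ := by
      intro j hj
      simp only [mul_sub]
      exact (hWl2 _ (by omega) hj).sub (hWl2 t ht (by omega))
    have hi2 : Integrable (fun ω => W ω * (‖lam (t + k + 1) ω‖ ^ 2 - ‖lam (t + k) ω‖ ^ 2)) μ := by
      simp only [mul_sub]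
      exact (hWl2 _ (by omega) (by omega)).sub (hWl2 _ (by omega) (by omega))
    have e1 : ∀ ω, W ω * (‖lam (t + (k + 1)) ω‖ ^ 2 - ‖lam t ω‖ ^ 2)
        = W ω * (‖lam (t + k) ω‖ ^ 2 - ‖lam t ω‖ ^ 2)
          + W ω * (‖lam (t + k + 1) ω‖ ^ 2 - ‖lam (t + k) ω‖ ^ 2) := by
      intro ω; rw [← add_assoc]; ring
    simp only [e1]
    rw [integral_add (hi1 k (by omega)) hi2]
    refine (add_le_add h1 h2).trans ?_
    have hi3 : Integrable (fun ω => W ω * (2 * σ * (A - c.ε₀ / 2 * ‖lam (t + k) ω‖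
        + (τ + α) / 2 * (‖xh - x (t + k) ω‖ ^ 2 - ‖xh - x (t + k + 1) ω‖ ^ 2)))) μ := by
      refine (hcomb (2 * σ * A) (2 * σ * (c.ε₀ / 2)) (2 * σ * ((τ + α) / 2)) (t + k) (t + k)
        (t + k + 1) (by omega) (by omega) (by omega) (by omega) (by omega) (by omega)).congr
        (Filter.Eventually.of_forall fun ω => ?_)
      simp only
      ring
    rw [← integral_add (hrhs k (by omega)) hi3]
    refine integral_mono ((hrhs k (by omega)).add hi3) (hrhs (k + 1) htk) fun ω => ?_
    -- Later steps of the window have their own multiplier norms; lowering the initial norm by the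
    -- largest possible change gives one lower bound for all of them, so the weight may stay fixed.
    have h3 : ‖lam t ω‖ - s * (σ * c.γ₁) ≤ ‖lam (t + k) ω‖ := by
      have h4 := (abs_le.1 (abs_sub_le_mul (z := fun t => ‖lam t ω‖) (H.abs_norm_lam_sub_le ω)
        ht (k := k) (by omega))).1
      have h5 : (k : ℝ) * (σ * c.γ₁) ≤ s * (σ * c.γ₁) :=
        mul_le_mul_of_nonneg_right (by exact_mod_cast (by omega : k ≤ s))
          (mul_nonneg hσ.le H.γ₁_pos.le)
      linarith
    have h6 := mul_le_mul_of_nonneg_left h3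
      (mul_nonneg (hW0 ω) (mul_nonneg hσ.le hQ.ε₀_pos.le))
    rw [add_assoc t k 1]
    push_cast
    linarith

/-- The level above which the multipliers drift downwards. -/
lemma integral_exp_norm_lam_le (H : IsSampledRun Q c μ σ α τ T ξ x1 Sig x lam) {s : ℕ}
    (hs : 1 ≤ s) (hsσ : s * σ ≤ 3) (hsτ : τ + α ≤ s) {t : ℕ} (ht : 1 ≤ t) (htT : t ≤ T + 1) :
    ∫ ω, Real.exp (σ * c.ε₀ * s / (4 * (s * (σ * c.γ₁)) ^ 2) * ‖lam t ω‖) ∂μ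
      ≤ Real.exp (σ * c.ε₀ * s / (4 * (s * (σ * c.γ₁)) ^ 2)
        * ((c.κ₀ + c.κ₁ + 2 * c.νg ^ 2 / c.ε₀ + 8 * c.γ₁) + s * (σ * c.γ₁)))
        * (48 * (s * (σ * c.γ₁)) ^ 2 / (σ * c.ε₀ * s) ^ 2) := by
  have := H.isProb
  have hQ := H.assumptions
  have hσ := H.σ_pos
  have hγ := H.γ₁_pos
  have hε := hQ.ε₀_pos
  have hκf := hQ.κf_pos
  have hD := hQ.D₀_pos
  have hν := hQ.νg_pos
  have hs0 : (0 : ℝ) < s := by exact_mod_cast hs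
  obtain ⟨xh, hxh, hg⟩ := hQ.slater
  set θ := c.κ₀ + c.κ₁ + 2 * c.νg ^ 2 / c.ε₀ + 8 * c.γ₁ with hθ
  have hθ0 : 0 < θ := by
    rw [hθ, ProgConsts.κ₀, ProgConsts.κ₁]; positivity
  -- Here `b = σ ε₀ s` is the drift rate over a window and `D = s σ γ₁` the largest change; `b ≤ D`
  -- amounts to `ε₀ ≤ γ₁`.
  refine integral_exp_le_of_drift (Z := fun t ω => ‖lam t ω‖) (N := T) (s := s) (θ := θ)
    (δ := σ * c.γ₁) (fun t h1 h2 => (H.lam_meas' h1 h2).norm) (fun t h1 h2 ω => norm_nonneg _)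
    (fun ω => by rw [H.run.lam_init, norm_zero]) H.abs_norm_lam_sub_le hs (by positivity) le_rfl
    (by positivity) ?_ hθ0 ?_ t ht htT
  · nlinarith [mul_le_mul_of_nonneg_left H.ε₀_le (mul_pos hs0 hσ).le]
  intro t ht hts w hw hw0 ⟨C, hwC⟩
  have hWm : Measurable[history ξ (t - 1)] fun ω => w ‖lam t ω‖ :=
    hw.comp (measurable_norm.comp (H.lam_meas ht (by omega)))
  have h1 := H.integral_drift_window hxh hg (s := s) ht hWm (fun ω => hw0 _) (fun ω => hwC _)
    le_rfl hts
  have hW' : Measurable fun ω => w ‖lam t ω‖ := hWm.mono (history_le H.ξ_meas _) le_rfl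
  have hli := H.integrable_norm_lam ht (by omega : t ≤ T + 1)
  have hWC : ∀ᵐ ω ∂μ, ‖w ‖lam t ω‖‖ ≤ C := Filter.Eventually.of_forall fun ω => by
    rw [Real.norm_eq_abs, abs_of_nonneg (hw0 _)]; exact hwC _
  have hdist : ∀ k, 1 ≤ k → k ≤ T + 1 → Integrable (fun ω => ‖xh - x k ω‖ ^ 2) μ := by
    intro k h1 h2
    refine integrable_of_abs_le (C := c.D₀ ^ 2)
      (((H.x_meas' h1 h2).const_sub xh).norm.pow_const 2) fun ω => ?_
    rw [abs_of_nonneg (sq_nonneg _)]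
    exact pow_le_pow_left₀ (norm_nonneg _) (hQ.diam_le _ hxh _ (H.x_mem h1 h2 ω)) 2
  refine h1.trans (integral_mono ?_ ?_ fun ω => ?_)
  · refine Integrable.bdd_mul (Integrable.const_mul (Integrable.add (Integrable.const_mul
      (Integrable.sub (integrable_const _) (Integrable.const_mul
        (hli.sub (integrable_const _)) _)) _) (((hdist t ht (by omega)).sub
          (hdist (t + s) (by omega) hts)).const_mul _)) _) hW'.aestronglyMeasurable hWC
  · exact Integrable.bdd_mul (((integrable_const _).sub hli).const_mul _)
      hW'.aestronglyMeasurable hWC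
  · refine mul_le_mul_of_nonneg_left ?_ (hw0 _)
    have hd1 : ‖xh - x t ω‖ ^ 2 - ‖xh - x (t + s) ω‖ ^ 2 ≤ c.D₀ ^ 2 := by
      have := pow_le_pow_left₀ (norm_nonneg _) (hQ.diam_le _ hxh _ (H.x_mem ht (by omega) ω)) 2
      nlinarith [sq_nonneg ‖xh - x (t + s) ω‖]
    -- The distances have telescoped over the window, and `τ + α ≤ s` bounds their total
    -- contribution by a multiple of `s`.
    have hd2 : (τ + α) / 2 * (‖xh - x t ω‖ ^ 2 - ‖xh - x (t + s) ω‖ ^ 2) ≤ s / 2 * c.D₀ ^ 2 := by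
      have hτα : 0 < τ + α := add_pos H.τ_pos H.α_pos
      calc _ ≤ (τ + α) / 2 * c.D₀ ^ 2 := mul_le_mul_of_nonneg_left hd1 (by positivity)
        _ ≤ _ := by gcongr
    have hθ1 : c.ε₀ * θ = 4 * c.κf * c.D₀ + 2 * c.D₀ ^ 2 + 2 * c.νg ^ 2 + 8 * c.ε₀ * c.γ₁ := by
      rw [hθ, ProgConsts.κ₀, ProgConsts.κ₁]; field_simp
    have hk1 : σ * c.νg ^ 2 ≤ c.νg ^ 2 := by
      nlinarith [mul_le_mul_of_nonneg_right H.σ_le_one (sq_nonneg c.νg)]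
    have hεγ : 0 < c.ε₀ * c.γ₁ := mul_pos hε hγ
    have hk2 : c.ε₀ * (σ * c.γ₁) ≤ c.ε₀ * c.γ₁ := by
      nlinarith [mul_le_mul_of_nonneg_right H.σ_le_one hεγ.le]
    have hk3 : c.ε₀ * (s * (σ * c.γ₁)) ≤ 3 * (c.ε₀ * c.γ₁) := by
      nlinarith [mul_le_mul_of_nonneg_right hsσ hεγ.le]
    -- The level `θ` is such that all constants together use at most the share `ε₀ θ / 2`; in
    -- particular `8 γ₁` covers the multiplier terms `ε₀ σ γ₁` and `ε₀ s σ γ₁ ≤ 3 ε₀ γ₁`.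
    have key : 2 * (c.κf * c.D₀ + c.ε₀ / 2 * (σ * c.γ₁) + σ / 2 * c.νg ^ 2
        + c.ε₀ / 2 * (s * (σ * c.γ₁))) + c.D₀ ^ 2 ≤ c.ε₀ * θ / 2 := by
      rw [hθ1]; linarith
    have h2 := mul_le_mul_of_nonneg_left key (mul_pos hσ hs0).le
    have h3 := mul_le_mul_of_nonneg_left hd2 (by positivity : 0 ≤ 2 * σ)
    linarith

set_option maxHeartbeats 800000 in
/-- The first two moments of the multipliers. -/
theorem moments_norm_lam_le (H : IsSampledRun Q c μ σ α τ T ξ x1 Sig x lam) {t : ℕ}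
    (ht : 1 ≤ t) (htT : t ≤ T + 1) :
    ∫ ω, ‖lam t ω‖ ∂μ ≤ c.γ₃ ∧ ∫ ω, ‖lam t ω‖ ^ 2 ∂μ ≤ c.γ₄ σ ∧ 0 ≤ c.γ₃ := by
  have := H.isProb
  have hQ := H.assumptions
  have hσ := H.σ_pos
  have hγ := H.γ₁_pos
  have hε := hQ.ε₀_pos
  have hκf := hQ.κf_pos
  have hD := hQ.D₀_pos
  have hν := hQ.νg_pos
  have hεγ := H.ε₀_le
  obtain ⟨s, hs, hsσ, hsτ⟩ := H.window
  have hs0 : (0 : ℝ) < s := by exact_mod_cast hs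
  have hE := H.integral_exp_norm_lam_le hs hsσ hsτ ht htT
  set θ := c.κ₀ + c.κ₁ + 2 * c.νg ^ 2 / c.ε₀ + 8 * c.γ₁ with hθ
  have hθ0 : 0 < θ := by
    rw [hθ, ProgConsts.κ₀, ProgConsts.κ₁]; positivity
  set r := σ * c.ε₀ * s / (4 * (s * (σ * c.γ₁)) ^ 2) with hr
  have hr0 : 0 < r := by positivity
  set q := c.γ₁ ^ 2 / c.ε₀ with hq
  have hqγ : c.γ₁ ≤ q := by rw [hq, le_div_iff₀ hε]; nlinarith
  have hq0 : 0 < q := by positivity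
  -- The window length cancels except for the product `s σ ≤ 3`, hence the bound `12 q`.
  have hr1 : 1 / r = 4 * (s * σ) * q := by rw [hr, hq]; field_simp
  have hr12 : 1 / r ≤ 12 * q := by rw [hr1]; nlinarith
  have hfac : 48 * (s * (σ * c.γ₁)) ^ 2 / (σ * c.ε₀ * s) ^ 2 = 48 * (c.γ₁ ^ 2 / c.ε₀ ^ 2) := by
    field_simp
  rw [hfac] at hE
  have hγε : 1 ≤ c.γ₁ ^ 2 / c.ε₀ ^ 2 := by
    rw [one_le_div (by positivity)]; exact pow_le_pow_left₀ hε.le hεγ 2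
  set ℓ := Real.log (128 * c.γ₁ ^ 2 / c.ε₀ ^ 2) with hℓ
  -- Since `γ₁ ≥ ε₀`, the factor `128` makes `ℓ ≥ 7 log 2 > 4`. Then `4 q ℓ ≥ 16 γ₁` absorbs the `10
  -- γ₁` by which `θ + 3 γ₁` exceeds the other terms of `γ₃`.
  have hℓ4 : 4 ≤ ℓ := by
    have h1 : Real.log 128 ≤ ℓ := by
      refine Real.log_le_log (by norm_num) ?_
      rw [mul_div_assoc]; linarith
    have h2 : Real.log 128 = 7 * Real.log 2 := by
      rw [show (128 : ℝ) = 2 ^ 7 by norm_num, Real.log_pow]; norm_num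
    linarith [Real.log_two_gt_d9]
  have h48 : Real.log (48 * (c.γ₁ ^ 2 / c.ε₀ ^ 2)) ≤ ℓ := by
    refine Real.log_le_log (by positivity) ?_
    rw [mul_div_assoc]; linarith
  set C := Real.exp (r * (θ + s * (σ * c.γ₁))) * (48 * (c.γ₁ ^ 2 / c.ε₀ ^ 2)) with hC
  have hC1 : 1 ≤ C := by
    have : 1 ≤ Real.exp (r * (θ + s * (σ * c.γ₁))) := Real.one_le_exp (by positivity)
    nlinarith
  have hlogC : Real.log C / r ≤ θ + 3 * c.γ₁ + 12 * q * ℓ := by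
    rw [hC, Real.log_mul (Real.exp_pos _).ne' (by positivity), Real.log_exp, add_div,
      mul_div_cancel_left₀ _ hr0.ne', div_eq_mul_one_div (Real.log _)]
    have h1 : Real.log (48 * (c.γ₁ ^ 2 / c.ε₀ ^ 2)) * (1 / r) ≤ ℓ * (12 * q) :=
      mul_le_mul h48 hr12 (by positivity) (by linarith)
    have h2 : s * (σ * c.γ₁) ≤ 3 * c.γ₁ := by nlinarith
    linarith
  have hγ₃ : c.γ₃ = c.κ₀ + c.κ₁ + 2 * c.νg ^ 2 / c.ε₀ + c.γ₁ + c.ε₀ / 4 + 16 * q * ℓ := by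
    rw [ProgConsts.γ₃, ProgConsts.κ₃, ProgConsts.κ₄, ← hℓ, hq]; ring
  have hγ₃' : θ + 3 * c.γ₁ + 12 * q * ℓ ≤ c.γ₃ := by
    rw [hγ₃, hθ]; nlinarith
  have hγ₃q : 4 * q ≤ c.γ₃ := by
    have : 12 * q * ℓ ≤ c.γ₃ := by linarith
    nlinarith
  have hlog0 : 0 ≤ Real.log C / r := div_nonneg (Real.log_nonneg hC1) hr0.le
  have hM := moments_le_of_integral_exp_le hr0 hC1 (H.lam_meas' ht htT).norm
    (fun ω => norm_nonneg _) (H.norm_lam_le ht htT) hE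
  have hle := hlogC.trans hγ₃'
  refine ⟨hM.1.trans hle, hM.2.trans ?_, by linarith⟩
  have h1 : (Real.log C / r) ^ 2 ≤ c.γ₃ ^ 2 := pow_le_pow_left₀ hlog0 hle 2
  have h2 : (Real.log C / r) * (1 / r) ≤ c.γ₃ * (12 * q) :=
    mul_le_mul hle hr12 (by positivity) (by linarith)
  have h3 : (1 / r) ^ 2 ≤ (12 * q) ^ 2 := pow_le_pow_left₀ (by positivity) hr12 2
  have h4 : 0 ≤ 2 * c.νg ^ 2 * (upperGamma 6 1 + 2 * upperGamma 4 1 + upperGamma 2 1) := by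
    have h5 := fun a => upperGamma_nonneg (a := a) zero_le_one
    have h6 := h5 6
    have h7 := h5 4
    have h8 := h5 2
    positivity
  have h5 : 0 ≤ 2 * σ * c.νg * (c.γ₃ + 16 * q) := by
    have : 0 ≤ c.γ₃ := by linarith
    positivity
  have h6 : c.γ₁ ^ 4 / c.ε₀ ^ 2 = q ^ 2 := by rw [hq]; field_simp
  -- The moment bound gives `γ₃² + 24 γ₃ q + 288 q²`, and `4q ≤ γ₃` turns this into the leading
  -- terms `γ₃² + 32 γ₃ q + 256 q²`; the remaining terms of `γ₄` are nonnegative.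
  rw [ProgConsts.γ₄, ← hq, h6]
  nlinarith [mul_le_mul_of_nonneg_right hγ₃q hq0.le, sq_nonneg c.νg]

end IsSampledRun

/-! ### Telescoping sums for complementarity, constraints and envelopes -/

lemma sum_Icc_le_of_telescope {a b : ℕ → ℝ} {K : ℝ} {T : ℕ}
    (h : ∀ t, 1 ≤ t → t ≤ T → a t ≤ K + (b t - b (t + 1))) :
    ∑ t ∈ Finset.Icc 1 T, a t ≤ T * K + (b 1 - b (T + 1)) := by
  induction T with
  | zero => simp
  | succ T ih =>
    rw [Finset.sum_Icc_succ_top (by omega)]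
    have h1 := ih fun t h1 h2 => h t h1 (by omega)
    have h2 := h (T + 1) (by omega) le_rfl
    push_cast
    linarith

lemma measurable_comp_of_continuous_subtype {A B C Ω : Type*} [TopologicalSpace A]
    [SecondCountableTopology A] [MeasurableSpace A] [BorelSpace A] [TopologicalSpace B]
    [SecondCountableTopology B] [MeasurableSpace B] [BorelSpace B] [TopologicalSpace C]
    [MeasurableSpace C] [BorelSpace C] {m : MeasurableSpace Ω} {S : Set A} {f : A → B → C}
    (hf : Continuous fun a : S × B => f a.1 a.2) {l : Ω → A} {y : Ω → B} (hl : Measurable l)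
    (hlS : ∀ ω, l ω ∈ S) (hy : Measurable y) : Measurable fun ω => f (l ω) (y ω) :=
  hf.measurable.comp ((hl.subtype_mk (h := hlS)).prodMk hy)

namespace IsSampledRun

variable {n p : ℕ} {Ω Ξ : Type*} [mΩ : MeasurableSpace Ω] [MeasurableSpace Ξ]
    {Q : StochProgram n p Ξ} {c : ProgConsts p} {μ : Measure Ω} {σ α τ : ℝ} {T : ℕ}
    {ξ : ℕ → Ω → Ξ} {x1 : RVec n} {Sig : ℕ → Fin p → Ω → Matrix (Fin n) (Fin n) ℝ}
    {x : ℕ → Ω → RVec n} {lam : ℕ → Ω → RVec p}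

lemma abs_inner_lam_gvec_le (H : IsSampledRun Q c μ σ α τ T ξ x1 Sig x lam) {t : ℕ} (ht : 1 ≤ t)
    (htT : t ≤ T + 1) (ω : Ω) {z : RVec n} (hz : z ∈ Q.X₀) :
    |inner ℝ (lam t ω) (Q.gvec z)| ≤ T * (σ * c.γ₁) * c.νg :=
  StochProgram.Assumptions.abs_inner_le (H.norm_lam_le ht htT ω)
    (H.assumptions.norm_gvec_le (H.assumptions.X₀_subset hz))

/-- Accumulated violation of complementarity. -/
theorem sum_complementarity_le (H : IsSampledRun Q c μ σ α τ T ξ x1 Sig x lam) :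
    ∑ t ∈ Finset.Icc 1 T, -∫ ω, inner ℝ (lam t ω) (Q.gvec (x t ω)) ∂μ
      ≤ T * (σ / 2 * c.νg ^ 2 + c.κf ^ 2 / (2 * α)) := by
  have := H.isProb
  have hQ := H.assumptions
  have hσ := H.σ_pos
  have h1 := sum_Icc_le_of_telescope (T := T)
    (a := fun t => -∫ ω, inner ℝ (lam t ω) (Q.gvec (x t ω)) ∂μ)
    (b := fun t => 1 / (2 * σ) * ∫ ω, ‖lam t ω‖ ^ 2 ∂μ)
    (K := σ / 2 * c.νg ^ 2 + c.κf ^ 2 / (2 * α)) (by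
      intro t ht htT
      have hxO := H.x_memO ht (by omega : t ≤ T + 1)
      have e := hQ.integral_inner_Gvec (μ := μ) (history_le H.ξ_meas (t - 1))
        (H.lam_meas ht (by omega)) (H.norm_lam_le ht (by omega)) (H.x_meas ht (by omega)) hxO
        (H.ξ_meas t) (indep_history H.ξ_meas H.ξ_indep ht) (H.ξ_law t ⟨ht, htT⟩)
      have hi : Integrable (fun ω => inner ℝ (lam t ω) (Q.Gvec (x t ω) (ξ t ω))) μ :=
        integrable_of_abs_le (measurable_inner (H.lam_meas' ht (by omega))
          (hQ.measurable_Gvec (H.x_meas' ht (by omega)) hxO (H.ξ_meas t)))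
          fun ω => StochProgram.Assumptions.abs_inner_le (H.norm_lam_le ht (by omega) ω)
            (hQ.norm_G_le _ (hxO ω) _)
      have hl := H.integrable_norm_lam_sq ht (by omega : t ≤ T + 1)
      have hl' := H.integrable_norm_lam_sq (t := t + 1) (by omega) (by omega)
      have hd : Integrable (fun ω => 1 / (2 * σ) * (‖lam t ω‖ ^ 2 - ‖lam (t + 1) ω‖ ^ 2)) μ :=
        (hl.sub hl').const_mul _
      have h2 : ∫ ω, -inner ℝ (lam t ω) (Q.Gvec (x t ω) (ξ t ω)) ∂μ
          ≤ ∫ ω, (σ / 2 * c.νg ^ 2 + c.κf ^ 2 / (2 * α)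
            + 1 / (2 * σ) * (‖lam t ω‖ ^ 2 - ‖lam (t + 1) ω‖ ^ 2)) ∂μ :=
        integral_mono hi.neg ((integrable_const _).add hd) fun ω => by
          have := (H.isModelStep ht htT ω).complementarity
          simp only
          linarith
      rw [integral_neg, e, integral_add (integrable_const _) hd,
        integral_const_mul, integral_sub hl hl'] at h2
      simp only [integral_const, probReal_univ, smul_eq_mul, one_mul] at h2
      linarith)
  simp only [H.run.lam_init, norm_zero] at h1
  have h2 : 0 ≤ 1 / (2 * σ) * ∫ ω, ‖lam (T + 1) ω‖ ^ 2 ∂μ :=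
    mul_nonneg (by positivity) (integral_nonneg fun ω => sq_nonneg _)
  simp at h1 h2 ⊢
  linarith

/-- Accumulated violation of a constraint. -/
theorem sum_constraint_le (H : IsSampledRun Q c μ σ α τ T ξ x1 Sig x lam) (i : Fin p) :
    ∑ t ∈ Finset.Icc 1 T, σ * ∫ ω, Q.g i (x t ω) ∂μ
      ≤ T * (σ * (1 / α * (c.ρ₁ + (c.νg + c.γ₃) * c.ρ₂))) + c.γ₃ := by
  have := H.isProb
  have hQ := H.assumptions
  have hσ := H.σ_pos
  have hα := H.α_pos
  have hρ₂ : 0 ≤ c.ρ₂ := by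
    have h1 := hQ.κg_pos
    have h2 := hQ.D₀_pos
    have h3 := H.κS_pos
    rw [ProgConsts.ρ₂]; positivity
  have hli : ∀ t, 1 ≤ t → t ≤ T + 1 → Integrable (fun ω => lam t ω i) μ := fun t ht htT =>
    integrable_of_abs_le (measurable_apply (H.lam_meas' ht htT) i) fun ω =>
      (abs_apply_le_norm _ i).trans (H.norm_lam_le ht htT ω)
  have h1 := sum_Icc_le_of_telescope (T := T)
    (a := fun t => σ * ∫ ω, Q.g i (x t ω) ∂μ)
    (b := fun t => -∫ ω, lam t ω i ∂μ)
    (K := σ * (1 / α * (c.ρ₁ + (c.νg + c.γ₃) * c.ρ₂))) (by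
      intro t ht htT
      have hxO := H.x_memO ht (by omega : t ≤ T + 1)
      -- A standard basis vector in place of the multiplier extracts the single constraint `i`.
      have e := hQ.integral_inner_Gvec (μ := μ) (history_le H.ξ_meas (t - 1))
        (V := fun _ => EuclideanSpace.single i (1 : ℝ)) measurable_const (fun _ => le_rfl)
        (H.x_meas ht (by omega)) hxO
        (H.ξ_meas t) (indep_history H.ξ_meas H.ξ_indep ht) (H.ξ_law t ⟨ht, htT⟩)
      simp only [EuclideanSpace.inner_single_left, map_one, one_mul] at e
      change ∫ ω, Q.G i (x t ω) (ξ t ω) ∂μ = ∫ ω, Q.g i (x t ω) ∂μ at e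
      have hi : Integrable (fun ω => Q.G i (x t ω) (ξ t ω)) μ :=
        integrable_of_abs_le (hQ.measurable_G i (H.x_meas' ht (by omega)) hxO (H.ξ_meas t))
          fun ω => hQ.abs_G_le i (hxO ω) _
      have hl := hli t ht (by omega)
      have hl' := hli (t + 1) (by omega) (by omega)
      have hn := H.integrable_norm_lam ht (by omega : t ≤ T + 1)
      have hd : Integrable (fun ω => lam (t + 1) ω i - lam t ω i) μ := hl'.sub hl
      have hs : Integrable (fun ω => σ * (1 / α * c.ρ₂) * ‖lam t ω‖) μ := hn.const_mul _
      have hds : Integrable (fun ω => (lam (t + 1) ω i - lam t ω i)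
        + σ * (1 / α * c.ρ₂) * ‖lam t ω‖) μ := hd.add hs
      have h2 : ∫ ω, σ * Q.G i (x t ω) (ξ t ω) ∂μ
          ≤ ∫ ω, ((lam (t + 1) ω i - lam t ω i) + σ * (1 / α * c.ρ₂) * ‖lam t ω‖
            + σ * (1 / α * (c.ρ₁ + c.νg * c.ρ₂))) ∂μ :=
        integral_mono (hi.const_mul σ) (hds.add (integrable_const _)) fun ω => by
          have := (H.isModelStep ht htT ω).constraint_le H.σ_le_one i
          change σ * Q.G i (x t ω) (ξ t ω) ≤ _ at this
          simp only
          linarith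
      rw [integral_const_mul, e, integral_add hds (integrable_const _), integral_add hd hs,
        integral_sub hl' hl, integral_const_mul] at h2
      simp only [integral_const, probReal_univ, smul_eq_mul, one_mul] at h2
      have h3 := mul_le_mul_of_nonneg_left (H.moments_norm_lam_le ht (by omega : t ≤ T + 1)).1
        (by positivity : 0 ≤ σ * (1 / α * c.ρ₂))
      linarith)
  have h2 : ∫ ω, lam (T + 1) ω i ∂μ ≤ c.γ₃ :=
    (integral_mono (hli _ (by omega) le_rfl) (H.integrable_norm_lam (by omega) le_rfl)
      fun ω => (le_abs_self _).trans (abs_apply_le_norm _ i)).trans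
      (H.moments_norm_lam_le (t := T + 1) (by omega) le_rfl).1
  have h3 : ∫ ω, lam 1 ω i ∂μ = 0 := by simp [H.run.lam_init]
  rw [h3] at h1
  linarith

/-- The proximal point of the current Lagrangian at the current iterate. -/
noncomputable def proxIter (H : IsSampledRun Q c μ σ α τ T ξ x1 Sig x lam) (t : ℕ) (ω : Ω) :
    RVec n := H.assumptions.prox α (lam t ω) (x t ω)

lemma lam_mem_multiplierSet (H : IsSampledRun Q c μ σ α τ T ξ x1 Sig x lam) {t : ℕ} (ht : 1 ≤ t)
    (htT : t ≤ T + 1) (ω : Ω) : lam t ω ∈ StochProgram.Assumptions.multiplierSet c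
      (c.L₀ + ∑ i, T * (σ * c.γ₂) * c.L i) :=
  ⟨H.lam_nonneg ht htT ω, add_le_add_right (Finset.sum_le_sum fun i _ =>
    mul_le_mul_of_nonneg_right (H.lam_le ht htT ω i) (H.assumptions.L_pos i).le) _⟩

lemma weak_modulus_lt (H : IsSampledRun Q c μ σ α τ T ξ x1 Sig x lam) {t : ℕ} (ht : 1 ≤ t)
    (htT : t ≤ T + 1) (ω : Ω) : 2 * (c.L₀ + ∑ i, lam t ω i * c.L i) < α :=
  lt_of_le_of_lt (mul_le_mul_of_nonneg_left (H.lam_mem_multiplierSet ht htT ω).2 zero_le_two)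
    H.weak

lemma weak_modulus_pos (H : IsSampledRun Q c μ σ α τ T ξ x1 Sig x lam) {t : ℕ} (ht : 1 ≤ t)
    (htT : t ≤ T + 1) (ω : Ω) : 0 < c.L₀ + ∑ i, lam t ω i * c.L i :=
  add_pos_of_pos_of_nonneg H.assumptions.L₀_pos (Finset.sum_nonneg fun i _ =>
    mul_nonneg (H.lam_nonneg ht htT ω i) (H.assumptions.L_pos i).le)

lemma proxIter_mem (H : IsSampledRun Q c μ σ α τ T ξ x1 Sig x lam) (t : ℕ) (ω : Ω) :
    H.proxIter t ω ∈ Q.X₀ := H.assumptions.prox_mem _ _ _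

lemma proxIter_memO (H : IsSampledRun Q c μ σ α τ T ξ x1 Sig x lam) (t : ℕ) (ω : Ω) :
    H.proxIter t ω ∈ Q.O₀ := H.assumptions.X₀_subset (H.proxIter_mem t ω)

/-- The proximal point is obtained by choice, but on the set of multipliers that the run can reach
it is continuous in multiplier and centre, hence determined measurably by the past. -/
lemma proxIter_meas (H : IsSampledRun Q c μ σ α τ T ξ x1 Sig x lam) {t : ℕ} (ht : 1 ≤ t)
    (htT : t ≤ T + 1) : Measurable[history ξ (t - 1)] (H.proxIter t) := by
  have hm : c.L₀ + ∑ i, T * (σ * c.γ₂) * c.L i < α := by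
    have h1 := H.weak
    have h2 : 0 < c.L₀ + ∑ i, T * (σ * c.γ₂) * c.L i :=
      add_pos_of_pos_of_nonneg H.assumptions.L₀_pos (Finset.sum_nonneg fun i _ =>
        mul_nonneg (mul_nonneg (Nat.cast_nonneg _) (mul_pos H.σ_pos H.γ₂_pos).le)
          (H.assumptions.L_pos i).le)
    linarith
  exact measurable_comp_of_continuous_subtype (f := H.assumptions.prox α)
    (H.assumptions.continuous_prox hm H.α_pos.le) (H.lam_meas ht htT)
    (H.lam_mem_multiplierSet ht htT) (H.x_meas ht htT)

lemma proxIter_meas' (H : IsSampledRun Q c μ σ α τ T ξ x1 Sig x lam) {t : ℕ} (ht : 1 ≤ t)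
    (htT : t ≤ T + 1) : Measurable (H.proxIter t) :=
  (H.proxIter_meas ht htT).mono (history_le H.ξ_meas _) le_rfl

lemma hasGradientAt_lagEnvelope (H : IsSampledRun Q c μ σ α τ T ξ x1 Sig x lam) {t : ℕ}
    (ht : 1 ≤ t) (htT : t ≤ T + 1) (ω : Ω) :
    HasGradientAt (Q.lagEnvelope α (lam t ω)) (α • (x t ω - H.proxIter t ω)) (x t ω) :=
  H.assumptions.hasGradientAt_lagEnvelope (H.lam_nonneg ht htT ω)
    (by linarith [H.weak_modulus_lt ht htT ω, H.weak_modulus_pos ht htT ω]) H.α_pos.le _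

lemma norm_gradient_sq (H : IsSampledRun Q c μ σ α τ T ξ x1 Sig x lam) {t : ℕ}
    (ht : 1 ≤ t) (htT : t ≤ T + 1) (ω : Ω) :
    ‖gradient (Q.lagEnvelope α (lam t ω)) (x t ω)‖ ^ 2
      = α ^ 2 * ‖H.proxIter t ω - x t ω‖ ^ 2 := by
  rw [(H.hasGradientAt_lagEnvelope ht htT ω).gradient, norm_smul, mul_pow, Real.norm_eq_abs,
    sq_abs, norm_sub_rev]

lemma integrable_norm_sub_sq (H : IsSampledRun Q c μ σ α τ T ξ x1 Sig x lam) {y z : Ω → RVec n}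
    (hy : Measurable y) (hz : Measurable z) (hyX : ∀ ω, y ω ∈ Q.X₀) (hzX : ∀ ω, z ω ∈ Q.X₀) :
    Integrable (fun ω => ‖z ω - y ω‖ ^ 2) μ := by
  have := H.isProb
  refine integrable_of_abs_le (C := c.D₀ ^ 2) ((hz.sub hy).norm.pow_const 2) fun ω => ?_
  rw [abs_of_nonneg (sq_nonneg _)]
  exact pow_le_pow_left₀ (norm_nonneg _) (H.assumptions.diam_le _ (hzX ω) _ (hyX ω)) 2

/-- The expected distance of the next iterate to the proximal point. -/
lemma integral_descent (H : IsSampledRun Q c μ σ α τ T ξ x1 Sig x lam) {t : ℕ} (ht : 1 ≤ t)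
    (htT : t ≤ T) :
    (τ + α) / 2 * ∫ ω, ‖H.proxIter t ω - x (t + 1) ω‖ ^ 2 ∂μ
      ≤ (τ + α) / 2 * ∫ ω, ‖H.proxIter t ω - x t ω‖ ^ 2 ∂μ
        - α / 2 * ∫ ω, ‖H.proxIter t ω - x t ω‖ ^ 2 ∂μ
        + σ * (c.D₀ * c.γ₂ * p * (c.κg + c.κS * c.D₀))
        + ((c.κf + c.γ₂ * p * (c.κg + c.κS * c.D₀)) ^ 2 + p * c.κg ^ 2 * c.γ₄ σ) / (τ + α) := by
  have := H.isProb
  have hQ := H.assumptions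
  have hτα : 0 < τ + α := add_pos H.τ_pos H.α_pos
  have htT1 : t ≤ T + 1 := by omega
  have hx := H.x_meas ht htT1
  have hz := H.proxIter_meas ht htT1
  have hl := H.lam_meas ht htT1
  have hx' := H.x_meas' ht htT1
  have hz' := H.proxIter_meas' ht htT1
  have hl' := H.lam_meas' ht htT1
  have hxX := H.x_mem ht htT1
  have hzX := H.proxIter_mem t
  have hxO := H.x_memO ht htT1
  have hzO := H.proxIter_memO t
  have hle := history_le H.ξ_meas (t - 1)
  have hind := indep_history H.ξ_meas H.ξ_indep ht
  have hlaw := H.ξ_law t ⟨ht, htT⟩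
  have hlC := H.norm_lam_le ht htT1
  set z := H.proxIter t with hzdef
  -- expectations given the past
  have eF := hQ.integral_F_sub (μ := μ) hle hx hz hxX hzX (H.ξ_meas t) hind hlaw
  have eGz := hQ.integral_inner_Gvec (μ := μ) hle hl hlC hz hzO (H.ξ_meas t) hind hlaw
  have eGx := hQ.integral_inner_Gvec (μ := μ) hle hl hlC hx hxO (H.ξ_meas t) hind hlaw
  have hFi : Integrable (fun ω => Q.F (z ω) (ξ t ω) - Q.F (x t ω) (ξ t ω)) μ :=
    integrable_of_abs_le (C := c.κf * c.D₀)
      ((hQ.measurable_F hz' hzO (H.ξ_meas t)).sub (hQ.measurable_F hx' hxO (H.ξ_meas t)))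
      fun ω => (hQ.abs_F_sub_le (hxO ω) (hzO ω) _).trans
        (mul_le_mul_of_nonneg_left (hQ.diam_le _ (hzX ω) _ (hxX ω)) hQ.κf_pos.le)
  have hfi : Integrable (fun ω => Q.f (z ω) - Q.f (x t ω)) μ :=
    integrable_of_abs_le (C := c.κf * c.D₀)
      ((hQ.measurable_f hz' hzO).sub (hQ.measurable_f hx' hxO))
      fun ω => (hQ.abs_f_sub_le (hxO ω) (hzO ω)).trans
        (mul_le_mul_of_nonneg_left (hQ.diam_le _ (hzX ω) _ (hxX ω)) hQ.κf_pos.le)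
  have hGi : ∀ y : Ω → RVec n, Measurable y → (∀ ω, y ω ∈ Q.O₀) →
      Integrable (fun ω => inner ℝ (lam t ω) (Q.Gvec (y ω) (ξ t ω))) μ := fun y hy hyO =>
    integrable_of_abs_le (measurable_inner hl' (hQ.measurable_Gvec hy hyO (H.ξ_meas t)))
      fun ω => StochProgram.Assumptions.abs_inner_le (hlC ω) (hQ.norm_G_le _ (hyO ω) _)
  have hgi : ∀ y : Ω → RVec n, Measurable y → (∀ ω, y ω ∈ Q.O₀) →
      Integrable (fun ω => inner ℝ (lam t ω) (Q.gvec (y ω))) μ := fun y hy hyO =>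
    integrable_of_abs_le (measurable_inner hl' (hQ.measurable_gvec hy hyO))
      fun ω => StochProgram.Assumptions.abs_inner_le (hlC ω) (hQ.norm_gvec_le (hyO ω))
  set m : Ω → ℝ := fun ω => c.L₀ + ∑ i, lam t ω i * c.L i with hm
  have hmm : Measurable m :=
    (Finset.measurable_sum _ fun i _ => (measurable_apply hl' i).mul_const _).const_add _
  have hmi : Integrable (fun ω => m ω * ‖z ω - x t ω‖ ^ 2) μ := by
    refine (H.integrable_norm_sub_sq hx' hz' hxX hzX).bdd_mul (c := α) hmm.aestronglyMeasurable
      (Filter.Eventually.of_forall fun ω => ?_)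
    have h1 := H.weak_modulus_lt ht htT1 ω
    have h2 := H.weak_modulus_pos ht htT1 ω
    rw [Real.norm_eq_abs, abs_of_pos h2]
    simp only
    linarith
  have hr := H.integrable_norm_sub_sq hx' hz' hxX hzX
  have hr' := H.integrable_norm_sub_sq (H.x_meas' (t := t + 1) (by omega) (by omega)) hz'
    (H.x_mem (by omega) (by omega)) hzX
  have hl2 := H.integrable_norm_lam_sq ht htT1
  set K := σ * (c.D₀ * c.γ₂ * p * (c.κg + c.κS * c.D₀))
    + (c.κf + c.γ₂ * p * (c.κg + c.κS * c.D₀)) ^ 2 / (τ + α) with hK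
  -- pathwise inequality
  have hpt : ∀ ω, (τ + α) / 2 * ‖z ω - x (t + 1) ω‖ ^ 2
      ≤ (τ + α) / 2 * ‖z ω - x t ω‖ ^ 2 + (Q.F (z ω) (ξ t ω) - Q.F (x t ω) (ξ t ω))
        + (inner ℝ (lam t ω) (Q.Gvec (z ω) (ξ t ω)) - inner ℝ (lam t ω) (Q.Gvec (x t ω) (ξ t ω)))
        + 1 / 2 * (m ω * ‖z ω - x t ω‖ ^ 2) + (p * c.κg ^ 2 / (τ + α) * ‖lam t ω‖ ^ 2 + K) := by
    intro ω
    have h1 := (H.isModelStep ht htT ω).descent H.σ_le_one (hzX ω)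
    have h2 := (hQ.F_weak (ξ t ω)).gradient_le (hxO ω) (hzO ω) (hQ.F_diff _ (hxO ω) _)
    have h3 : ∑ i, lam t ω i * inner ℝ (Q.gradG i (x t ω) (ξ t ω)) (z ω - x t ω)
        ≤ (inner ℝ (lam t ω) (Q.Gvec (z ω) (ξ t ω)) - inner ℝ (lam t ω) (Q.Gvec (x t ω) (ξ t ω)))
          + (∑ i, lam t ω i * c.L i) / 2 * ‖z ω - x t ω‖ ^ 2 := by
      rw [← inner_sub_right, PiLp.inner_apply, Finset.sum_div, Finset.sum_mul,
        ← Finset.sum_add_distrib]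
      refine Finset.sum_le_sum fun i _ => ?_
      have h4 := (hQ.G_weak i (ξ t ω)).gradient_le (hxO ω) (hzO ω) (hQ.G_diff i _ (hxO ω) _)
      have h5 := mul_le_mul_of_nonneg_left h4 (H.lam_nonneg ht htT1 ω i)
      have e : inner ℝ (lam t ω i) ((Q.Gvec (z ω) (ξ t ω) - Q.Gvec (x t ω) (ξ t ω)) i)
          = lam t ω i * (Q.G i (z ω) (ξ t ω) - Q.G i (x t ω) (ξ t ω)) := by
        simp [StochProgram.Gvec, mul_comm]
      rw [e]
      simp only [StochProgram.gradG]
      linarith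
    have e : ((c.κf + c.γ₂ * p * (c.κg + c.κS * c.D₀)) ^ 2 + p * c.κg ^ 2 * ‖lam t ω‖ ^ 2)
        / (τ + α) = (c.κf + c.γ₂ * p * (c.κg + c.κS * c.D₀)) ^ 2 / (τ + α)
          + p * c.κg ^ 2 / (τ + α) * ‖lam t ω‖ ^ 2 := by ring
    rw [e] at h1
    simp only [StochProgram.gradF] at h1
    simp only [hm, hK]
    linarith
  have i1 := hr.const_mul ((τ + α) / 2)
  have i2 : Integrable (fun ω => inner ℝ (lam t ω) (Q.Gvec (z ω) (ξ t ω))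
    - inner ℝ (lam t ω) (Q.Gvec (x t ω) (ξ t ω))) μ := (hGi z hz' hzO).sub (hGi _ hx' hxO)
  have i3 := hmi.const_mul (1 / 2)
  have i4 : Integrable (fun ω => p * c.κg ^ 2 / (τ + α) * ‖lam t ω‖ ^ 2 + K) μ :=
    (hl2.const_mul _).add (integrable_const K)
  have k1 : Integrable (fun ω => (τ + α) / 2 * ‖z ω - x t ω‖ ^ 2
    + (Q.F (z ω) (ξ t ω) - Q.F (x t ω) (ξ t ω))) μ := i1.add hFi
  have k2 : Integrable (fun ω => (τ + α) / 2 * ‖z ω - x t ω‖ ^ 2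
    + (Q.F (z ω) (ξ t ω) - Q.F (x t ω) (ξ t ω))
    + (inner ℝ (lam t ω) (Q.Gvec (z ω) (ξ t ω))
      - inner ℝ (lam t ω) (Q.Gvec (x t ω) (ξ t ω)))) μ := k1.add i2
  have k3 : Integrable (fun ω => (τ + α) / 2 * ‖z ω - x t ω‖ ^ 2
    + (Q.F (z ω) (ξ t ω) - Q.F (x t ω) (ξ t ω))
    + (inner ℝ (lam t ω) (Q.Gvec (z ω) (ξ t ω)) - inner ℝ (lam t ω) (Q.Gvec (x t ω) (ξ t ω)))
    + 1 / 2 * (m ω * ‖z ω - x t ω‖ ^ 2)) μ := k2.add i3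
  have hI := integral_mono (hr'.const_mul ((τ + α) / 2)) (k3.add i4) hpt
  rw [integral_add' k3 i4, integral_add k2 i3, integral_add k1 i2, integral_add i1 hFi,
    integral_sub (hGi z hz' hzO) (hGi _ hx' hxO),
    integral_add (hl2.const_mul _) (integrable_const K), eF, eGz, eGx] at hI
  simp only [integral_const_mul, integral_const, probReal_univ, smul_eq_mul, one_mul] at hI
  -- the growth of the proximal objective
  have hgrow : ∫ ω, (Q.f (z ω) - Q.f (x t ω)) ∂μ + (∫ ω, inner ℝ (lam t ω) (Q.gvec (z ω)) ∂μ
      - ∫ ω, inner ℝ (lam t ω) (Q.gvec (x t ω)) ∂μ) + 1 / 2 * ∫ ω, m ω * ‖z ω - x t ω‖ ^ 2 ∂μ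
      ≤ -(α / 2) * ∫ ω, ‖z ω - x t ω‖ ^ 2 ∂μ := by
    have j2 : Integrable (fun ω => inner ℝ (lam t ω) (Q.gvec (z ω))
      - inner ℝ (lam t ω) (Q.gvec (x t ω))) μ := (hgi z hz' hzO).sub (hgi _ hx' hxO)
    have j3 : Integrable (fun ω => Q.f (z ω) - Q.f (x t ω) + (inner ℝ (lam t ω) (Q.gvec (z ω))
      - inner ℝ (lam t ω) (Q.gvec (x t ω)))) μ := hfi.add j2
    rw [← integral_sub (hgi z hz' hzO) (hgi _ hx' hxO), ← integral_const_mul,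
      ← integral_const_mul, ← integral_add hfi j2, ← integral_add j3 i3]
    refine integral_mono (j3.add i3) (hr.const_mul _) fun ω => ?_
    have h1 := (hQ.weaklyConvexOn_lagrangian (H.lam_nonneg ht htT1 ω) le_rfl).proxObj_growth
      (hzX ω) (hxX ω) (hQ.isMinOn_prox α (lam t ω) (x t ω))
    change proxObj _ α (x t ω) (z ω) + _ * ‖x t ω - z ω‖ ^ 2 ≤ _ at h1
    simp only [proxObj, sub_self, norm_zero, StochProgram.Assumptions.lagrangian_eq] at h1
    rw [norm_sub_rev (x t ω) (z ω)] at h1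
    have h2 := H.weak_modulus_lt ht htT1 ω
    -- The modulus `m` is paid twice: once in replacing linearizations by function values, once in
    -- the growth of the proximal objective. This is why `α` must exceed `2m`.
    have h3 : 0 ≤ (α - 2 * m ω) * ‖z ω - x t ω‖ ^ 2 :=
      mul_nonneg (by simp only [hm]; linarith) (sq_nonneg _)
    have h4 : (α - (c.L₀ + ∑ i, lam t ω i * c.L i)) / 2 * ‖z ω - x t ω‖ ^ 2
        = (α - m ω) / 2 * ‖z ω - x t ω‖ ^ 2 := rfl
    rw [h4] at h1
    linarith
  have hmom := mul_le_mul_of_nonneg_left (H.moments_norm_lam_le ht htT1).2.1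
    (by positivity : 0 ≤ p * c.κg ^ 2 / (τ + α))
  have e : ((c.κf + c.γ₂ * p * (c.κg + c.κS * c.D₀)) ^ 2 + p * c.κg ^ 2 * c.γ₄ σ)
        / (τ + α) = (c.κf + c.γ₂ * p * (c.κg + c.κS * c.D₀)) ^ 2 / (τ + α)
          + p * c.κg ^ 2 / (τ + α) * c.γ₄ σ := by ring
  rw [e]
  simp only [hK] at hI
  linarith

lemma lagEnvelope_eq (H : IsSampledRun Q c μ σ α τ T ξ x1 Sig x lam) (t : ℕ) (ω : Ω) :
    Q.lagEnvelope α (lam t ω) (x t ω) = Q.f (H.proxIter t ω)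
      + inner ℝ (lam t ω) (Q.gvec (H.proxIter t ω)) + α / 2 * ‖H.proxIter t ω - x t ω‖ ^ 2 := by
  rw [H.assumptions.lagEnvelope_eq, proxObj, StochProgram.Assumptions.lagrangian_eq]
  rfl

lemma integrable_f_comp (H : IsSampledRun Q c μ σ α τ T ξ x1 Sig x lam) {z : Ω → RVec n}
    (hz : Measurable z) (hzX : ∀ ω, z ω ∈ Q.X₀) : Integrable (fun ω => Q.f (z ω)) μ := by
  have := H.isProb
  have hQ := H.assumptions
  refine integrable_of_abs_le (C := |Q.f x1| + c.κf * c.D₀)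
    (hQ.measurable_f hz fun ω => hQ.X₀_subset (hzX ω)) fun ω => ?_
  have h1 := hQ.abs_f_sub_le (hQ.X₀_subset H.x1_mem) (hQ.X₀_subset (hzX ω))
  have h2 := mul_le_mul_of_nonneg_left (hQ.diam_le _ (hzX ω) _ H.x1_mem) hQ.κf_pos.le
  have h3 : Q.f (z ω) = Q.f x1 + (Q.f (z ω) - Q.f x1) := by ring
  rw [h3]
  exact (abs_add_le _ _).trans (by linarith)

lemma integrable_lagEnvelope (H : IsSampledRun Q c μ σ α τ T ξ x1 Sig x lam) {t : ℕ} (ht : 1 ≤ t)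
    (htT : t ≤ T + 1) : Integrable (fun ω => Q.lagEnvelope α (lam t ω) (x t ω)) μ := by
  have := H.isProb
  have hQ := H.assumptions
  simp only [H.lagEnvelope_eq]
  have hz := H.proxIter_meas' ht htT
  refine ((H.integrable_f_comp hz (H.proxIter_mem t)).add ?_).add
    ((H.integrable_norm_sub_sq (H.x_meas' ht htT) hz (H.x_mem ht htT)
      (H.proxIter_mem t)).const_mul _)
  exact integrable_of_abs_le (measurable_inner (H.lam_meas' ht htT)
    (hQ.measurable_gvec hz (H.proxIter_memO t)))
    fun ω => H.abs_inner_lam_gvec_le ht htT ω (H.proxIter_mem t ω)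

/-- Decrease of the expected Moreau envelope in one step. -/
lemma integral_lagEnvelope_succ_le (H : IsSampledRun Q c μ σ α τ T ξ x1 Sig x lam) {t : ℕ}
    (ht : 1 ≤ t) (htT : t ≤ T) :
    ∫ ω, Q.lagEnvelope α (lam (t + 1) ω) (x (t + 1) ω) ∂μ
      ≤ ∫ ω, Q.lagEnvelope α (lam t ω) (x t ω) ∂μ + σ * c.γ₁ * c.νg
        + α / 2 * (∫ ω, ‖H.proxIter t ω - x (t + 1) ω‖ ^ 2 ∂μ
          - ∫ ω, ‖H.proxIter t ω - x t ω‖ ^ 2 ∂μ) := by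
  have := H.isProb
  have hQ := H.assumptions
  have htT1 : t ≤ T + 1 := by omega
  have hz := H.proxIter_meas' ht htT1
  have i1 := H.integrable_lagEnvelope ht htT1
  have i2 := H.integrable_lagEnvelope (t := t + 1) (by omega) (by omega)
  have i3 := H.integrable_norm_sub_sq (H.x_meas' ht htT1) hz (H.x_mem ht htT1) (H.proxIter_mem t)
  have i4 := H.integrable_norm_sub_sq (H.x_meas' (t := t + 1) (by omega) (by omega)) hz
    (H.x_mem (by omega) (by omega)) (H.proxIter_mem t)
  have hI := integral_mono i2 ((i1.add (integrable_const (σ * c.γ₁ * c.νg))).add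
    ((i4.sub i3).const_mul (α / 2))) fun ω => by
      have h1 := hQ.lagEnvelope_le α (lam (t + 1) ω) (x (t + 1) ω) (H.proxIter_mem t ω)
      have h2 := H.lagEnvelope_eq t ω
      have h3 := (le_abs_self _).trans (StochProgram.Assumptions.abs_inner_le
        (H.isModelStep ht htT ω).norm_step_sub_le (hQ.norm_gvec_le (H.proxIter_memO t ω)))
      rw [inner_sub_left] at h3
      rw [StochProgram.Assumptions.lagrangian_eq] at h1
      simp only [Pi.add_apply, Pi.sub_apply]
      linarith
  rw [integral_add' (i1.add (integrable_const _)) ((i4.sub i3).const_mul _),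
    integral_add' i1 (integrable_const _)] at hI
  simp only [Pi.sub_apply, integral_const_mul, integral_const, probReal_univ, smul_eq_mul,
    one_mul, integral_sub i4 i3] at hI
  exact hI

lemma bddBelow_image_f (H : IsSampledRun Q c μ σ α τ T ξ x1 Sig x lam) :
    BddBelow (Q.f '' Q.X₀) := by
  have hQ := H.assumptions
  refine ⟨Q.f x1 - c.κf * c.D₀, ?_⟩
  rintro _ ⟨z, hz, rfl⟩
  have h2 := (abs_le.1 (hQ.abs_f_sub_le (hQ.X₀_subset H.x1_mem) (hQ.X₀_subset hz))).1
  have h3 := mul_le_mul_of_nonneg_left (hQ.diam_le _ hz _ H.x1_mem) hQ.κf_pos.le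
  linarith

/-- Accumulated squared gradients of the Moreau envelopes. -/
theorem sum_gradient_le (H : IsSampledRun Q c μ σ α τ T ξ x1 Sig x lam) :
    ∑ t ∈ Finset.Icc 1 T, α ^ 2 * ∫ ω, ‖H.proxIter t ω - x t ω‖ ^ 2 ∂μ
      ≤ T * (2 * (τ + α) * (σ * c.γ₁ * c.νg)
          + 2 * α * (σ * (c.D₀ * c.γ₂ * p * (c.κg + c.κS * c.D₀)))
          + 2 * α / (τ + α) * ((c.κf + c.γ₂ * p * (c.κg + c.κS * c.D₀)) ^ 2
            + p * c.κg ^ 2 * c.γ₄ σ))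
        + 2 * (τ + α) * (Q.f x1 - sInf (Q.f '' Q.X₀) + c.νg * c.γ₃) := by
  have := H.isProb
  have hQ := H.assumptions
  have hα := H.α_pos
  have hτα : 0 < τ + α := add_pos H.τ_pos H.α_pos
  set E : ℕ → ℝ := fun t => ∫ ω, Q.lagEnvelope α (lam t ω) (x t ω) ∂μ with hE
  have h1 := sum_Icc_le_of_telescope (T := T)
    (a := fun t => α ^ 2 * ∫ ω, ‖H.proxIter t ω - x t ω‖ ^ 2 ∂μ)
    (b := fun t => 2 * (τ + α) * E t)
    (K := 2 * (τ + α) * (σ * c.γ₁ * c.νg)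
          + 2 * α * (σ * (c.D₀ * c.γ₂ * p * (c.κg + c.κS * c.D₀)))
          + 2 * α / (τ + α) * ((c.κf + c.γ₂ * p * (c.κg + c.κS * c.D₀)) ^ 2
            + p * c.κg ^ 2 * c.γ₄ σ)) (by
      intro t ht htT
      -- With the weights `2α` and `2(τ + α)` the distances to `x (t + 1)` cancel, and the squared
      -- gradient is bounded by the decrease of `2(τ + α) E` plus errors.
      have h2 := mul_le_mul_of_nonneg_left (H.integral_descent ht htT) (by positivity : 0 ≤ 2 * α)
      have h3 := mul_le_mul_of_nonneg_left (H.integral_lagEnvelope_succ_le ht htT)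
        (by positivity : 0 ≤ 2 * (τ + α))
      simp only [hE]
      have e : 2 * α / (τ + α) * ((c.κf + c.γ₂ * p * (c.κg + c.κS * c.D₀)) ^ 2
            + p * c.κg ^ 2 * c.γ₄ σ) = 2 * α * (((c.κf + c.γ₂ * p * (c.κg + c.κS * c.D₀)) ^ 2
            + p * c.κg ^ 2 * c.γ₄ σ) / (τ + α)) := by ring
      rw [e]
      linarith)
  have hE1 : E 1 ≤ Q.f x1 := by
    have h2 : ∀ ω, Q.lagEnvelope α (lam 1 ω) (x 1 ω) ≤ Q.f x1 := by
      intro ω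
      have := hQ.lagEnvelope_le α (lam 1 ω) (x 1 ω) H.x1_mem
      rw [H.run.x_init, H.run.lam_init, StochProgram.Assumptions.lagrangian_eq] at this
      rw [H.run.x_init, H.run.lam_init]
      simpa using this
    have := integral_mono (H.integrable_lagEnvelope le_rfl (by omega)) (integrable_const _) h2
    simpa using this
  have hET : sInf (Q.f '' Q.X₀) - c.νg * c.γ₃ ≤ E (T + 1) := by
    have hn := H.integrable_norm_lam (t := T + 1) (by omega) le_rfl
    have h2 := integral_mono ((integrable_const (sInf (Q.f '' Q.X₀))).sub (hn.const_mul c.νg))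
      (H.integrable_lagEnvelope (t := T + 1) (by omega) le_rfl) fun ω => by
        have h3 := csInf_le H.bddBelow_image_f ⟨_, H.proxIter_mem (T + 1) ω, rfl⟩
        have h4 := (abs_le.1 (StochProgram.Assumptions.abs_inner_le (V := lam (T + 1) ω) le_rfl
          (hQ.norm_gvec_le (H.proxIter_memO (T + 1) ω)))).1
        have h5 : 0 ≤ α / 2 * ‖H.proxIter (T + 1) ω - x (T + 1) ω‖ ^ 2 := by positivity
        simp only [Pi.sub_apply, H.lagEnvelope_eq]
        linarith
    rw [integral_sub' (integrable_const _) (hn.const_mul _), integral_const_mul] at h2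
    simp only [integral_const, probReal_univ, smul_eq_mul, one_mul] at h2
    have h3 := mul_le_mul_of_nonneg_left (H.moments_norm_lam_le (t := T + 1) (by omega) le_rfl).1
      hQ.νg_pos.le
    simp only [hE]
    linarith
  have h2 : 2 * (τ + α) * E 1 - 2 * (τ + α) * E (T + 1)
      ≤ 2 * (τ + α) * (Q.f x1 - sInf (Q.f '' Q.X₀) + c.νg * c.γ₃) := by
    rw [← mul_sub]
    exact mul_le_mul_of_nonneg_left (by linarith) (by positivity)
  linarith

end IsSampledRun

/-! ### Evaluation at the random output index -/

lemma measurable_const_mul_norm_sub_sq {n : ℕ} {Ω : Type*} {m : MeasurableSpace Ω}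
    {y z : Ω → RVec n} (hy : Measurable y) (hz : Measurable z) (a : ℝ) :
    Measurable fun ω => a * ‖y ω - z ω‖ ^ 2 :=
  ((hy.sub hz).norm.pow_const 2).const_mul a

namespace IsSampledRun

variable {n p : ℕ} {Ω Ξ : Type*} [mΩ : MeasurableSpace Ω] [MeasurableSpace Ξ]
    {Q : StochProgram n p Ξ} {c : ProgConsts p} {μ : Measure Ω} {σ α τ : ℝ} {T : ℕ}
    {ξ : ℕ → Ω → Ξ} {x1 : RVec n} {Sig : ℕ → Fin p → Ω → Matrix (Fin n) (Fin n) ℝ}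
    {x : ℕ → Ω → RVec n} {lam : ℕ → Ω → RVec p} {R : Ω → ℕ}

/-- The squared gradient of the Moreau envelope at a random index. -/
lemma integral_norm_gradient_sq_index (H : IsSampledRun Q c μ σ α τ T ξ x1 Sig x lam)
    (hR : Measurable R) (hR_law : μ.map R = uniformOn (Icc 1 T))
    (hR_indep : Indep (MeasurableSpace.comap R inferInstance) (history ξ T) μ) :
    Integrable (fun ω => ‖gradient (Q.lagEnvelope α (lam (R ω) ω)) (x (R ω) ω)‖ ^ 2) μ ∧
      ∫ ω, ‖gradient (Q.lagEnvelope α (lam (R ω) ω)) (x (R ω) ω)‖ ^ 2 ∂μ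
        = 1 / T * ∑ t ∈ Finset.Icc 1 T, α ^ 2 * ∫ ω, ‖H.proxIter t ω - x t ω‖ ^ 2 ∂μ := by
  have := H.isProb
  have key : ∀ t, 1 ≤ t → t ≤ T →
      (fun ω => ‖gradient (Q.lagEnvelope α (lam t ω)) (x t ω)‖ ^ 2)
        = fun ω => α ^ 2 * ‖H.proxIter t ω - x t ω‖ ^ 2 := fun t ht htT =>
    funext fun ω => H.norm_gradient_sq ht (by omega) ω
  have h := integral_uniform_index (m := history ξ T) hR hR_law (history_le H.ξ_meas T) hR_indep
    (Y := fun t ω => ‖gradient (Q.lagEnvelope α (lam t ω)) (x t ω)‖ ^ 2)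
    (C := α ^ 2 * c.D₀ ^ 2)
    (fun t ht htT => by
      rw [key t ht htT]
      exact (measurable_const_mul_norm_sub_sq (H.proxIter_meas ht (by omega))
        (H.x_meas ht (by omega)) _).mono (history_mono (by omega)) le_rfl)
    (fun t ht htT ω => by
      have := H.norm_gradient_sq ht (by omega : t ≤ T + 1) ω
      simp only [this]
      rw [abs_of_nonneg (by positivity)]
      exact mul_le_mul_of_nonneg_left (pow_le_pow_left₀ (norm_nonneg _)
        (H.assumptions.diam_le _ (H.proxIter_mem t ω) _ (H.x_mem ht (by omega) ω)) 2)
        (sq_nonneg _))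
  refine ⟨h.1, h.2.trans ?_⟩
  congr 1
  refine Finset.sum_congr rfl fun t ht => ?_
  rw [Finset.mem_Icc] at ht
  rw [key t ht.1 ht.2, integral_const_mul]

/-- The constraint values at a random index. -/
lemma integral_g_index (H : IsSampledRun Q c μ σ α τ T ξ x1 Sig x lam)
    (hR : Measurable R) (hR_law : μ.map R = uniformOn (Icc 1 T))
    (hR_indep : Indep (MeasurableSpace.comap R inferInstance) (history ξ T) μ) (i : Fin p) :
    Integrable (fun ω => Q.g i (x (R ω) ω)) μ ∧
      ∫ ω, Q.g i (x (R ω) ω) ∂μ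
        = 1 / T * ∑ t ∈ Finset.Icc 1 T, ∫ ω, Q.g i (x t ω) ∂μ := by
  have := H.isProb
  exact integral_uniform_index (m := history ξ T) hR hR_law (history_le H.ξ_meas T) hR_indep
    (Y := fun t ω => Q.g i (x t ω)) (C := c.νg)
    (fun t ht htT => H.assumptions.measurable_g i
      ((H.x_meas ht (by omega)).mono (history_mono (by omega)) le_rfl) (H.x_memO ht (by omega)))
    (fun t ht htT ω => H.assumptions.abs_g_le i (H.x_memO ht (by omega) ω))

/-- The complementarity defect at a random index. -/
lemma integral_inner_index (H : IsSampledRun Q c μ σ α τ T ξ x1 Sig x lam)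
    (hR : Measurable R) (hR_law : μ.map R = uniformOn (Icc 1 T))
    (hR_indep : Indep (MeasurableSpace.comap R inferInstance) (history ξ T) μ) :
    Integrable (fun ω => inner ℝ (lam (R ω) ω) (Q.gvec (x (R ω) ω))) μ ∧
      ∫ ω, inner ℝ (lam (R ω) ω) (Q.gvec (x (R ω) ω)) ∂μ
        = 1 / T * ∑ t ∈ Finset.Icc 1 T, ∫ ω, inner ℝ (lam t ω) (Q.gvec (x t ω)) ∂μ := by
  have := H.isProb
  exact integral_uniform_index (m := history ξ T) hR hR_law (history_le H.ξ_meas T) hR_indep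
    (Y := fun t ω => inner ℝ (lam t ω) (Q.gvec (x t ω))) (C := T * (σ * c.γ₁) * c.νg)
    (fun t ht htT => (measurable_inner (H.lam_meas ht (by omega))
      (H.assumptions.measurable_gvec (H.x_meas ht (by omega)) (H.x_memO ht (by omega)))).mono
        (history_mono (by omega)) le_rfl)
    (fun t ht htT ω => H.abs_inner_lam_gvec_le ht (by omega) ω (H.x_mem ht (by omega) ω))

lemma sInf_image_le (H : IsSampledRun Q c μ σ α τ T ξ x1 Sig x lam) :
    sInf (Q.f '' Q.X₀) ≤ Q.f x1 :=
  csInf_le H.bddBelow_image_f ⟨x1, H.x1_mem, rfl⟩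

end IsSampledRun

/-! ### The prescribed parameters and the final bounds -/

/-- The parameters prescribed for the horizon `T` are admissible. -/
lemma IsSampledRun.of_rpow {n p : ℕ} {Ω Ξ : Type*} [MeasurableSpace Ω] [MeasurableSpace Ξ]
    (hp : 1 ≤ p) {Q : StochProgram n p Ξ} {c : ProgConsts p} (hQ : Q.Assumptions c)
    {μ : Measure Ω} [IsProbabilityMeasure μ] {T : ℕ} {u : ℝ} (hu : 0 < u) (huT : u ^ 4 = T)
    (hT : c.β ^ 2 < T) (hκS : 0 < c.κS) (hκε : √(p : ℝ) * c.κS * c.D₀ ^ 2 ≤ c.ε₀)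
    {ξ : ℕ → Ω → Ξ} (hξ_meas : ∀ t, Measurable (ξ t)) (hξ_law : ∀ t ∈ Icc 1 T, μ.map (ξ t) = Q.P)
    (hξ_indep : iIndepFun ξ μ) {x1 : RVec n} (hx1 : x1 ∈ Q.X₀)
    {Sig : ℕ → Fin p → Ω → Matrix (Fin n) (Fin n) ℝ} {x : ℕ → Ω → RVec n} {lam : ℕ → Ω → RVec p}
    (hrun : IsPMQSopt Q (u ^ 3)⁻¹ (c.β * u) (u ^ 2) T x1 ξ Sig x lam)
    (hSig_le : ∀ t ∈ Icc 1 T, ∀ i ω,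
      (-(c.L i) • (1 : Matrix (Fin n) (Fin n) ℝ) - Sig t i ω).PosSemidef)
    (hSig_norm : ∀ t ∈ Icc 1 T, ∀ i ω, ‖matOp (Sig t i ω)‖ ≤ c.κS) :
    1 ≤ u ∧ 1 < c.β ∧ IsSampledRun Q c μ (u ^ 3)⁻¹ (c.β * u) (u ^ 2) T ξ x1 Sig x lam := by
  have hγ₂ : 0 < c.γ₂ := by
    have h1 := hQ.κg_pos
    have h2 := hQ.D₀_pos
    have h4 := hQ.νg_pos
    rw [ProgConsts.γ₂]
    positivity
  have hsum : 0 ≤ ∑ j, c.γ₂ * c.L j :=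
    Finset.sum_nonneg fun j _ => mul_nonneg hγ₂.le (hQ.L_pos j).le
  have hβ : 1 < c.β := by
    rw [ProgConsts.β]
    linarith [hQ.L₀_pos]
  rw [← huT] at hT
  have hβu : c.β < u ^ 2 := by
    refine lt_of_pow_lt_pow_left₀ 2 (by positivity) ?_
    rwa [← pow_mul]
  have hu1 : 1 < u := by
    by_contra! h
    have : u ^ 2 ≤ 1 := pow_le_one₀ hu.le h
    linarith
  have hu3 : 1 < u ^ 3 := one_lt_pow₀ hu1 (by norm_num)
  -- The window is `s = ⌈2u³⌉`: then `s σ ≤ 2 + u⁻³ ≤ 3`, while `β < u²` gives `τ + α = u² + βu ≤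
  -- 2u³ ≤ s`.
  refine ⟨hu1.le, hβ, inferInstance, hQ, hp, by positivity, inv_le_one_of_one_le₀ hu3.le,
    by positivity, by positivity, hκS, hκε, ⟨⌈2 * u ^ 3⌉₊, ?_, ?_, ?_⟩, ?_, hξ_meas, hξ_law,
    hξ_indep, hx1, hrun, hSig_le, hSig_norm⟩
  · exact Nat.one_le_iff_ne_zero.2 (Nat.ceil_pos.2 (by positivity)).ne'
  · have h1 := (Nat.ceil_lt_add_one (by positivity : 0 ≤ 2 * u ^ 3)).le
    rw [← div_eq_mul_inv, div_le_iff₀ (by positivity)]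
    linarith
  · refine le_trans ?_ (Nat.le_ceil _)
    have h1 : c.β * u ≤ u ^ 2 * u := mul_le_mul_of_nonneg_right hβu.le hu.le
    have h2 : u ^ 2 * 1 ≤ u ^ 2 * u := mul_le_mul_of_nonneg_left hu1.le (by positivity)
    linarith
  -- Here `T σ = u`, so multipliers grow at most like `u`, the same order as `α = βu`; the
  -- definition of `β` contains the required factor `2`.
  · have e : ∑ i, T * ((u ^ 3)⁻¹ * c.γ₂) * c.L i = u * ∑ i, c.γ₂ * c.L i := by
      rw [Finset.mul_sum]
      refine Finset.sum_congr rfl fun i _ => ?_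
      rw [← huT]
      field_simp
    rw [e, ProgConsts.β]
    have := mul_lt_mul_of_pos_left hu1 hQ.L₀_pos
    linarith

/-- Arithmetic behind the bound for the Lagrangian gradient. -/
lemma gradient_bound_arith {u β S Δ N₁ N₂ M A B C T : ℝ} (hu : 1 ≤ u) (hβ : 0 < β)
    (hT : T = u ^ 4) (hΔ : 0 ≤ Δ) (hN₁ : 0 ≤ N₁) (hN₂ : 0 ≤ N₂) (hM : 0 ≤ M) (hA : 0 ≤ A)
    (hB : 0 ≤ B) (hC : 0 ≤ C)
    (hS : S ≤ T * (2 * (u ^ 2 + β * u) * ((u ^ 3)⁻¹ * N₁) + 2 * (β * u) * ((u ^ 3)⁻¹ * M)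
      + 2 * (β * u) / (u ^ 2 + β * u) * (A + B)) + 2 * (u ^ 2 + β * u) * (Δ + N₂)) :
    1 / T * S ≤ 4 * (β + 1) / u ^ 2 * Δ + 4 / u ^ 2 * ((β + 1) * N₂ + β * M)
      + 4 / u * ((β + 1) * N₁ + β * A + β * B) + C := by
  have hu0 : 0 < u := by linarith
  have h1 : u ^ 2 + β * u ≤ (β + 1) * u ^ 2 := by nlinarith [mul_nonneg hβ.le hu0.le]
  have h2 : 2 * (β * u) / (u ^ 2 + β * u) ≤ 2 * β / u := by
    rw [div_le_div_iff₀ (by positivity) hu0]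
    nlinarith [mul_pos hβ hu0, mul_pos hβ (mul_pos hβ hu0)]
  have h3 : S ≤ T * (2 * ((β + 1) * u ^ 2) * ((u ^ 3)⁻¹ * N₁) + 2 * (β * u) * ((u ^ 3)⁻¹ * M)
      + 2 * β / u * (A + B)) + 2 * ((β + 1) * u ^ 2) * (Δ + N₂) := by
    refine hS.trans ?_
    rw [hT]
    gcongr
  have h4 : 1 / T * S ≤ 1 / T * (T * (2 * ((β + 1) * u ^ 2) * ((u ^ 3)⁻¹ * N₁)
      + 2 * (β * u) * ((u ^ 3)⁻¹ * M) + 2 * β / u * (A + B))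
        + 2 * ((β + 1) * u ^ 2) * (Δ + N₂)) :=
    mul_le_mul_of_nonneg_left h3 (by rw [hT]; positivity)
  -- The averaged bound is exactly half of the three leading terms.
  have e : 1 / T * (T * (2 * ((β + 1) * u ^ 2) * ((u ^ 3)⁻¹ * N₁)
      + 2 * (β * u) * ((u ^ 3)⁻¹ * M) + 2 * β / u * (A + B))
        + 2 * ((β + 1) * u ^ 2) * (Δ + N₂))
      = 1 / 2 * (4 * (β + 1) / u ^ 2 * Δ + 4 / u ^ 2 * ((β + 1) * N₂ + β * M)
      + 4 / u * ((β + 1) * N₁ + β * A + β * B)) := by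
    rw [hT]
    field_simp
    ring
  rw [e] at h4
  have h5 : 0 ≤ 4 * (β + 1) / u ^ 2 * Δ + 4 / u ^ 2 * ((β + 1) * N₂ + β * M)
      + 4 / u * ((β + 1) * N₁ + β * A + β * B) := by positivity
  linarith

theorem corollary3p1
    {n p : ℕ} {Ω Ξ : Type*} [MeasurableSpace Ω] [MeasurableSpace Ξ]
    (hp : 1 ≤ p)
    (Q : StochProgram n p Ξ) (c : ProgConsts p) (hQ : Q.Assumptions c)
    (μ : Measure Ω) [IsProbabilityMeasure μ]
    -- the horizon and the parameters of the algorithm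
    (T : ℕ) (σ α τ : ℝ)
    (hσ : σ = (T : ℝ) ^ (-(3 / 4) : ℝ))
    (hα : α = c.β * (T : ℝ) ^ (1 / 4 : ℝ))
    (hτ : τ = (T : ℝ) ^ (1 / 2 : ℝ))
    (hT : max (c.β ^ 2) (max (c.β⁻¹ * p * (c.κg + c.κS * c.D₀ / 2) ^ 2) ((c.κS * c.γ₂) ^ 4))
      < (T : ℝ))
    (hκS : 0 < c.κS)
    (hκε : √(p : ℝ) * c.κS * c.D₀ ^ 2 ≤ c.ε₀)
    -- the i.i.d. samples `ξ_1, …, ξ_T`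
    (ξ : ℕ → Ω → Ξ)
    (hξ_meas : ∀ t, Measurable (ξ t))
    (hξ_law : ∀ t ∈ Icc 1 T, μ.map (ξ t) = Q.P)
    (hξ_indep : iIndepFun ξ μ)
    -- the run of the algorithm
    (x1 : RVec n) (hx1 : x1 ∈ Q.X₀)
    (Sig : ℕ → Fin p → Ω → Matrix (Fin n) (Fin n) ℝ)
    (x : ℕ → Ω → RVec n) (lam : ℕ → Ω → RVec p)
    (hrun : IsPMQSopt Q σ α τ T x1 ξ Sig x lam)
    -- `Σ_i^t ⪯ -L_i I` and `‖Σ_i^t‖ ≤ κ_Σ`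
    (hSig_le : ∀ t ∈ Icc 1 T, ∀ i ω,
      (-(c.L i) • (1 : Matrix (Fin n) (Fin n) ℝ) - Sig t i ω).PosSemidef)
    (hSig_norm : ∀ t ∈ Icc 1 T, ∀ i ω, ‖matOp (Sig t i ω)‖ ≤ c.κS)
    -- the output index: uniform on `{1, …, T}` and independent of the samples
    (R : Ω → ℕ) (hR_meas : Measurable R)
    (hR_law : μ.map R = uniformOn (Icc 1 T))
    (hR_indep : Indep (MeasurableSpace.comap R inferInstance) (history ξ T) μ) :
    -- the Moreau envelopes are differentiable at the iterates
    (∀ t ∈ Icc 1 T, ∀ ω, DifferentiableAt ℝ (Q.lagEnvelope α (lam t ω)) (x t ω)) ∧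
    -- (i) Lagrangian gradient violation
    Integrable (fun ω => ‖gradient (Q.lagEnvelope α (lam (R ω) ω)) (x (R ω) ω)‖ ^ 2) μ ∧
    (∫ ω, ‖gradient (Q.lagEnvelope α (lam (R ω) ω)) (x (R ω) ω)‖ ^ 2 ∂μ
      ≤ 4 * (c.β + 1) / (T : ℝ) ^ (1 / 2 : ℝ) * (Q.f x1 - sInf (Q.f '' Q.X₀))
        + 4 / (T : ℝ) ^ (1 / 2 : ℝ)
          * ((c.β + 1) * c.νg * c.γ₃ + c.β * c.D₀ * c.γ₂ * p * (c.κg + c.κS * c.D₀))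
        + 4 / (T : ℝ) ^ (1 / 4 : ℝ)
          * ((c.β + 1) * c.νg * c.γ₁
            + c.β * (c.κf + c.γ₂ * p * (c.κg + c.κS * c.D₀)) ^ 2
            + c.β * p * c.κg ^ 2 * c.γ₄ σ)
        + 8 * c.β / T * p * c.κg ^ 2 * c.γ₁ * c.γ₃
        + 4 * c.β / (T : ℝ) ^ (7 / 4 : ℝ) * c.γ₁ ^ 2 * p * c.κg ^ 2) ∧
    -- (ii) constraint violation
    (∀ i, Integrable (fun ω => Q.g i (x (R ω) ω)) μ ∧
      ∫ ω, Q.g i (x (R ω) ω) ∂μ ≤ c.γ₅ / (T : ℝ) ^ (1 / 4 : ℝ)) ∧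
    -- (iii) complementarity violation
    Integrable (fun ω => inner ℝ (lam (R ω) ω) (Q.gvec (x (R ω) ω))) μ ∧
    (-∫ ω, inner ℝ (lam (R ω) ω) (Q.gvec (x (R ω) ω)) ∂μ
      ≤ c.νg ^ 2 / (2 * (T : ℝ) ^ (3 / 4 : ℝ)) + c.κf ^ 2 / (2 * c.β * (T : ℝ) ^ (1 / 4 : ℝ))) := by
  have := hQ.isProb
  have hβT : c.β ^ 2 < T := (le_max_left _ _).trans_lt hT
  have hT0 : (0 : ℝ) < T := (sq_nonneg _).trans_lt hβT
  -- All real powers of `T` become natural powers of `u`, after which the bookkeeping is polynomial.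
  set u : ℝ := (T : ℝ) ^ (1 / 4 : ℝ) with hu_def
  have hu : 0 < u := Real.rpow_pos_of_pos hT0 _
  have hpow : ∀ k : ℕ, (T : ℝ) ^ ((k : ℝ) / 4) = u ^ k := fun k => by
    rw [hu_def, ← Real.rpow_mul_natCast hT0.le]
    congr 1
    ring
  have huT : u ^ 4 = T := by rw [← hpow]; norm_num
  have e2 : (T : ℝ) ^ (1 / 2 : ℝ) = u ^ 2 := by rw [← hpow]; norm_num
  have e3 : (T : ℝ) ^ (3 / 4 : ℝ) = u ^ 3 := by rw [← hpow]; norm_num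
  have e7 : (T : ℝ) ^ (7 / 4 : ℝ) = u ^ 7 := by rw [← hpow]; norm_num
  rw [Real.rpow_neg hT0.le, e3] at hσ
  rw [e2] at hτ
  subst hσ hα hτ
  obtain ⟨hu1, hβ1, H⟩ := IsSampledRun.of_rpow hp hQ hu huT hβT hκS hκε hξ_meas hξ_law hξ_indep
    hx1 hrun hSig_le hSig_norm
  have hβ : 0 < c.β := by linarith
  obtain ⟨-, hγ₄, hγ₃⟩ := H.moments_norm_lam_le le_rfl (by omega)
  replace hγ₄ := (integral_nonneg fun ω => sq_nonneg ‖lam 1 ω‖).trans hγ₄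
  have hγ₁ := H.γ₁_pos
  have hγ₂ := H.γ₂_pos
  have hνg := hQ.νg_pos
  have hκg := hQ.κg_pos
  have hD := hQ.D₀_pos
  have hT1 : 1 / (T : ℝ) * T = 1 := one_div_mul_cancel hT0.ne'
  refine ⟨fun t ht ω => (H.hasGradientAt_lagEnvelope ht.1 (by have := ht.2; omega)
    ω).differentiableAt, ?_⟩
  obtain ⟨hi, ei⟩ := H.integral_norm_gradient_sq_index hR_meas hR_law hR_indep
  obtain ⟨hi', ei'⟩ := H.integral_inner_index hR_meas hR_law hR_indep
  refine ⟨hi, ?_, fun i => ?_, hi', ?_⟩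
  -- The terms of order `T⁻¹` and `T^{-7/4}` are slack: they enter as the nonnegative remainder `C`.
  · rw [ei, e2, e7, add_assoc (_ + _ + _)]
    refine (gradient_bound_arith (N₁ := c.νg * c.γ₁) (N₂ := c.νg * c.γ₃)
      (M := c.D₀ * c.γ₂ * p * (c.κg + c.κS * c.D₀))
      (A := (c.κf + c.γ₂ * p * (c.κg + c.κS * c.D₀)) ^ 2) (B := p * c.κg ^ 2 * c.γ₄ (u ^ 3)⁻¹)
      (C := 8 * c.β / T * p * c.κg ^ 2 * c.γ₁ * c.γ₃
        + 4 * c.β / u ^ 7 * c.γ₁ ^ 2 * p * c.κg ^ 2)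
      (Δ := Q.f x1 - sInf (Q.f '' Q.X₀)) hu1 hβ huT.symm
      (sub_nonneg.2 H.sInf_image_le) (by positivity) (by positivity) (by positivity)
      (by positivity) (by positivity) (by positivity) ?_).trans (le_of_eq ?_)
    · refine H.sum_gradient_le.trans (le_of_eq ?_)
      ring
    · ring
  · obtain ⟨hg, eg⟩ := H.integral_g_index hR_meas hR_law hR_indep i
    refine ⟨hg, ?_⟩
    have h := H.sum_constraint_le i
    rw [← Finset.mul_sum] at h
    rw [eg, le_div_iff₀ hu, ProgConsts.γ₅]
    -- Since `u / T = u⁻³ = σ`, multiplying the average by `u` gives the sum that telescopes in the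
    -- multipliers.
    calc 1 / (T : ℝ) * (∑ t ∈ Finset.Icc 1 T, ∫ ω, Q.g i (x t ω) ∂μ) * u
        = (u ^ 3)⁻¹ * ∑ t ∈ Finset.Icc 1 T, ∫ ω, Q.g i (x t ω) ∂μ := by
          rw [← huT]
          field_simp
      _ ≤ _ := h
      _ = c.γ₃ + 1 / c.β * (c.ρ₁ + (c.νg + c.γ₃) * c.ρ₂) := by
          rw [← huT]
          field_simp
          ring
  · have h := mul_le_mul_of_nonneg_left H.sum_complementarity_le (by positivity : 0 ≤ 1 / (T : ℝ))
    rw [ei', e3]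
    rw [Finset.sum_neg_distrib, mul_neg, ← mul_assoc, hT1, one_mul] at h
    refine h.trans (le_of_eq ?_)
    field_simp
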